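/- Let $A\to M$ be a Lie algebroid of rank $n$ over a smooth manifold $M$ of dimension $m$, with anchor $\rho$ and bracket $[\,,\,]$, where $A$ and $M$ are orientable, and let $\phi_0\in\Omega^1(A)$ be a 1-cocycle of $A$, so that $(A,\phi_0)$ is a Jacobi algebroid. For nowhere vanishing $\eta\in\Gamma(\wedge^nA)$ and $\mu\in\Omega^m(M)$, the modular form $\xi_A^{\eta\otimes\mu}\in\Omega^1(A)$ of $A$ is the 1-form with $$\langle\xi_A^{\eta\otimes\mu},X\rangle\,\eta\otimes\mu=[X,\eta]\otimes\mu+\eta\otimes\mathcal L_{\rho(X)}\mu\qquad(X\in\Gamma(A)),$$ and the modular form of the Jacobi algebroid is $\xi_A^{\phi_0,\eta\otimes\mu}=\xi_A^{\eta\otimes\mu}-(n-1)\phi_0$. Their classes $[\xi_A],[\xi_A^{\phi_0}]\in H^1(A)$ do not depend on $\eta,\mu$. There is exactly one Lie algebroid structure on the vector bundle $\hat A=A\times\mathbb R\to M\times\mathbb R$ (the pullback of $A$ along $M\times\mathbb R\to M$) with anchor $\hat\rho(X)=\rho(X)+\langle\phi_0,X\rangle\,\partial/\partial t$ and whose bracket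 of time-independent sections is the bracket of $A$. For this structure, identifying forms and multivector fields on $A$ with time-independent ones on $\hat A$, the sections $\eta$ and $e^{-(n-1)t}\eta$ of $\wedge^n\hat A$ and the form $\mu\wedge dt$ on $M\times\mathbb R$ are smooth and nowhere vanishing, and $$\xi_{\hat A}^{\eta\otimes(\mu\wedge dt)}=\xi_A^{\eta\otimes\mu},\qquad \xi_{\hat A}^{\,e^{-(n-1)t}\eta\otimes(\mu\wedge dt)}=\xi_A^{\phi_0,\eta\otimes\mu}.$$ Pulling back forms induces a linear map $H^1(A)\to H^1(\hat A)$, and in $H^1(\hat A)$ $$[\xi_{\hat A}]=[\xi_A^{\phi_0}]=[\xi_A],$$ that is, the modular class of the Lie algebroid $\hat A$ equals the images of the modular class of the Jacobi algebroid $(A,\phi_0)$ and of the modular class of the Lie algebroid $A$. -/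

import Mathlib

open Bundle
open scoped Manifold ContDiff Topology

noncomputable section

set_option linter.unusedSectionVars false

/-! ## Smooth sections and forms -/

section Sections

variable {E : Type*} [NormedAddCommGroup E] [NormedSpace ℝ E]
  {H : Type*} [TopologicalSpace H] (I : ModelWithCorners ℝ E H)
  {M : Type*} [TopologicalSpace M] [ChartedSpace H M]
  (F : Type*) [NormedAddCommGroup F] [NormedSpace ℝ F]
  (A : M → Type*) [TopologicalSpace (TotalSpace F A)]
  [∀ x, AddCommGroup (A x)] [∀ x, Module ℝ (A x)] [∀ x, TopologicalSpace (A x)]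
  [FiberBundle F A]

/-- The space `𝔛¹(A) = Γ(A)` of smooth sections of the vector bundle `A`. -/
abbrev SmoothSection : Type _ := Cₛ^∞⟮I; F, A⟯

/-- The derivative `v f` of a function along a tangent vector `v`. -/
def dirDeriv {x : M} (v : TangentSpace I x) (f : M → ℝ) : ℝ := mfderiv I 𝓘(ℝ, ℝ) f x v

variable {I F A} in
/-- The product of a smooth function and a smooth section. -/
def smulSection [VectorBundle ℝ F A] (f : C^∞⟮I, M; ℝ⟯) (X : SmoothSection I F A) :
    SmoothSection I F A :=
  ⟨(f : M → ℝ) • (X : ∀ x, A x), f.contMDiff.smul_section X.contMDiff⟩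

/-- `Ω¹(A)`: the smooth `A`-1-forms, that is, families of linear forms on the fibres whose value on
every smooth section is a smooth function. -/
def oneForms : Submodule ℝ (∀ x, A x →ₗ[ℝ] ℝ) where
  carrier := {α | ∀ X : SmoothSection I F A, ContMDiff I 𝓘(ℝ, ℝ) ∞ fun x => α x (X x)}
  add_mem' ha hb X := (ha X).add (hb X)
  zero_mem' _ := contMDiff_const
  smul_mem' _ _ ha X := contMDiff_const.mul (ha X)

/-- Smoothness of an `A`-`n`-vector field. A section of `Λⁿ A` is a family of alternating `n`-linear
forms on the dual fibres; it is smooth when its values on smooth 1-forms are smooth. -/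
def IsSmoothMultivector {n : ℕ} (η : ∀ x, (A x →ₗ[ℝ] ℝ) [⋀^Fin n]→ₗ[ℝ] ℝ) : Prop :=
  ∀ α : Fin n → oneForms I F A, ContMDiff I 𝓘(ℝ, ℝ) ∞ fun x => η x fun i => (α i).1 x

/-- Smooth vector fields on the base. -/
abbrev SmoothVectorField (M : Type*) [TopologicalSpace M] [ChartedSpace H M]
    [IsManifold I ∞ M] : Type _ := Cₛ^∞⟮I; E, (TangentSpace I : M → Type _)⟯

/-- Smoothness of a differential `d`-form on the base. -/
def IsSmoothForm [IsManifold I ∞ M] {d : ℕ} (μ : ∀ x : M, (TangentSpace I x) [⋀^Fin d]→ₗ[ℝ] ℝ) :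
    Prop :=
  ∀ V : Fin d → SmoothVectorField I M, ContMDiff I 𝓘(ℝ, ℝ) ∞ fun x => μ x fun i => V i x

/-- A nowhere vanishing smooth `A`-`n`-vector field (used with `n` the rank of `A`). -/
structure IsTopSection {n : ℕ} (η : ∀ x, (A x →ₗ[ℝ] ℝ) [⋀^Fin n]→ₗ[ℝ] ℝ) : Prop where
  smooth : IsSmoothMultivector I F A η
  ne_zero : ∀ x, η x ≠ 0

/-- A nowhere vanishing smooth `d`-form on the base (used with `d` the dimension of the base). -/
structure IsVolumeForm [IsManifold I ∞ M] {d : ℕ}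
    (μ : ∀ x : M, (TangentSpace I x) [⋀^Fin d]→ₗ[ℝ] ℝ) : Prop where
  smooth : IsSmoothForm I μ
  ne_zero : ∀ x, μ x ≠ 0

/-- The Lie derivative of a `d`-form along a vector field, evaluated on smooth vector fields:
`(ℒ_V μ)(W₁, …, W_d) = V (μ(W₁, …, W_d)) - ∑ᵢ μ(W₁, …, [V, Wᵢ], …, W_d)`. -/
def lieDerivForm [IsManifold I ∞ M] {d : ℕ} (V : ∀ x : M, TangentSpace I x)
    (μ : ∀ x : M, (TangentSpace I x) [⋀^Fin d]→ₗ[ℝ] ℝ)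
    (W : Fin d → SmoothVectorField I M) (x : M) : ℝ :=
  dirDeriv I (V x) (fun y => μ y fun j => W j y) -
    ∑ i, μ x (Function.update (fun j => W j x) i (VectorField.mlieBracket I V (W i) x))

/-! ### Sections are localizable and have arbitrary values at a point -/

variable {I F A}
variable [VectorBundle ℝ F A] [ContMDiffVectorBundle ∞ F A I]
  [FiniteDimensional ℝ E] [FiniteDimensional ℝ F] [IsManifold I ∞ M] [T2Space M]

/-- A bump function supported where the bundle is trivial, times a section smooth there. -/
theorem exists_bump (x : M) : ∃ ψ : C^∞⟮I, M; ℝ⟯, ψ x = 1 ∧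
    tsupport ψ ⊆ (trivializationAt F A x).baseSet := by
  obtain ⟨g, -, hg⟩ := (SmoothBumpFunction.nhds_basis_tsupport (I := I) x).mem_iff.1
    ((trivializationAt F A x).open_baseSet.mem_nhds (FiberBundle.mem_baseSet_trivializationAt' x))
  exact ⟨⟨g, g.contMDiff⟩, g.eq_one, hg⟩

theorem exists_section_eq (x : M) (v : A x) : ∃ Y : SmoothSection I F A, Y x = v := by
  obtain ⟨ψ, hψ, hs⟩ := exists_bump (I := I) (F := F) (A := A) x
  set e := trivializationAt F A x
  have hx : x ∈ e.baseSet := FiberBundle.mem_baseSet_trivializationAt' x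
  let b := Module.finBasis ℝ F
  let σ : ∀ y, A y := fun y => ∑ i, (e.basisAt b hx).repr v i • e.localFrame b i y
  have hσ : ContMDiffOn I (I.prod 𝓘(ℝ, F)) ∞ (fun y => TotalSpace.mk' F y (σ y)) e.baseSet :=
    ContMDiffOn.sum_section fun i _ =>
      (e.contMDiffOn_localFrame_baseSet ∞ b i).const_smul_section
  refine ⟨⟨(ψ : M → ℝ) • σ, ContMDiffOn.smul_section_of_tsupport
    ψ.contMDiff.contMDiffOn e.open_baseSet hs hσ⟩, ?_⟩
  change ψ x • σ x = v
  rw [hψ, one_smul]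
  simp only [σ, e.localFrame_apply_of_mem_baseSet b hx]
  exact (e.basisAt b hx).sum_repr v

theorem eq_zero_of_tensorial (x : M) (Φ : SmoothSection I F A →ₗ[ℝ] ℝ)
    (hΦ : ∀ (f : C^∞⟮I, M; ℝ⟯) Y, Φ (smulSection f Y) = f x * Φ Y)
    (Y : SmoothSection I F A) (hY : Y x = 0) : Φ Y = 0 := by
  obtain ⟨ψ, hψ, hs⟩ := exists_bump (I := I) (F := F) (A := A) x
  set e := trivializationAt F A x
  have hx : x ∈ e.baseSet := FiberBundle.mem_baseSet_trivializationAt' x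
  let b := Module.finBasis ℝ F
  have : ContMDiffVectorBundle 1 F A I := ContMDiffVectorBundle.of_le (n := ∞) (by norm_cast)
  let s : Fin (Module.finrank ℝ F) → SmoothSection I F A := fun i =>
    ⟨(ψ : M → ℝ) • e.localFrame b i, ContMDiffOn.smul_section_of_tsupport
      ψ.contMDiff.contMDiffOn e.open_baseSet hs (e.contMDiffOn_localFrame_baseSet ∞ b i)⟩
  let c : Fin (Module.finrank ℝ F) → C^∞⟮I, M; ℝ⟯ := fun i =>
    ⟨fun y => ψ y • e.localFrameCoeff I b i y (Y y), by
      refine contMDiff_of_contMDiffOn_union_of_isOpen (t := (tsupport ψ)ᶜ)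
        (ψ.contMDiff.contMDiffOn.smul
        (contMDiffOn_baseSet_localFrameCoeff (e := e) b Y.contMDiff.contMDiffOn i)) ?_ ?_
        e.open_baseSet (isClosed_tsupport ψ).isOpen_compl
      · refine (contMDiffOn_const (c := (0 : ℝ))).congr fun y hy => ?_
        rw [image_eq_zero_of_notMem_tsupport hy, zero_smul]
      · rw [Set.eq_univ_iff_forall]
        intro y
        by_cases hy : y ∈ tsupport ψ
        · exact Or.inl (hs hy)
        · exact Or.inr hy⟩
  have key : smulSection ψ (smulSection ψ Y) = ∑ i, smulSection (c i) (s i) := by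
    ext y
    have h1 : (∑ i, smulSection (c i) (s i)) y = ∑ i, smulSection (c i) (s i) y := by
      have := congrFun (map_sum (ContMDiffSection.coeAddHom I F ∞ A)
        (fun i => smulSection (c i) (s i)) Finset.univ) y
      exact this.trans (Finset.sum_apply _ _ _)
    rw [h1]
    change ψ y • ψ y • Y y = ∑ i, (ψ y • e.localFrameCoeff I b i y (Y y)) •
      (ψ y • e.localFrame b i y)
    by_cases hy : y ∈ e.baseSet
    · conv_lhs => rw [e.eq_sum_localFrameCoeff_smul (I := I) (b := b) (s := Y) hy]
      simp only [Finset.smul_sum, smul_smul]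
      refine Finset.sum_congr rfl fun i _ => ?_
      congr 1
      simp only [smul_eq_mul]
      ring
    · have : ψ y = 0 := image_eq_zero_of_notMem_tsupport fun h => hy (hs h)
      simp [this]
  have h2 := congrArg Φ key
  rw [hΦ, hΦ, hψ, one_mul, one_mul, map_sum] at h2
  rw [h2]
  refine Finset.sum_eq_zero fun i _ => ?_
  rw [hΦ]
  change (ψ x • e.localFrameCoeff I b i x (Y x)) * _ = 0
  simp [hY]

end Sections

/-! ## Lie algebroids -/

/-- The quotient `Z / B` for `B ⊆ Z ⊆ V`. -/
abbrev Subquotient {V : Type*} [AddCommGroup V] [Module ℝ V] (Z B : Submodule ℝ V) : Type _ :=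
  Z ⧸ B.submoduleOf Z

section Algebroid

variable {E : Type*} [NormedAddCommGroup E] [NormedSpace ℝ E]
  {H : Type*} [TopologicalSpace H] (I : ModelWithCorners ℝ E H)
  {M : Type*} [TopologicalSpace M] [ChartedSpace H M] [IsManifold I ∞ M]
  (F : Type*) [NormedAddCommGroup F] [NormedSpace ℝ F]
  (A : M → Type*) [TopologicalSpace (TotalSpace F A)]
  [∀ x, AddCommGroup (A x)] [∀ x, Module ℝ (A x)] [∀ x, TopologicalSpace (A x)]
  [FiberBundle F A] [VectorBundle ℝ F A]

/-- A Lie algebroid structure on the vector bundle `A` over `M`: an anchor `ρ : A → TM` and a Lie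
bracket on `Γ(A)` satisfying the Leibniz rule `[X, fY] = f [X, Y] + (ρ(X) f) Y`, such that `ρ` is
a homomorphism to the Lie algebra of vector fields. -/
@[ext]
structure LieAlgebroid where
  anchor : ∀ x, A x →ₗ[ℝ] TangentSpace I x
  contMDiff_anchor : ∀ X : SmoothSection I F A,
    ContMDiff I I.tangent ∞ fun x => (⟨x, anchor x (X x)⟩ : TangentBundle I M)
  bracket : SmoothSection I F A →ₗ[ℝ] SmoothSection I F A →ₗ[ℝ] SmoothSection I F A
  bracket_self : ∀ X, bracket X X = 0
  jacobi : ∀ X Y Z,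
    bracket X (bracket Y Z) = bracket (bracket X Y) Z + bracket Y (bracket X Z)
  leibniz : ∀ (X : SmoothSection I F A) (f : C^∞⟮I, M; ℝ⟯) (Y : SmoothSection I F A) (x : M),
    bracket X (smulSection f Y) x =
      f x • bracket X Y x + dirDeriv I (anchor x (X x)) f • Y x
  anchor_bracket : ∀ (X Y : SmoothSection I F A) (x : M),
    anchor x (bracket X Y x) =
      VectorField.mlieBracket I (fun y => anchor y (X y)) (fun y => anchor y (Y y)) x

namespace LieAlgebroid

variable {I F A}
variable (L : LieAlgebroid I F A)

/-- `(ℒ_X f)(x) = (ρ(X) f)(x)`. -/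
def lieDerivFun (X : SmoothSection I F A) (f : M → ℝ) (x : M) : ℝ :=
  dirDeriv I (L.anchor x (X x)) f

theorem lieDerivFun_add (X : SmoothSection I F A) {f g : M → ℝ}
    (hf : ContMDiff I 𝓘(ℝ, ℝ) ∞ f) (hg : ContMDiff I 𝓘(ℝ, ℝ) ∞ g) (x : M) :
    L.lieDerivFun X (fun y => f y + g y) x = L.lieDerivFun X f x + L.lieDerivFun X g x := by
  have := mfderiv_add (hf.mdifferentiableAt (x := x) (by simp))
    (hg.mdifferentiableAt (x := x) (by simp))
  exact congrArg (fun T : TangentSpace I x →L[ℝ] ℝ => T (L.anchor x (X x))) this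

theorem lieDerivFun_mul (X : SmoothSection I F A) {f g : M → ℝ}
    (hf : ContMDiff I 𝓘(ℝ, ℝ) ∞ f) (hg : ContMDiff I 𝓘(ℝ, ℝ) ∞ g) (x : M) :
    L.lieDerivFun X (fun y => f y * g y) x =
      f x * L.lieDerivFun X g x + L.lieDerivFun X f x * g x := by
  have := ((hf.mdifferentiableAt (x := x) (by simp)).hasMFDerivAt.mul
    (hg.mdifferentiableAt (x := x) (by simp)).hasMFDerivAt).mfderiv
  have := congrArg (fun T : TangentSpace I x →L[ℝ] ℝ => T (L.anchor x (X x))) this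
  refine this.trans ?_
  change f x * L.lieDerivFun X g x + g x * L.lieDerivFun X f x = _
  ring

theorem lieDerivFun_const (X : SmoothSection I F A) (c : ℝ) (x : M) :
    L.lieDerivFun X (fun _ => c) x = 0 := by
  have := mfderiv_const (I := I) (I' := 𝓘(ℝ, ℝ)) (x := x) (c := c)
  exact congrArg (fun T : TangentSpace I x →L[ℝ] ℝ => T (L.anchor x (X x))) this

theorem lieDerivFun_const_mul (X : SmoothSection I F A) (c : ℝ) {g : M → ℝ}
    (hg : ContMDiff I 𝓘(ℝ, ℝ) ∞ g) (x : M) :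
    L.lieDerivFun X (fun y => c * g y) x = c * L.lieDerivFun X g x := by
  rw [L.lieDerivFun_mul X contMDiff_const hg, L.lieDerivFun_const, zero_mul, add_zero]

/-- The closed `A`-1-forms: `(d α)(X, Y) = ρ(X)(α(Y)) - ρ(Y)(α(X)) - α([X, Y]) = 0`. -/
def cocycles : Submodule ℝ (∀ x, A x →ₗ[ℝ] ℝ) where
  carrier := {α | α ∈ oneForms I F A ∧ ∀ (X Y : SmoothSection I F A) (x : M),
    L.lieDerivFun X (fun y => α y (Y y)) x - L.lieDerivFun Y (fun y => α y (X y)) x -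
      α x (L.bracket X Y x) = 0}
  add_mem' := by
    rintro α β ⟨hα, hα'⟩ ⟨hβ, hβ'⟩
    refine ⟨add_mem hα hβ, fun X Y x => ?_⟩
    have h1 := L.lieDerivFun_add X (hα Y) (hβ Y) x
    have h2 := L.lieDerivFun_add Y (hα X) (hβ X) x
    simp only [Pi.add_apply, LinearMap.add_apply, h1, h2]
    linarith [hα' X Y x, hβ' X Y x]
  zero_mem' := by
    refine ⟨zero_mem _, fun X Y x => ?_⟩
    simp [lieDerivFun_const]
  smul_mem' := by
    rintro c α ⟨hα, hα'⟩
    refine ⟨Submodule.smul_mem _ c hα, fun X Y x => ?_⟩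
    have h1 := L.lieDerivFun_const_mul X c (hα Y) x
    have h2 := L.lieDerivFun_const_mul Y c (hα X) x
    simp only [Pi.smul_apply, LinearMap.smul_apply, smul_eq_mul, h1, h2]
    linear_combination c * hα' X Y x

/-- The exact `A`-1-forms `d f`, where `(d f)(a) = ρ(a) f` for a smooth function `f`. -/
def coboundaries : Submodule ℝ (∀ x, A x →ₗ[ℝ] ℝ) where
  carrier := {α | ∃ f : C^∞⟮I, M; ℝ⟯, ∀ x (a : A x), α x a = dirDeriv I (L.anchor x a) f}
  add_mem' := by
    rintro α β ⟨f, hf⟩ ⟨g, hg⟩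
    refine ⟨f + g, fun x a => ?_⟩
    have := mfderiv_add (f.contMDiff.mdifferentiableAt (x := x) (by simp))
      (g.contMDiff.mdifferentiableAt (x := x) (by simp))
    have := congrArg (fun T : TangentSpace I x →L[ℝ] ℝ => T (L.anchor x a)) this
    simp only [Pi.add_apply, LinearMap.add_apply, hf, hg]
    exact this.symm
  zero_mem' := by
    refine ⟨0, fun x a => ?_⟩
    have := mfderiv_const (I := I) (I' := 𝓘(ℝ, ℝ)) (x := x) (c := (0 : ℝ))
    exact (congrArg (fun T : TangentSpace I x →L[ℝ] ℝ => T (L.anchor x a)) this).symm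
  smul_mem' := by
    rintro c α ⟨f, hf⟩
    refine ⟨c • f, fun x a => ?_⟩
    have := const_smul_mfderiv (f.contMDiff.mdifferentiableAt (x := x) (by simp)) c
    have := congrArg (fun T : TangentSpace I x →L[ℝ] ℝ => T (L.anchor x a)) this
    simp only [Pi.smul_apply, LinearMap.smul_apply, hf]
    exact this.symm

/-- The first Lie algebroid cohomology space `H¹(A)` with trivial coefficients. -/
abbrev H1 : Type _ := Subquotient L.cocycles L.coboundaries

/-- `α` is a closed 1-form and `c` is its cohomology class. -/
def HasClass (α : ∀ x, A x →ₗ[ℝ] ℝ) (c : L.H1) : Prop :=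
  ∃ h : α ∈ L.cocycles, Submodule.Quotient.mk ⟨α, h⟩ = c

section LieDerivative

variable [ContMDiffVectorBundle ∞ F A I] [FiniteDimensional ℝ E] [FiniteDimensional ℝ F] [T2Space M]

/-- For fixed `x`, the functional `Y ↦ ρ(X)(α(Y))(x) - α([X, Y])(x)`. -/
def lieDerivAux (X : SmoothSection I F A) (α : oneForms I F A) (x : M) :
    SmoothSection I F A →ₗ[ℝ] ℝ where
  toFun Y := L.lieDerivFun X (fun y => α.1 y (Y y)) x - α.1 x (L.bracket X Y x)
  map_add' Y Z := by
    have h := L.lieDerivFun_add X (α.2 Y) (α.2 Z) x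
    simp only [ContMDiffSection.coe_add, Pi.add_apply, map_add, h]
    ring
  map_smul' c Y := by
    have h := L.lieDerivFun_const_mul X c (α.2 Y) x
    simp only [ContMDiffSection.coe_smul, Pi.smul_apply, map_smul, smul_eq_mul, h,
      RingHom.id_apply]
    ring

theorem lieDerivAux_smul (X : SmoothSection I F A) (α : oneForms I F A) (x : M)
    (f : C^∞⟮I, M; ℝ⟯) (Y : SmoothSection I F A) :
    L.lieDerivAux X α x (smulSection f Y) = f x * L.lieDerivAux X α x Y := by
  have h := L.lieDerivFun_mul X f.contMDiff (α.2 Y) x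
  have h2 : (fun y => α.1 y (smulSection f Y y)) = fun y => f y * α.1 y (Y y) := by
    funext y
    exact (α.1 y).map_smul (f y) (Y y)
  change L.lieDerivFun X (fun y => α.1 y (smulSection f Y y)) x
    - α.1 x (L.bracket X (smulSection f Y) x) = f x *
    (L.lieDerivFun X (fun y => α.1 y (Y y)) x - α.1 x (L.bracket X Y x))
  rw [h2, h, L.leibniz, map_add, map_smul, map_smul, smul_eq_mul, smul_eq_mul]
  change _ - (_ + L.lieDerivFun X f x * _) = _
  ring

theorem lieDerivAux_congr (X : SmoothSection I F A) (α : oneForms I F A) (x : M)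
    {Y Z : SmoothSection I F A} (h : Y x = Z x) :
    L.lieDerivAux X α x Y = L.lieDerivAux X α x Z := by
  rw [← sub_eq_zero, ← map_sub]
  exact eq_zero_of_tensorial x _ (L.lieDerivAux_smul X α x) _ (by simp [h])

/-- The Lie derivative `ℒ_X α` of a 1-form along a section `X`, as a linear form on each fibre;
see `lieDerivOneForm_apply` for its value on sections. -/
def lieDerivOneForm (X : SmoothSection I F A) (α : oneForms I F A) (x : M) :
    A x →ₗ[ℝ] ℝ where
  toFun v := L.lieDerivAux X α x (exists_section_eq x v).choose
  map_add' v w := by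
    rw [← map_add]
    refine L.lieDerivAux_congr X α x ?_
    have h1 := (exists_section_eq (I := I) (F := F) x v).choose_spec
    have h2 := (exists_section_eq (I := I) (F := F) x w).choose_spec
    have h3 := (exists_section_eq (I := I) (F := F) x (v + w)).choose_spec
    simp [h1, h2, h3]
  map_smul' c v := by
    rw [RingHom.id_apply, ← map_smul]
    refine L.lieDerivAux_congr X α x ?_
    have h1 := (exists_section_eq (I := I) (F := F) x v).choose_spec
    have h3 := (exists_section_eq (I := I) (F := F) x (c • v)).choose_spec
    simp [h1, h3]

/-- `(ℒ_X α)(Y) = ρ(X)(α(Y)) - α([X, Y])`. -/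
theorem lieDerivOneForm_apply (X : SmoothSection I F A) (α : oneForms I F A)
    (Y : SmoothSection I F A) (x : M) :
    L.lieDerivOneForm X α x (Y x) =
      L.lieDerivFun X (fun y => α.1 y (Y y)) x - α.1 x (L.bracket X Y x) :=
  L.lieDerivAux_congr X α x (exists_section_eq (I := I) (F := F) x (Y x)).choose_spec

/-- The Lie derivative (Schouten bracket) `ℒ_X η = [X, η]` of an `n`-vector field, evaluated on
smooth 1-forms:
`(ℒ_X η)(α₁, …, αₙ) = ρ(X)(η(α₁, …, αₙ)) - ∑ᵢ η(α₁, …, ℒ_X αᵢ, …, αₙ)`. -/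
def lieDerivMultivector {n : ℕ} (X : SmoothSection I F A)
    (η : ∀ x, (A x →ₗ[ℝ] ℝ) [⋀^Fin n]→ₗ[ℝ] ℝ) (α : Fin n → oneForms I F A) (x : M) : ℝ :=
  L.lieDerivFun X (fun y => η y fun j => (α j).1 y) x -
    ∑ i, η x (Function.update (fun j => (α j).1 x) i (L.lieDerivOneForm X (α i) x))

/-- `ξ` is the modular form of the Lie algebroid with respect to `η ⊗ μ`: the 1-form with
`ξ(X) η ⊗ μ = ℒ_X η ⊗ μ + η ⊗ ℒ_{ρ(X)} μ` for all `X ∈ Γ(A)`. The identity of sections of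
`Λⁿ A ⊗ Λᵈ T*M` is expressed by evaluating both sides on `n` one-forms and `d` vector fields. -/
def IsModularForm {n d : ℕ} (η : ∀ x, (A x →ₗ[ℝ] ℝ) [⋀^Fin n]→ₗ[ℝ] ℝ)
    (μ : ∀ x : M, (TangentSpace I x) [⋀^Fin d]→ₗ[ℝ] ℝ) (ξ : ∀ x, A x →ₗ[ℝ] ℝ) : Prop :=
  ξ ∈ oneForms I F A ∧
  ∀ (X : SmoothSection I F A) (α : Fin n → oneForms I F A) (W : Fin d → SmoothVectorField I M)
    (x : M),
    ξ x (X x) * (η x (fun i => (α i).1 x) * μ x (fun j => W j x)) =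
      L.lieDerivMultivector X η α x * μ x (fun j => W j x) +
      η x (fun i => (α i).1 x) * lieDerivForm I (fun y => L.anchor y (X y)) μ W x

/-- `ζ` is the modular form `ξ_A^{η ⊗ μ} - (n - 1) φ₀` of the Jacobi algebroid `(A, φ₀)` of rank
`n` with respect to `η ⊗ μ`. -/
def IsJacobiModularForm {n d : ℕ} (φ₀ : ∀ x, A x →ₗ[ℝ] ℝ)
    (η : ∀ x, (A x →ₗ[ℝ] ℝ) [⋀^Fin n]→ₗ[ℝ] ℝ)
    (μ : ∀ x : M, (TangentSpace I x) [⋀^Fin d]→ₗ[ℝ] ℝ) (ζ : ∀ x, A x →ₗ[ℝ] ℝ) : Prop :=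
  ∃ ξ, L.IsModularForm η μ ξ ∧ ζ = ξ - ((n : ℝ) - 1) • φ₀

variable (n d : ℕ)

/-- `c ∈ H¹(A)` is the modular class of the Lie algebroid: for all nowhere vanishing top sections
`η` of `Λⁿ A` and volume forms `μ` there is exactly one modular form with respect to `η ⊗ μ`, it is
closed, and its class is `c`. Here `n` is the rank of `A` and `d` the dimension of the base. -/
def IsModularClass (c : L.H1) : Prop :=
  ∀ (η : ∀ x, (A x →ₗ[ℝ] ℝ) [⋀^Fin n]→ₗ[ℝ] ℝ) (μ : ∀ x : M, (TangentSpace I x) [⋀^Fin d]→ₗ[ℝ] ℝ),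
    IsTopSection I F A η → IsVolumeForm I μ →
      (∃! ξ, L.IsModularForm η μ ξ) ∧ ∀ ξ, L.IsModularForm η μ ξ → L.HasClass ξ c

/-- `c ∈ H¹(A)` is the modular class of the Jacobi algebroid `(A, φ₀)`. -/
def IsJacobiModularClass (φ₀ : ∀ x, A x →ₗ[ℝ] ℝ) (c : L.H1) : Prop :=
  ∀ (η : ∀ x, (A x →ₗ[ℝ] ℝ) [⋀^Fin n]→ₗ[ℝ] ℝ) (μ : ∀ x : M, (TangentSpace I x) [⋀^Fin d]→ₗ[ℝ] ℝ),
    IsTopSection I F A η → IsVolumeForm I μ →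
      (∃! ζ, L.IsJacobiModularForm φ₀ η μ ζ) ∧
        ∀ ζ, L.IsJacobiModularForm φ₀ η μ ζ → L.HasClass ζ c

end LieDerivative

end LieAlgebroid

end Algebroid

/-! ## The bundle `Â = A × ℝ` over `M × ℝ` -/

section Hat

variable {E : Type*} [NormedAddCommGroup E] [NormedSpace ℝ E]
  {H : Type*} [TopologicalSpace H] (I : ModelWithCorners ℝ E H)
  {M : Type*} [TopologicalSpace M] [ChartedSpace H M]
  (F : Type*) [NormedAddCommGroup F] [NormedSpace ℝ F]
  (A : M → Type*) [TopologicalSpace (TotalSpace F A)]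
  [∀ x, AddCommGroup (A x)] [∀ x, Module ℝ (A x)] [∀ x, TopologicalSpace (A x)]
  [FiberBundle F A]

/-- The vector bundle `Â = A × ℝ → M × ℝ`: the pullback of `A` along the projection `M × ℝ → M`. -/
abbrev HatBundle : M × ℝ → Type _ :=
  ⇑(ContMDiffMap.fst : C^∞⟮I.prod 𝓘(ℝ, ℝ), M × ℝ; I, M⟯) *ᵖ A

instance instAddCommGroupHatBundle (p : M × ℝ) : AddCommGroup (HatBundle I A p) :=
  inferInstanceAs (AddCommGroup (A p.1))

variable {F A}

/-- A section of `A`, seen as a time-independent section of `Â`. -/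
def hatSection [VectorBundle ℝ F A] (X : SmoothSection I F A) :
    SmoothSection (I.prod 𝓘(ℝ, ℝ)) F (HatBundle I A) where
  toFun p := X p.1
  contMDiff_toFun p := by
    have h := (contMDiffAt_section (s := X) p.1).1 (X.contMDiff p.1)
    exact (contMDiffAt_section (IB := I.prod 𝓘(ℝ, ℝ)) (E := HatBundle I A)
      (s := fun p : M × ℝ => X p.1) p).2 (h.comp p contMDiffAt_fst)

/-- A 1-form on `A`, seen as a time-independent 1-form on `Â`. -/
def hatOneForm (α : ∀ x, A x →ₗ[ℝ] ℝ) (p : M × ℝ) : HatBundle I A p →ₗ[ℝ] ℝ :=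
  α p.1

/-- An `n`-vector field on `A`, seen as a time-independent `n`-vector field on `Â`. -/
def hatMultivector {n : ℕ} (η : ∀ x, (A x →ₗ[ℝ] ℝ) [⋀^Fin n]→ₗ[ℝ] ℝ) (p : M × ℝ) :
    (HatBundle I A p →ₗ[ℝ] ℝ) [⋀^Fin n]→ₗ[ℝ] ℝ :=
  η p.1

/-- The `n`-vector field `e^{-(n-1)t} η` on `Â`. -/
def expHatMultivector {n : ℕ} (η : ∀ x, (A x →ₗ[ℝ] ℝ) [⋀^Fin n]→ₗ[ℝ] ℝ) (p : M × ℝ) :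
    (HatBundle I A p →ₗ[ℝ] ℝ) [⋀^Fin n]→ₗ[ℝ] ℝ :=
  Real.exp (-((n : ℝ) - 1) * p.2) • hatMultivector I η p

/-- The differential form `μ ∧ dt` on `M × ℝ`. -/
def wedgeDt {d : ℕ} (μ : ∀ x : M, (TangentSpace I x) [⋀^Fin d]→ₗ[ℝ] ℝ) (p : M × ℝ) :
    (TangentSpace (I.prod 𝓘(ℝ, ℝ)) p) [⋀^Fin (d + 1)]→ₗ[ℝ] ℝ :=
  let prμ : (TangentSpace (I.prod 𝓘(ℝ, ℝ)) p) [⋀^Fin d]→ₗ[ℝ] ℝ :=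
    (μ p.1).compLinearMap (mfderiv (I.prod 𝓘(ℝ, ℝ)) I Prod.fst p).toLinearMap
  let dt : (TangentSpace (I.prod 𝓘(ℝ, ℝ)) p) [⋀^Fin 1]→ₗ[ℝ] ℝ :=
    AlternatingMap.ofSubsingleton ℝ (TangentSpace (I.prod 𝓘(ℝ, ℝ)) p) ℝ (0 : Fin 1)
      (mfderiv (I.prod 𝓘(ℝ, ℝ)) 𝓘(ℝ, ℝ) Prod.snd p).toLinearMap
  ((LinearMap.mul' ℝ ℝ).compAlternatingMap (prμ.domCoprod dt)).domDomCongr finSumFinEquiv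

variable [IsManifold I ∞ M] [VectorBundle ℝ F A]
variable {I}

/-- `Lhat` is the Lie algebroid structure on `Â` induced from `A` by the 1-form `φ₀`: the anchor is
`ρ̂(X) = ρ(X) + ⟨φ₀, X⟩ ∂/∂t`, and the bracket of time-independent sections is that of `A`. -/
structure LieAlgebroid.IsInduced (L : LieAlgebroid I F A) (φ₀ : ∀ x, A x →ₗ[ℝ] ℝ)
    (Lhat : LieAlgebroid (I.prod 𝓘(ℝ, ℝ)) F (HatBundle I A)) : Prop where
  anchor_fst : ∀ (p : M × ℝ) (a : A p.1),
    mfderiv (I.prod 𝓘(ℝ, ℝ)) I Prod.fst p (Lhat.anchor p a) = L.anchor p.1 a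
  anchor_snd : ∀ (p : M × ℝ) (a : A p.1),
    mfderiv (I.prod 𝓘(ℝ, ℝ)) 𝓘(ℝ, ℝ) Prod.snd p (Lhat.anchor p a) = φ₀ p.1 a
  bracket_hat : ∀ X Y : SmoothSection I F A,
    Lhat.bracket (hatSection I X) (hatSection I Y) = hatSection I (L.bracket X Y)

end Hat

end

/-!
# Modular classes of a Jacobi algebroid and of the induced Lie algebroid on `A × ℝ`

The sections of a vector bundle and the sections of its dual are treated alike, as a
`SectionModule`. A derivation `D` of such a module (an operator with the Leibniz rule over a vector
field of the base) acts on forms `κ` of top degree. The defect of `D κ` being a multiple of `κ` is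
tensorial, and forms of top degree on a fibre are a line, so `D κ = (div D) κ` for a smooth function
`div D`, the divergence. Three facts about it suffice: adding a rank one endomorphism `l(·) w` to
`D` subtracts its trace `l(w)` (`Derivation.div_smul`), the divergence is a cocycle on commutators
(`Derivation.div_commutator`), and replacing `κ` by `f κ` adds the logarithmic derivative of `f`
(`Derivation.div_mul`).

For a section `X` of a Lie algebroid, the modular form takes the value
`div (ℒ_X on 1-forms) + div (ℒ_{ρ(X)} on vector fields)`. Under `X ↦ f X` the two summands change by
`∓ ρ(X) f`, so the sum is a 1-form; it is closed by the cocycle property, and its class does not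
depend on `η ⊗ μ` because the logarithmic derivatives are exact.

On `Â = A × ℝ` everything is tested on time-independent sections. These attain every value at every
point, so that tensorial identities (uniqueness of the structure, compatibility of the anchor, the
Jacobi identity, closedness of pullbacks) need only be checked on them; see `IsGenerating`. The
bracket of `Â` exists by the explicit formula
`[X, Y](x, t) = [X_t, Y_t](x) + ⟨φ₀, X⟩ ∂Y/∂t - ⟨φ₀, Y⟩ ∂X/∂t`. Lie derivatives of time-independent
objects along time-independent sections are pulled back from `M`, and `∂/∂t` commutes with
`ρ̂(X)`, so the modular form for `η ⊗ (μ ∧ dt)` is the pullback of the one of `A`. Rescaling `η` by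
`e^{-(n-1)t}` subtracts `(n - 1) dt`, which on `Â` is `(n - 1) φ₀`. Finally `φ₀` is the differential
of the function `t` on `Â`, hence its class dies under `H¹(A) → H¹(Â)`.
-/

noncomputable section

set_option linter.unusedSectionVars false

/-! ### Alternating forms of top degree -/

namespace AlternatingMap

variable {ι : Type*} [Fintype ι] [DecidableEq ι] {P V : Type*} [AddCommGroup P] [Module ℝ P]
  [AddCommGroup V] [Module ℝ V]

/-- The action of an endomorphism `T` on an alternating form by the Leibniz rule:
`v ↦ ∑ᵢ κ(v₁, …, T vᵢ, …, vₙ)`. -/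
def sumUpdate (κ : P [⋀^ι]→ₗ[ℝ] ℝ) (T : P →ₗ[ℝ] P) : P [⋀^ι]→ₗ[ℝ] ℝ where
  toMultilinearMap := ∑ i, κ.toMultilinearMap.compLinearMap
    (Function.update (fun _ => LinearMap.id) i T)
  map_eq_zero_of_eq' v i j hv hij := by
    have key : ∀ k, (fun l => (Function.update (fun _ => LinearMap.id) k T : ι → P →ₗ[ℝ] P) l (v l))
        = Function.update v k (T (v k)) := by
      intro k
      ext l
      by_cases h : l = k
      · subst h; simp
      · simp [h]
    simp only [MultilinearMap.toFun_eq_coe, _root_.sum_apply,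
      MultilinearMap.compLinearMap_apply, key]
    -- only the terms with index `i` and `j` survive, and they cancel
    rw [← Finset.sum_subset (Finset.subset_univ {i, j}), Finset.sum_pair hij]
    · have h2 : Function.update v j (T (v j)) =
          (Function.update v i (T (v i))) ∘ Equiv.swap i j := by
        ext l
        by_cases hl : l = i
        · subst hl; simp [hij, hij.symm, hv]
        · by_cases hl' : l = j
          · subst hl'; simp [hv]
          · simp [hl, hl', Equiv.swap_apply_of_ne_of_ne hl hl']
      change κ _ + κ _ = 0
      rw [h2, κ.map_swap _ hij, add_neg_cancel]
    · intro k _ hk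
      simp only [Finset.mem_insert, Finset.mem_singleton, not_or] at hk
      refine κ.map_eq_zero_of_eq _ ?_ hij
      rw [Function.update_of_ne (Ne.symm hk.1), Function.update_of_ne (Ne.symm hk.2), hv]

theorem sumUpdate_apply (κ : P [⋀^ι]→ₗ[ℝ] ℝ) (T : P →ₗ[ℝ] P) (v : ι → P) :
    κ.sumUpdate T v = ∑ i, κ (Function.update v i (T (v i))) := by
  change (∑ i, κ.toMultilinearMap.compLinearMap
    (Function.update (fun _ => LinearMap.id) i T) : MultilinearMap ℝ (fun _ : ι => P) ℝ) v = _
  rw [_root_.sum_apply]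
  refine Finset.sum_congr rfl fun k _ => ?_
  rw [MultilinearMap.compLinearMap_apply]
  change κ _ = κ _
  congr 1
  ext l
  by_cases h : l = k
  · subst h; simp
  · simp [h]

theorem sumUpdate_sumUpdate (κ : P [⋀^ι]→ₗ[ℝ] ℝ) (T S : P →ₗ[ℝ] P) (v : ι → P) :
    (κ.sumUpdate T).sumUpdate S v = κ.sumUpdate (T ∘ₗ S) v + ∑ i, ∑ j, if j = i then 0 else
      κ (Function.update (Function.update v i (S (v i))) j (T (v j))) := by
  simp only [sumUpdate_apply, ← Finset.sum_add_distrib]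
  refine Finset.sum_congr rfl fun i _ => ?_
  have h0 : κ (Function.update v i ((T ∘ₗ S) (v i))) =
      ∑ j, if j = i then κ (Function.update v i ((T ∘ₗ S) (v i))) else 0 := by simp
  rw [h0, ← Finset.sum_add_distrib]
  refine Finset.sum_congr rfl fun j _ => ?_
  by_cases h : j = i
  · subst h; simp
  · simp [h]

/-- The action of endomorphisms on forms reverses commutators. -/
theorem sumUpdate_commutator (κ : P [⋀^ι]→ₗ[ℝ] ℝ) (T S : P →ₗ[ℝ] P) (v : ι → P) :
    (κ.sumUpdate T).sumUpdate S v - (κ.sumUpdate S).sumUpdate T v =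
      κ.sumUpdate (T ∘ₗ S - S ∘ₗ T) v := by
  rw [sumUpdate_sumUpdate, sumUpdate_sumUpdate]
  conv_lhs => enter [2, 2]; rw [Finset.sum_comm]
  have h : ∀ i j, (if j = i then 0 else
      κ (Function.update (Function.update v i (S (v i))) j (T (v j)))) = if i = j then 0 else
      κ (Function.update (Function.update v j (T (v j))) i (S (v i))) := by
    intro i j
    by_cases h : j = i
    · simp [h]
    · rw [if_neg h, if_neg (Ne.symm h), Function.update_comm h]
  simp only [h, sumUpdate_apply, LinearMap.sub_apply, map_update_sub, Finset.sum_sub_distrib]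
  ring

/-- The forms of top degree are a line. -/
theorem exists_eq_mul_of_finrank_eq [FiniteDimensional ℝ V] {n : ℕ} (hn : Module.finrank ℝ V = n)
    {κ : V [⋀^Fin n]→ₗ[ℝ] ℝ} (hκ : κ ≠ 0) (Λ : V [⋀^Fin n]→ₗ[ℝ] ℝ) :
    ∃ c : ℝ, ∀ v, Λ v = c * κ v := by
  let e : Module.Basis (Fin n) ℝ V := Module.finBasisOfFinrankEq ℝ V hn
  have h1 := κ.eq_smul_basis_det e
  have h2 := Λ.eq_smul_basis_det e
  have h0 : κ e ≠ 0 := by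
    intro h
    rw [h, zero_smul] at h1
    exact hκ h1
  refine ⟨Λ e / κ e, fun v => ?_⟩
  have h3 : κ v = κ e * e.det v := congrArg (fun T : V [⋀^Fin n]→ₗ[ℝ] ℝ => T v) h1
  have h4 : Λ v = Λ e * e.det v := congrArg (fun T : V [⋀^Fin n]→ₗ[ℝ] ℝ => T v) h2
  rw [h3, h4]
  field_simp

theorem exists_basis_apply_ne_zero [FiniteDimensional ℝ V] {n : ℕ} (hn : Module.finrank ℝ V = n)
    {κ : V [⋀^Fin n]→ₗ[ℝ] ℝ} (hκ : κ ≠ 0) : ∃ e : Module.Basis (Fin n) ℝ V, κ e ≠ 0 := by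
  refine ⟨Module.finBasisOfFinrankEq ℝ V hn, fun h => hκ ?_⟩
  rw [κ.eq_smul_basis_det (Module.finBasisOfFinrankEq ℝ V hn), h, zero_smul]

/-- The trace of a rank one endomorphism, computed on a form of top degree. -/
theorem sum_mul_apply_update [FiniteDimensional ℝ V] {n : ℕ} (hn : Module.finrank ℝ V = n)
    (κ : V [⋀^Fin n]→ₗ[ℝ] ℝ) (l : V →ₗ[ℝ] ℝ) (w : V) (v : Fin n → V) :
    ∑ i, κ (Function.update v i (l (v i) • w)) = l w * κ v := by
  by_cases hκ : κ = 0
  · simp [hκ]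
  obtain ⟨e, he⟩ := exists_basis_apply_ne_zero hn hκ
  obtain ⟨c, hc⟩ := exists_eq_mul_of_finrank_eq hn hκ (κ.sumUpdate (l.smulRight w))
  have h1 := hc v
  have h2 := hc e
  rw [sumUpdate_apply] at h1 h2
  have h3 : ∀ i, κ (Function.update e i w) = e.repr w i * κ e := by
    intro i
    conv_lhs => rw [← e.sum_repr w]
    rw [κ.map_update_sum, Finset.sum_eq_single i]
    · rw [κ.map_update_smul, Function.update_eq_self, smul_eq_mul]
    · intro j _ hj
      rw [κ.map_update_smul, κ.map_update_self _ (Ne.symm hj), smul_zero]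
    · simp
  have h4 : c = l w := by
    simp only [LinearMap.smulRight_apply, map_update_smul, smul_eq_mul, h3] at h2
    apply mul_right_cancel₀ he
    rw [← h2]
    conv_rhs => rw [← e.sum_repr w, map_sum, Finset.sum_mul]
    refine Finset.sum_congr rfl fun i _ => ?_
    rw [map_smul, smul_eq_mul]
    ring
  rw [← h4, ← h1]
  rfl

/-- An alternating form which vanishes as soon as one argument lies in the kernel of the surjection
`ev` onto a space of dimension its degree is a multiple of the pullback of a given form. -/
theorem exists_eq_mul_of_ker [FiniteDimensional ℝ V] {n : ℕ} (hn : Module.finrank ℝ V = n)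
    {κ : V [⋀^Fin n]→ₗ[ℝ] ℝ} (hκ : κ ≠ 0) (ev : P →ₗ[ℝ] V) (hev : Function.Surjective ev)
    (Λ : P [⋀^Fin n]→ₗ[ℝ] ℝ) (hΛ : ∀ p i, ev (p i) = 0 → Λ p = 0) :
    ∃ a : ℝ, ∀ p, Λ p = a * κ fun i => ev (p i) := by
  obtain ⟨σ, hσ⟩ := ev.exists_rightInverse_of_surjective (LinearMap.range_eq_top.2 hev)
  obtain ⟨a, ha⟩ := exists_eq_mul_of_finrank_eq hn hκ (Λ.compLinearMap σ)
  refine ⟨a, fun p => ?_⟩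
  rw [← ha, compLinearMap_apply]
  have hσ' : ∀ v, ev (σ v) = v := fun v => congrArg (fun T : V →ₗ[ℝ] V => T v) hσ
  -- replace the arguments one at a time by the values of a section of `ev`
  have key : ∀ s : Finset (Fin n), Λ (s.piecewise (fun i => σ (ev (p i))) p) = Λ p := by
    intro s
    induction s using Finset.induction_on with
    | empty => simp
    | insert i s hi ih =>
      rw [← ih, Finset.piecewise_insert, ← sub_eq_zero]
      conv_lhs => rw [← Function.update_eq_self i (s.piecewise (fun i => σ (ev (p i))) p),
        Function.update_idem]
      rw [← map_update_sub]
      refine hΛ _ i ?_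
      simp [hi, hσ']
  simpa using (key Finset.univ).symm

end AlternatingMap

/-! ### Vector fields as derivations -/

section Calculus

variable {E : Type*} [NormedAddCommGroup E] [NormedSpace ℝ E]
  {H : Type*} [TopologicalSpace H] {I : ModelWithCorners ℝ E H}
  {M : Type*} [TopologicalSpace M] [ChartedSpace H M]

theorem dirDeriv_add {x : M} (v : TangentSpace I x) {f g : M → ℝ}
    (hf : ContMDiff I 𝓘(ℝ, ℝ) ∞ f) (hg : ContMDiff I 𝓘(ℝ, ℝ) ∞ g) :
    dirDeriv I v (fun y => f y + g y) = dirDeriv I v f + dirDeriv I v g :=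
  congrArg (fun T : TangentSpace I x →L[ℝ] ℝ => T v) (mfderiv_add
    (hf.mdifferentiableAt (x := x) (by simp)) (hg.mdifferentiableAt (x := x) (by simp)))

theorem dirDeriv_mul {x : M} (v : TangentSpace I x) {f g : M → ℝ}
    (hf : ContMDiff I 𝓘(ℝ, ℝ) ∞ f) (hg : ContMDiff I 𝓘(ℝ, ℝ) ∞ g) :
    dirDeriv I v (fun y => f y * g y) = f x * dirDeriv I v g + dirDeriv I v f * g x := by
  have := ((hf.mdifferentiableAt (x := x) (by simp)).hasMFDerivAt.mul
    (hg.mdifferentiableAt (x := x) (by simp)).hasMFDerivAt).mfderiv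
  have := congrArg (fun T : TangentSpace I x →L[ℝ] ℝ => T v) this
  refine this.trans ?_
  change f x * dirDeriv I v g + g x * dirDeriv I v f = _
  ring

theorem dirDeriv_const {x : M} (v : TangentSpace I x) (c : ℝ) :
    dirDeriv I v (fun _ : M => c) = 0 :=
  congrArg (fun T : TangentSpace I x →L[ℝ] ℝ => T v)
    (mfderiv_const (I := I) (I' := 𝓘(ℝ, ℝ)) (x := x) (c := c))

theorem dirDeriv_const_mul {x : M} (v : TangentSpace I x) (c : ℝ) {f : M → ℝ}
    (hf : ContMDiff I 𝓘(ℝ, ℝ) ∞ f) :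
    dirDeriv I v (fun y => c * f y) = c * dirDeriv I v f := by
  rw [dirDeriv_mul v contMDiff_const hf, dirDeriv_const, zero_mul, add_zero]

theorem dirDeriv_sub {x : M} (v : TangentSpace I x) {f g : M → ℝ}
    (hf : ContMDiff I 𝓘(ℝ, ℝ) ∞ f) (hg : ContMDiff I 𝓘(ℝ, ℝ) ∞ g) :
    dirDeriv I v (fun y => f y - g y) = dirDeriv I v f - dirDeriv I v g := by
  have h : (fun y => f y - g y) = fun y => f y + (-1) * g y := by ext; ring
  rw [h, dirDeriv_add (g := fun y => (-1) * g y) v hf (contMDiff_const.mul hg),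
    dirDeriv_const_mul v _ hg]
  ring

theorem dirDeriv_sum {x : M} (v : TangentSpace I x) {ι : Type*} (s : Finset ι) {f : ι → M → ℝ}
    (hf : ∀ i, ContMDiff I 𝓘(ℝ, ℝ) ∞ (f i)) :
    dirDeriv I v (fun y => ∑ i ∈ s, f i y) = ∑ i ∈ s, dirDeriv I v (f i) := by
  classical
  induction s using Finset.induction_on with
  | empty => simpa using dirDeriv_const v 0
  | insert i s hi ih =>
    simp only [Finset.sum_insert hi]
    rw [dirDeriv_add v (hf i) (contMDiff_finsetSum fun j _ => hf j), ih]

theorem dirDeriv_congr {x : M} (v : TangentSpace I x) {f g : M → ℝ} (h : f =ᶠ[𝓝 x] g) :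
    dirDeriv I v f = dirDeriv I v g :=
  congrArg (fun T : TangentSpace I x →L[ℝ] ℝ => T v) h.mfderiv_eq

theorem dirDeriv_add_left {x : M} (v w : TangentSpace I x) (f : M → ℝ) :
    dirDeriv I (v + w) f = dirDeriv I v f + dirDeriv I w f :=
  (mfderiv I 𝓘(ℝ, ℝ) f x).map_add v w

theorem dirDeriv_smul_left {x : M} (c : ℝ) (v : TangentSpace I x) (f : M → ℝ) :
    dirDeriv I (c • v) f = c * dirDeriv I v f :=
  (mfderiv I 𝓘(ℝ, ℝ) f x).map_smul c v

theorem dirDeriv_zero_left {x : M} (f : M → ℝ) :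
    dirDeriv I (0 : TangentSpace I x) f = 0 :=
  (mfderiv I 𝓘(ℝ, ℝ) f x).map_zero

/-- The differential of a function at `x`, as a linear form on the tangent space. -/
def differentialAt (f : M → ℝ) (x : M) : TangentSpace I x →ₗ[ℝ] ℝ where
  toFun v := dirDeriv I v f
  map_add' v w := dirDeriv_add_left v w f
  map_smul' c v := dirDeriv_smul_left c v f

variable [IsManifold I ∞ M]

theorem contMDiff_dirDeriv {v : ∀ x : M, TangentSpace I x}
    (hv : ContMDiff I I.tangent ∞ fun x => (⟨x, v x⟩ : TangentBundle I M)) {f : M → ℝ}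
    (hf : ContMDiff I 𝓘(ℝ, ℝ) ∞ f) : ContMDiff I 𝓘(ℝ, ℝ) ∞ fun x => dirDeriv I (v x) f := by
  have h1 : ContMDiff I.tangent 𝓘(ℝ, ℝ).tangent ∞ (tangentMap I 𝓘(ℝ, ℝ) f) :=
    hf.contMDiff_tangentMap (by simp)
  have h2 := contMDiff_snd_tangentBundle_modelSpace ℝ 𝓘(ℝ, ℝ) (n := ∞)
  exact h2.comp (h1.comp hv)

/-- The Lie bracket of smooth vector fields. -/
def vfBracket [CompleteSpace E] (V W : SmoothVectorField I M) : SmoothVectorField I M :=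
  ⟨VectorField.mlieBracket I V W, by
    have : IsManifold I (((⊤ : ℕ∞) : WithTop ℕ∞) + 1) M :=
      (inferInstance : IsManifold I ∞ M)
    have : IsManifold I (minSmoothness ℝ 2) M := by
      simpa using (IsManifold.of_le (n := ∞) (by norm_cast) : IsManifold I 2 M)
    exact ContDiff.mlieBracket_vectorField (m := ⊤) (n := ⊤) V.contMDiff W.contMDiff (by simp)⟩

theorem vfBracket_smul_right [CompleteSpace E] (V W : SmoothVectorField I M) (f : C^∞⟮I, M; ℝ⟯)
    (x : M) : vfBracket V (smulSection f W) x =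
      f x • vfBracket V W x + dirDeriv I (V x) f • W x := by
  have := VectorField.mlieBracket_smul_right (V := V) (W := W) (f := f) (x := x)
    (f.contMDiff.mdifferentiableAt (by simp)) (W.mdifferentiableAt)
  rw [add_comm]
  exact this

theorem vfBracket_add_right [CompleteSpace E] (V W U : SmoothVectorField I M) (x : M) :
    vfBracket V (W + U) x = vfBracket V W x + vfBracket V U x :=
  VectorField.mlieBracket_add_right W.mdifferentiableAt U.mdifferentiableAt

theorem vfBracket_add_left [CompleteSpace E] (V W U : SmoothVectorField I M) (x : M) :
    vfBracket (V + W) U x = vfBracket V U x + vfBracket W U x :=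
  VectorField.mlieBracket_add_left V.mdifferentiableAt W.mdifferentiableAt

theorem vfBracket_swap [CompleteSpace E] (V W : SmoothVectorField I M) (x : M) :
    vfBracket V W x = - vfBracket W V x :=
  VectorField.mlieBracket_swap_apply

theorem vfBracket_smul_left [CompleteSpace E] (V W : SmoothVectorField I M) (f : C^∞⟮I, M; ℝ⟯)
    (x : M) : vfBracket (smulSection f V) W x =
      f x • vfBracket V W x - dirDeriv I (W x) f • V x := by
  rw [vfBracket_swap, vfBracket_smul_right, vfBracket_swap W V]
  module

theorem vfBracket_jacobi [CompleteSpace E] (U V W : SmoothVectorField I M) (x : M) :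
    vfBracket U (vfBracket V W) x =
      vfBracket (vfBracket U V) W x + vfBracket V (vfBracket U W) x := by
  have : IsManifold I (minSmoothness ℝ 3) M := by
    simpa using (IsManifold.of_le (n := ∞) (by norm_cast) : IsManifold I 3 M)
  refine VectorField.leibniz_identity_mlieBracket_apply ?_ ?_ ?_ <;>
  · simp only [minSmoothness_of_isRCLikeNormedField]
    refine (ContMDiffSection.contMDiff _ x).of_le (by norm_cast)

/-- The Lie bracket of vector fields acts on functions as the commutator of derivations: both sides
are the coefficient of `U` in the Jacobi identity for `V`, `W`, `f U`. -/
theorem dirDeriv_vfBracket [FiniteDimensional ℝ E] [CompleteSpace E] [T2Space M]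
    (V W : SmoothVectorField I M)
    {f : M → ℝ} (hf : ContMDiff I 𝓘(ℝ, ℝ) ∞ f) (x : M) :
    dirDeriv I (vfBracket V W x) f =
      dirDeriv I (V x) (fun y => dirDeriv I (W y) f) -
        dirDeriv I (W x) (fun y => dirDeriv I (V y) f) := by
  -- the comparison of coefficients needs a nonzero tangent vector
  by_cases hE : ∀ u : TangentSpace I x, u = 0
  · rw [hE (vfBracket V W x), hE (V x), hE (W x)]
    simp only [dirDeriv_zero_left, sub_zero]
  push Not at hE
  obtain ⟨u, hu⟩ := hE
  obtain ⟨U, rfl⟩ := exists_section_eq (I := I) (F := E) (A := (TangentSpace I : M → Type _)) x u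
  let f' : C^∞⟮I, M; ℝ⟯ := ⟨f, hf⟩
  let Vf : C^∞⟮I, M; ℝ⟯ := ⟨_, contMDiff_dirDeriv V.contMDiff hf⟩
  let Wf : C^∞⟮I, M; ℝ⟯ := ⟨_, contMDiff_dirDeriv W.contMDiff hf⟩
  have hW : vfBracket W (smulSection f' U) = smulSection f' (vfBracket W U) + smulSection Wf U :=
    ContMDiffSection.ext fun y => vfBracket_smul_right W U f' y
  have hV : vfBracket V (smulSection f' U) = smulSection f' (vfBracket V U) + smulSection Vf U :=
    ContMDiffSection.ext fun y => vfBracket_smul_right V U f' y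
  have h := vfBracket_jacobi V W (smulSection f' U) x
  have hj := vfBracket_jacobi V W U x
  rw [hW, hV] at h
  simp only [vfBracket_add_right, vfBracket_smul_right] at h
  rw [hj] at h
  have h2 : (dirDeriv I (V x) Wf - dirDeriv I (W x) Vf - dirDeriv I (vfBracket V W x) f') • U x
      = 0 := by
    rw [← sub_eq_zero] at h
    rw [← h]
    change _ = f x • (_ + _) + dirDeriv I (V x) f • _ + (dirDeriv I (W x) f • _ + _) -
      (f x • _ + _ + (f x • _ + dirDeriv I (W x) f • _ + (dirDeriv I (V x) f • _ + _)))
    module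
  have h3 := (smul_eq_zero.1 h2).resolve_right hu
  change dirDeriv I (V x) Wf - dirDeriv I (W x) Vf - dirDeriv I (vfBracket V W x) f = 0 at h3
  change _ = dirDeriv I (V x) Wf - dirDeriv I (W x) Vf
  linarith

/-- Smooth functions separate tangent vectors. -/
theorem eq_of_forall_dirDeriv_eq [FiniteDimensional ℝ E] [T2Space M] {x : M}
    {v w : TangentSpace I x}
    (h : ∀ f : M → ℝ, ContMDiff I 𝓘(ℝ, ℝ) ∞ f → dirDeriv I v f = dirDeriv I w f) : v = w := by
  obtain ⟨g⟩ : Nonempty (SmoothBumpFunction I x) := inferInstance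
  have hinv := isInvertible_mfderiv_extChartAt (I := I) (mem_extChartAt_source (I := I) x)
  have hinj : Function.Injective (mfderiv I 𝓘(ℝ, E) (extChartAt I x) x) := by
    obtain ⟨T, hT⟩ := hinv
    rw [← hT]
    exact T.injective
  apply hinj
  -- test against the coordinate functions, cut off by a bump function
  rw [← sub_eq_zero, ← Module.forall_dual_apply_eq_zero_iff ℝ]
  intro l
  let l' : E →L[ℝ] ℝ := LinearMap.toContinuousLinearMap l
  have hc : ContMDiffOn I 𝓘(ℝ, E) ∞ (extChartAt I x) (chartAt H x).source :=
    contMDiffOn_extChartAt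
  have hs : ContMDiffOn I 𝓘(ℝ, ℝ) ∞ (fun y => l' (extChartAt I x y)) (chartAt H x).source :=
    l'.contMDiff.comp_contMDiffOn hc
  have key := h _ (g.contMDiff_smul hs)
  have hev : (fun y => g y • l' (extChartAt I x y)) =ᶠ[𝓝 x] fun y => l' (extChartAt I x y) := by
    filter_upwards [g.eventuallyEq_one] with y hy
    simp [hy]
  have hd : ∀ u : TangentSpace I x, dirDeriv I u (fun y => l' (extChartAt I x y)) =
      l (mfderiv I 𝓘(ℝ, E) (extChartAt I x) x u) := by
    intro u
    have h1 := mfderiv_comp (I := I) (I' := 𝓘(ℝ, E)) (I'' := 𝓘(ℝ, ℝ)) x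
      (g := l') (f := extChartAt I x) l'.differentiableAt.mdifferentiableAt
      (mdifferentiableAt_extChartAt (mem_chart_source H x))
    rw [mfderiv_eq_fderiv, l'.fderiv] at h1
    exact congrArg (fun T : TangentSpace I x →L[ℝ] ℝ => T u) h1
  rw [dirDeriv_congr v hev, dirDeriv_congr w hev, hd, hd] at key
  exact ((l : TangentSpace 𝓘(ℝ, E) (extChartAt I x x) →ₗ[ℝ] ℝ).map_sub _ _).trans
    (sub_eq_zero.2 key)

end Calculus

/-! ### Modules of sections and divergences -/

section SectionModule

variable {E : Type*} [NormedAddCommGroup E] [NormedSpace ℝ E]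
  {H : Type*} [TopologicalSpace H] (I : ModelWithCorners ℝ E H)
  {M : Type*} [TopologicalSpace M] [ChartedSpace H M]

/-- The space `P` of global sections of a vector bundle with fibres `V`, presented by its
evaluation maps and its multiplication by functions. The last axiom says that up to a factor
equal to `1` at `x` every section is a combination of finitely many fixed ones, with coefficients
vanishing at `x` if the section does. It makes it possible to treat `Γ(A)` and `Ω¹(A)` alike. -/
structure SectionModule (P : Type*) [AddCommGroup P] [Module ℝ P] (V : M → Type*)
    [∀ x, AddCommGroup (V x)] [∀ x, Module ℝ (V x)] where
  ev : ∀ x, P →ₗ[ℝ] V x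
  smul : C^∞⟮I, M; ℝ⟯ → P → P
  ev_smul : ∀ f p x, ev x (smul f p) = f x • ev x p
  ext : ∀ p q, (∀ x, ev x p = ev x q) → p = q
  surjective : ∀ x, Function.Surjective (ev x)
  exists_frame : ∀ x, ∃ (ψ : C^∞⟮I, M; ℝ⟯) (r : ℕ) (q : Fin r → P), ψ x = 1 ∧
    ∀ p, ∃ c : Fin r → C^∞⟮I, M; ℝ⟯, (ev x p = 0 → ∀ i, c i x = 0) ∧
      smul ψ p = ∑ i, smul (c i) (q i)

namespace SectionModule

variable {I} {P : Type*} [AddCommGroup P] [Module ℝ P] {V : M → Type*}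
    [∀ x, AddCommGroup (V x)] [∀ x, Module ℝ (V x)] (S : SectionModule I P V)

theorem eq_zero_of_tensorial {x : M} {W : Type*} [AddCommGroup W] [Module ℝ W] (Φ : P →ₗ[ℝ] W)
    (hΦ : ∀ f p, Φ (S.smul f p) = f x • Φ p) {p : P} (hp : S.ev x p = 0) : Φ p = 0 := by
  obtain ⟨ψ, r, q, hψ, hq⟩ := S.exists_frame x
  obtain ⟨c, hc, h⟩ := hq p
  have h2 := congrArg Φ h
  rw [hΦ, hψ, one_smul, map_sum] at h2
  rw [h2]
  refine Finset.sum_eq_zero fun i _ => ?_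
  rw [hΦ, hc hp, zero_smul]

/-- A functional on sections which is linear over functions at `x` comes from the fibre at `x`. -/
theorem exists_eq_comp_ev {x : M} {W : Type*} [AddCommGroup W] [Module ℝ W] (Φ : P →ₗ[ℝ] W)
    (hΦ : ∀ f p, Φ (S.smul f p) = f x • Φ p) : ∃ φ : V x →ₗ[ℝ] W, ∀ p, φ (S.ev x p) = Φ p := by
  obtain ⟨σ, hσ⟩ := (S.ev x).exists_rightInverse_of_surjective
    (LinearMap.range_eq_top.2 (S.surjective x))
  refine ⟨Φ ∘ₗ σ, fun p => ?_⟩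
  rw [LinearMap.comp_apply, ← sub_eq_zero, ← map_sub]
  refine S.eq_zero_of_tensorial Φ hΦ ?_
  rw [map_sub, sub_eq_zero]
  exact congrArg (fun T : V x →ₗ[ℝ] V x => T (S.ev x p)) hσ

/-- A smooth form of degree `n` on the bundle. -/
def IsSmooth {n : ℕ} (κ : ∀ x, V x [⋀^Fin n]→ₗ[ℝ] ℝ) : Prop :=
  ∀ p : Fin n → P, ContMDiff I 𝓘(ℝ, ℝ) ∞ fun x => κ x fun i => S.ev x (p i)

theorem exists_apply_ne_zero {n : ℕ} {x : M} {κ : V x [⋀^Fin n]→ₗ[ℝ] ℝ} (hκ : κ ≠ 0) :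
    ∃ p : Fin n → P, κ (fun i => S.ev x (p i)) ≠ 0 := by
  by_contra! h
  apply hκ
  ext v
  choose p hp using fun i => S.surjective x (v i)
  have := h p
  simp only [hp] at this
  simpa using this

variable [IsManifold I ∞ M]

/-- A derivation of the bundle: an operator `∇` on sections with the Leibniz rule
`∇(f p) = f ∇p + (v f) p` for a smooth vector field `v` on the base. -/
structure Derivation where
  field : SmoothVectorField I M
  nabla : P →ₗ[ℝ] P
  leibniz : ∀ f p x, S.ev x (nabla (S.smul f p)) =
    f x • S.ev x (nabla p) + dirDeriv I (field x) f • S.ev x p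

variable {S} {n : ℕ}

/-- The Lie derivative of a form along a derivation:
`(D κ)(p₁, …, pₙ) = v(κ(p₁, …, pₙ)) - ∑ᵢ κ(p₁, …, ∇pᵢ, …, pₙ)`. -/
def Derivation.lie (D : S.Derivation) (κ : ∀ x, V x [⋀^Fin n]→ₗ[ℝ] ℝ) (p : Fin n → P) (x : M) : ℝ :=
  dirDeriv I (D.field x) (fun y => κ y fun i => S.ev y (p i)) -
    ∑ i, κ x (Function.update (fun j => S.ev x (p j)) i (S.ev x (D.nabla (p i))))

theorem ev_update (x : M) (p : Fin n → P) (i : Fin n) (q : P) :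
    (fun j => S.ev x (Function.update p i q j)) =
      Function.update (fun j => S.ev x (p j)) i (S.ev x q) := by
  ext j
  by_cases h : j = i
  · subst h; simp
  · simp [h]

theorem Derivation.lie_eq (D : S.Derivation) (κ : ∀ x, V x [⋀^Fin n]→ₗ[ℝ] ℝ) (p : Fin n → P)
    (x : M) : D.lie κ p x = dirDeriv I (D.field x) (fun y => κ y fun i => S.ev y (p i)) -
      ∑ i, κ x (fun j => S.ev x (Function.update p i (D.nabla (p i)) j)) := by
  simp only [ev_update]
  rfl

theorem Derivation.contMDiff_lie (D : S.Derivation) {κ : ∀ x, V x [⋀^Fin n]→ₗ[ℝ] ℝ}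
    (hκ : S.IsSmooth κ) (p : Fin n → P) : ContMDiff I 𝓘(ℝ, ℝ) ∞ (D.lie κ p) := by
  have h : D.lie κ p = fun x => dirDeriv I (D.field x) (fun y => κ y fun i => S.ev y (p i)) -
      ∑ i, κ x (fun j => S.ev x (Function.update p i (D.nabla (p i)) j)) :=
    funext fun x => D.lie_eq κ p x
  rw [h]
  exact (contMDiff_dirDeriv D.field.contMDiff (hκ p)).sub
    (contMDiff_finsetSum fun i _ => hκ _)

/-- The Lie derivative at `x`, as an alternating form on sections. -/
def Derivation.lieAlt (D : S.Derivation) {κ : ∀ x, V x [⋀^Fin n]→ₗ[ℝ] ℝ}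
    (hκ : S.IsSmooth κ) (x : M) : P [⋀^Fin n]→ₗ[ℝ] ℝ :=
  { toFun := fun p => dirDeriv I (D.field x) (fun y => κ y fun i => S.ev y (p i))
    map_update_add' := by
      intro dec p i a b
      obtain rfl : dec = instDecidableEqFin n := Subsingleton.elim _ _
      have h : (fun y => κ y fun j => S.ev y (Function.update p i (a + b) j)) =
          fun y => (κ y fun j => S.ev y (Function.update p i a j)) +
            κ y fun j => S.ev y (Function.update p i b j) := by
        funext y
        simp only [ev_update, map_add, AlternatingMap.map_update_add]
      rw [h, dirDeriv_add _ (hκ _) (hκ _)]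
    map_update_smul' := by
      intro dec p i c a
      obtain rfl : dec = instDecidableEqFin n := Subsingleton.elim _ _
      have h : (fun y => κ y fun j => S.ev y (Function.update p i (c • a) j)) =
          fun y => c * (κ y fun j => S.ev y (Function.update p i a j)) := by
        funext y
        simp only [ev_update, map_smul, AlternatingMap.map_update_smul, smul_eq_mul]
      rw [h, dirDeriv_const_mul _ _ (hκ _), smul_eq_mul]
    map_eq_zero_of_eq' := by
      intro p i j hp hij
      have h : (fun y => κ y fun l => S.ev y (p l)) = fun _ => 0 := by
        funext y
        exact (κ y).map_eq_zero_of_eq _ (congrArg (S.ev y) hp) hij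
      rw [h, dirDeriv_const] } - ((κ x).compLinearMap (S.ev x)).sumUpdate D.nabla

theorem Derivation.lieAlt_apply (D : S.Derivation) {κ : ∀ x, V x [⋀^Fin n]→ₗ[ℝ] ℝ}
    (hκ : S.IsSmooth κ) (x : M) (p : Fin n → P) : D.lieAlt hκ x p = D.lie κ p x := by
  rw [D.lie_eq, lieAlt, AlternatingMap.sub_apply, AlternatingMap.sumUpdate_apply]
  rfl

/-- The Lie derivative is linear over functions in each argument. -/
theorem Derivation.lie_update_smul (D : S.Derivation) {κ : ∀ x, V x [⋀^Fin n]→ₗ[ℝ] ℝ}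
    (hκ : S.IsSmooth κ) (x : M) (p : Fin n → P) (i : Fin n) (f : C^∞⟮I, M; ℝ⟯) (q : P) :
    D.lie κ (Function.update p i (S.smul f q)) x = f x * D.lie κ (Function.update p i q) x := by
  simp only [Derivation.lie, ev_update, S.ev_smul, AlternatingMap.map_update_smul, smul_eq_mul]
  have h1 := hκ (Function.update p i q)
  simp only [ev_update] at h1
  rw [dirDeriv_mul _ f.contMDiff h1, mul_sub, Finset.mul_sum]
  have h2 : ∀ j, κ x (Function.update (Function.update (fun j => S.ev x (p j)) i
        (f x • S.ev x q)) j (S.ev x (D.nabla (Function.update p i (S.smul f q) j)))) =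
      f x * κ x (Function.update (Function.update (fun j => S.ev x (p j)) i
        (S.ev x q)) j (S.ev x (D.nabla (Function.update p i q j)))) +
      if j = i then dirDeriv I (D.field x) f * κ x (Function.update (fun j => S.ev x (p j)) i
        (S.ev x q)) else 0 := by
    intro j
    by_cases hj : j = i
    · subst hj
      simp [D.leibniz, AlternatingMap.map_update_add, AlternatingMap.map_update_smul]
    · simp only [hj, if_false, add_zero, Function.update_of_ne hj]
      rw [Function.update_comm (Ne.symm hj), AlternatingMap.map_update_smul, smul_eq_mul,
        Function.update_comm (Ne.symm hj)]
  simp only [h2, Finset.sum_add_distrib, Finset.sum_ite_eq', Finset.mem_univ, if_true]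
  ring

theorem Derivation.lie_eq_zero (D : S.Derivation) {κ : ∀ x, V x [⋀^Fin n]→ₗ[ℝ] ℝ}
    (hκ : S.IsSmooth κ) (x : M) (p : Fin n → P) (i : Fin n) (hp : S.ev x (p i) = 0) :
    D.lie κ p x = 0 := by
  have := S.eq_zero_of_tensorial (x := x) ((D.lieAlt hκ x).toMultilinearMap.toLinearMap p i)
    (fun f q => ?_) hp
  · rw [← Function.update_eq_self i p, ← D.lieAlt_apply hκ]
    exact this
  · change D.lieAlt hκ x _ = _ • D.lieAlt hκ x _
    rw [D.lieAlt_apply, D.lieAlt_apply, D.lie_update_smul hκ, smul_eq_mul]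

variable (S) in
/-- A nowhere vanishing smooth form of degree the rank of the bundle. -/
structure IsVolume (κ : ∀ x, V x [⋀^Fin n]→ₗ[ℝ] ℝ) : Prop where
  smooth : S.IsSmooth κ
  ne_zero : ∀ x, κ x ≠ 0
  finrank : ∀ x, Module.finrank ℝ (V x) = n
  finite : ∀ x, FiniteDimensional ℝ (V x)

variable {κ : ∀ x, V x [⋀^Fin n]→ₗ[ℝ] ℝ}

/-- A function that is smooth after multiplication with all values of a volume form is smooth. -/
theorem IsVolume.contMDiff_of_mul (hκ : S.IsVolume κ) {a : M → ℝ}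
    (h : ∀ p : Fin n → P, ContMDiff I 𝓘(ℝ, ℝ) ∞ fun x => a x * κ x fun i => S.ev x (p i)) :
    ContMDiff I 𝓘(ℝ, ℝ) ∞ a := by
  intro x
  obtain ⟨p, hp⟩ := S.exists_apply_ne_zero (hκ.ne_zero x)
  have h1 := hκ.smooth p
  have h2 : ContMDiffAt I 𝓘(ℝ, ℝ) ∞
      (fun y => (a y * κ y fun i => S.ev y (p i)) / κ y fun i => S.ev y (p i)) x :=
    (h p x).div₀ (h1 x) hp
  refine h2.congr_of_eventuallyEq ?_
  filter_upwards [h1.continuous.continuousAt.eventually_ne hp] with y hy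
  field_simp

/-- By tensoriality the Lie derivative of a form of top degree lives on the fibres, where the forms
of top degree are a line. -/
theorem Derivation.exists_div (D : S.Derivation) (hκ : S.IsVolume κ) :
    ∃ a : C^∞⟮I, M; ℝ⟯, ∀ p x, D.lie κ p x = a x * κ x fun i => S.ev x (p i) := by
  have h : ∀ x, ∃ a : ℝ, ∀ p, D.lie κ p x = a * κ x fun i => S.ev x (p i) := by
    intro x
    have := hκ.finite x
    obtain ⟨a, ha⟩ := AlternatingMap.exists_eq_mul_of_ker (hκ.finrank x) (hκ.ne_zero x) (S.ev x)
      (S.surjective x) (D.lieAlt hκ.smooth x) fun p i hp => by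
        rw [D.lieAlt_apply, D.lie_eq_zero hκ.smooth x p i hp]
    exact ⟨a, fun p => by rw [← D.lieAlt_apply hκ.smooth, ha]⟩
  choose a ha using h
  refine ⟨⟨a, hκ.contMDiff_of_mul fun p => ?_⟩, fun p x => ha x p⟩
  simp only [← ha]
  exact D.contMDiff_lie hκ.smooth p

/-- The divergence of a derivation with respect to a volume form `κ`: the function `a` with
`D κ = a κ`. -/
def Derivation.div (D : S.Derivation) (hκ : S.IsVolume κ) : C^∞⟮I, M; ℝ⟯ :=
  (D.exists_div hκ).choose

theorem Derivation.lie_eq_div_mul (D : S.Derivation) (hκ : S.IsVolume κ) (p : Fin n → P) (x : M) :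
    D.lie κ p x = D.div hκ x * κ x fun i => S.ev x (p i) :=
  (D.exists_div hκ).choose_spec p x

theorem Derivation.div_eq (D : S.Derivation) (hκ : S.IsVolume κ) {x : M} {a : ℝ}
    (h : ∀ p, D.lie κ p x = a * κ x fun i => S.ev x (p i)) : D.div hκ x = a := by
  obtain ⟨p, hp⟩ := S.exists_apply_ne_zero (hκ.ne_zero x)
  apply mul_right_cancel₀ hp
  rw [← h, D.lie_eq_div_mul]

theorem Derivation.div_add (D D₁ D₂ : S.Derivation) (hκ : S.IsVolume κ)
    (hf : ∀ x, D.field x = D₁.field x + D₂.field x)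
    (hn : ∀ p x, S.ev x (D.nabla p) = S.ev x (D₁.nabla p) + S.ev x (D₂.nabla p)) (x : M) :
    D.div hκ x = D₁.div hκ x + D₂.div hκ x := by
  refine D.div_eq hκ fun p => ?_
  rw [add_mul, ← D₁.lie_eq_div_mul, ← D₂.lie_eq_div_mul]
  simp only [lie, hf, hn, dirDeriv_add_left, AlternatingMap.map_update_add,
    Finset.sum_add_distrib]
  ring

/-- If `D' = f D + l(·) w` with a rank one endomorphism `l(·) w`, then
`div D' = f div D - l(w)`. -/
theorem Derivation.div_smul (D D' : S.Derivation) (hκ : S.IsVolume κ) {x : M} (c : ℝ)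
    (l : V x →ₗ[ℝ] ℝ) (w : V x) (hf : D'.field x = c • D.field x)
    (hn : ∀ p, S.ev x (D'.nabla p) = c • S.ev x (D.nabla p) + l (S.ev x p) • w) :
    D'.div hκ x = c * D.div hκ x - l w := by
  have := hκ.finite x
  refine D'.div_eq hκ fun p => ?_
  rw [sub_mul, mul_assoc, ← D.lie_eq_div_mul,
    ← AlternatingMap.sum_mul_apply_update (hκ.finrank x) (κ x) l w]
  simp only [lie, hf, hn, dirDeriv_smul_left, AlternatingMap.map_update_add,
    Finset.sum_add_distrib, mul_sub, Finset.mul_sum, AlternatingMap.map_update_smul, smul_eq_mul]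
  ring

/-- Rescaling the volume form by `f` adds the logarithmic derivative of `f` to the divergence. -/
theorem Derivation.div_mul (D : S.Derivation) {κ' : ∀ x, V x [⋀^Fin n]→ₗ[ℝ] ℝ}
    (hκ : S.IsVolume κ) (hκ' : S.IsVolume κ') (f : C^∞⟮I, M; ℝ⟯)
    (h : ∀ x, κ' x = f x • κ x) (x : M) :
    f x * D.div hκ' x = f x * D.div hκ x + dirDeriv I (D.field x) f := by
  obtain ⟨p, hp⟩ := S.exists_apply_ne_zero (hκ.ne_zero x)
  apply mul_right_cancel₀ hp
  have h1 : f x * D.div hκ' x * (κ x fun i => S.ev x (p i)) = D.lie κ' p x := by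
    rw [D.lie_eq_div_mul hκ', h, AlternatingMap.smul_apply, smul_eq_mul]
    ring
  rw [h1, add_mul, mul_assoc, ← D.lie_eq_div_mul]
  simp only [lie, h, AlternatingMap.smul_apply, smul_eq_mul]
  rw [dirDeriv_mul _ f.contMDiff (hκ.smooth p), ← Finset.mul_sum]
  ring

theorem Derivation.dirDeriv_apply (D : S.Derivation) (hκ : S.IsVolume κ) (p : Fin n → P) (x : M) :
    dirDeriv I (D.field x) (fun y => κ y fun i => S.ev y (p i)) =
      D.div hκ x * (κ x).compLinearMap (S.ev x) p +
        ((κ x).compLinearMap (S.ev x)).sumUpdate D.nabla p := by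
  have h := D.lie_eq_div_mul hκ p x
  rw [D.lie_eq] at h
  rw [AlternatingMap.sumUpdate_apply]
  exact sub_eq_iff_eq_add.1 h

/-- The second derivative of the function `κ(p₁, …, pₙ)`. The terms other than those with
`v₁(div D₂)` and the iterated action on `κ` are symmetric in the two derivations. -/
theorem Derivation.dirDeriv_dirDeriv_apply (D₁ D₂ : S.Derivation) (hκ : S.IsVolume κ)
    (p : Fin n → P) (x : M) :
    dirDeriv I (D₁.field x) (fun z => dirDeriv I (D₂.field z) fun y => κ y fun i => S.ev y (p i)) =
      dirDeriv I (D₁.field x) (D₂.div hκ) * (κ x).compLinearMap (S.ev x) p +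
      D₂.div hκ x * (D₁.div hκ x * (κ x).compLinearMap (S.ev x) p +
        ((κ x).compLinearMap (S.ev x)).sumUpdate D₁.nabla p) +
      (D₁.div hκ x * ((κ x).compLinearMap (S.ev x)).sumUpdate D₂.nabla p +
        (((κ x).compLinearMap (S.ev x)).sumUpdate D₁.nabla).sumUpdate D₂.nabla p) := by
  have h : (fun z => dirDeriv I (D₂.field z) fun y => κ y fun i => S.ev y (p i)) = fun z =>
      (D₂.div hκ z * κ z fun i => S.ev z (p i)) +
        ∑ i, κ z fun j => S.ev z (Function.update p i (D₂.nabla (p i)) j) := by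
    funext z
    rw [D₂.dirDeriv_apply hκ, AlternatingMap.sumUpdate_apply]
    rfl
  rw [h, dirDeriv_add (f := fun z => D₂.div hκ z * κ z fun i => S.ev z (p i)) _
    ((D₂.div hκ).contMDiff.mul (hκ.smooth p))
    (contMDiff_finsetSum fun i _ => hκ.smooth _), dirDeriv_mul _ (D₂.div hκ).contMDiff
    (hκ.smooth p), dirDeriv_sum _ _ (fun i => hκ.smooth _)]
  simp only [D₁.dirDeriv_apply hκ, Finset.sum_add_distrib, ← Finset.mul_sum]
  rw [AlternatingMap.sumUpdate_apply _ D₂.nabla p, AlternatingMap.sumUpdate_apply _ D₂.nabla p]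
  simp only [AlternatingMap.compLinearMap_apply]
  ring

/-- The divergence is a cocycle: `div [D₁, D₂] = v₁(div D₂) - v₂(div D₁)`. -/
theorem Derivation.div_commutator (D D₁ D₂ : S.Derivation) (hκ : S.IsVolume κ)
    (hf : ∀ (f : M → ℝ) x, ContMDiff I 𝓘(ℝ, ℝ) ∞ f → dirDeriv I (D.field x) f =
      dirDeriv I (D₁.field x) (fun z => dirDeriv I (D₂.field z) f) -
        dirDeriv I (D₂.field x) (fun z => dirDeriv I (D₁.field z) f))
    (hn : ∀ p, D.nabla p = D₁.nabla (D₂.nabla p) - D₂.nabla (D₁.nabla p)) (x : M) :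
    D.div hκ x = dirDeriv I (D₁.field x) (D₂.div hκ) - dirDeriv I (D₂.field x) (D₁.div hκ) := by
  refine D.div_eq hκ fun p => ?_
  rw [D.lie_eq, hf _ _ (hκ.smooth p), D₁.dirDeriv_dirDeriv_apply D₂ hκ,
    D₂.dirDeriv_dirDeriv_apply D₁ hκ]
  have h1 := ((κ x).compLinearMap (S.ev x)).sumUpdate_commutator D₁.nabla D₂.nabla p
  have h2 : D.nabla = D₁.nabla ∘ₗ D₂.nabla - D₂.nabla ∘ₗ D₁.nabla := LinearMap.ext hn
  rw [← h2, AlternatingMap.sumUpdate_apply _ D.nabla] at h1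
  simp only [AlternatingMap.compLinearMap_apply] at h1 ⊢
  linarith

theorem IsVolume.exists_smul (hκ : S.IsVolume κ) {κ' : ∀ x, V x [⋀^Fin n]→ₗ[ℝ] ℝ}
    (hκ' : S.IsVolume κ') : ∃ f : C^∞⟮I, M; ℝ⟯, (∀ x, f x ≠ 0) ∧ ∀ x, κ' x = f x • κ x := by
  have h : ∀ x, ∃ c : ℝ, ∀ v, κ' x v = c * κ x v := fun x => by
    have := hκ.finite x
    exact AlternatingMap.exists_eq_mul_of_finrank_eq (hκ.finrank x) (hκ.ne_zero x) (κ' x)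
  choose f hf using h
  refine ⟨⟨f, hκ.contMDiff_of_mul fun p => ?_⟩, fun x hx => hκ'.ne_zero x ?_, fun x => ?_⟩
  · simp only [← hf]
    exact hκ'.smooth p
  · ext v
    have hx' : f x = 0 := hx
    rw [hf, hx', zero_mul, AlternatingMap.zero_apply]
  · ext v
    exact hf x v

end SectionModule

end SectionModule

/-! ### Frames, sections and 1-forms of a vector bundle -/

section Frames

variable {E : Type*} [NormedAddCommGroup E] [NormedSpace ℝ E]
  {H : Type*} [TopologicalSpace H] {I : ModelWithCorners ℝ E H}
  {M : Type*} [TopologicalSpace M] [ChartedSpace H M]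
  {F : Type*} [NormedAddCommGroup F] [NormedSpace ℝ F]
  {A : M → Type*} [TopologicalSpace (TotalSpace F A)]
  [∀ x, AddCommGroup (A x)] [∀ x, Module ℝ (A x)] [∀ x, TopologicalSpace (A x)]
  [FiberBundle F A]

theorem ContMDiffSection.sum_apply [VectorBundle ℝ F A] {ι : Type*} (s : Finset ι)
    (X : ι → SmoothSection I F A)
    (x : M) : (∑ i ∈ s, X i) x = ∑ i ∈ s, X i x :=
  (congrFun (map_sum (ContMDiffSection.coeAddHom I F ∞ A) X s) x).trans (Finset.sum_apply _ _ _)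

variable (F A) in
theorem VectorBundle.finrank_fiber [VectorBundle ℝ F A] (x : M) :
    Module.finrank ℝ (A x) = Module.finrank ℝ F :=
  ((trivializationAt F A x).continuousLinearEquivAt ℝ x
    (FiberBundle.mem_baseSet_trivializationAt' x)).toLinearEquiv.finrank_eq

variable (F A) in
theorem VectorBundle.finiteDimensional_fiber [VectorBundle ℝ F A] [FiniteDimensional ℝ F] (x : M) :
    FiniteDimensional ℝ (A x) :=
  ((trivializationAt F A x).continuousLinearEquivAt ℝ x
    (FiberBundle.mem_baseSet_trivializationAt' x)).symm.toLinearEquiv.finiteDimensional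

variable [VectorBundle ℝ F A] [ContMDiffVectorBundle ∞ F A I]
  [FiniteDimensional ℝ E] [FiniteDimensional ℝ F] [IsManifold I ∞ M] [T2Space M]

variable (I F A) in
/-- A local frame and its dual frame at `x`, both cut off by the same function `ψ`. -/
theorem exists_section_frame (x : M) : ∃ (ψ : C^∞⟮I, M; ℝ⟯) (r : ℕ)
    (s : Fin r → SmoothSection I F A) (θ : Fin r → oneForms I F A), ψ x = 1 ∧
    ∀ y (v : A y), (ψ y * ψ y) • v = ∑ i, (θ i).1 y v • s i y := by
  obtain ⟨ψ, hψ, hs⟩ := exists_bump (I := I) (F := F) (A := A) x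
  set e := trivializationAt F A x
  let b := Module.finBasis ℝ F
  have : ContMDiffVectorBundle 1 F A I := ContMDiffVectorBundle.of_le (n := ∞) (by norm_cast)
  refine ⟨ψ, _, fun i => ⟨(ψ : M → ℝ) • e.localFrame b i, ContMDiffOn.smul_section_of_tsupport
      ψ.contMDiff.contMDiffOn e.open_baseSet hs (e.contMDiffOn_localFrame_baseSet ∞ b i)⟩,
    fun i => ⟨fun y => ψ y • e.localFrameCoeff I b i y, fun Y => ?_⟩, hψ, fun y v => ?_⟩
  · refine contMDiff_of_contMDiffOn_union_of_isOpen (t := (tsupport ψ)ᶜ)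
        (ψ.contMDiff.contMDiffOn.smul
        (contMDiffOn_baseSet_localFrameCoeff (e := e) b Y.contMDiff.contMDiffOn i)) ?_ ?_
        e.open_baseSet (isClosed_tsupport ψ).isOpen_compl
    · refine (contMDiffOn_const (c := (0 : ℝ))).congr fun y hy => ?_
      change ψ y • e.localFrameCoeff I b i y (Y y) = 0
      rw [image_eq_zero_of_notMem_tsupport hy, zero_smul]
    · rw [Set.eq_univ_iff_forall]
      intro y
      by_cases hy : y ∈ tsupport ψ
      · exact Or.inl (hs hy)
      · exact Or.inr hy
  · change (ψ y * ψ y) • v = ∑ i, (ψ y • e.localFrameCoeff I b i y v) • (ψ y • e.localFrame b i y)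
    by_cases hy : y ∈ e.baseSet
    · obtain ⟨Y, rfl⟩ := exists_section_eq (I := I) (F := F) y v
      conv_lhs => rw [e.eq_sum_localFrameCoeff_smul (I := I) (b := b) (s := Y) hy]
      simp only [Finset.smul_sum, smul_smul]
      refine Finset.sum_congr rfl fun i _ => ?_
      congr 1
      simp only [smul_eq_mul]
      ring
    · have : ψ y = 0 := image_eq_zero_of_notMem_tsupport fun h => hy (hs h)
      simp [this]

variable (I F A) in
/-- The sections of `A`, as a module of sections. -/
def sectionModule : SectionModule I (SmoothSection I F A) A where
  ev x := { toFun := fun X => X x, map_add' := fun _ _ => rfl, map_smul' := fun _ _ => rfl }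
  smul f X := smulSection f X
  ev_smul _ _ _ := rfl
  ext _ _ h := ContMDiffSection.ext h
  surjective x v := exists_section_eq x v
  exists_frame x := by
    obtain ⟨ψ, r, s, θ, hψ, h⟩ := exists_section_frame I F A x
    refine ⟨ψ * ψ, r, s, ?_, fun X => ⟨fun i => ⟨_, (θ i).2 X⟩, fun hX i => ?_, ?_⟩⟩
    · change ψ x * ψ x = 1
      rw [hψ, one_mul]
    · change (θ i).1 x (X x) = 0
      rw [show X x = 0 from hX, map_zero]
    · refine ContMDiffSection.ext fun y => ?_
      rw [ContMDiffSection.sum_apply]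
      exact h y (X y)

/-- The product of a smooth function and a 1-form. -/
def smulOneForm (f : C^∞⟮I, M; ℝ⟯) (α : oneForms I F A) : oneForms I F A :=
  ⟨fun x => f x • α.1 x, fun X => f.contMDiff.mul (α.2 X)⟩

variable (I F A) in
theorem exists_oneForm_eq (x : M) (l : A x →ₗ[ℝ] ℝ) : ∃ α : oneForms I F A, α.1 x = l := by
  obtain ⟨ψ, r, s, θ, hψ, h⟩ := exists_section_frame I F A x
  refine ⟨∑ i, l (s i x) • θ i, ?_⟩
  rw [Submodule.coe_sum, Finset.sum_apply]
  ext v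
  have h1 := congrArg l (h x v)
  rw [hψ, one_mul, one_smul, map_sum] at h1
  rw [h1, LinearMap.sum_apply]
  refine Finset.sum_congr rfl fun i _ => ?_
  rw [map_smul, smul_eq_mul, mul_comm]
  rfl

variable (I F A) in
/-- The 1-forms on `A`, as a module of sections of the dual bundle. -/
def formModule : SectionModule I (oneForms I F A) (fun x => A x →ₗ[ℝ] ℝ) where
  ev x := { toFun := fun α => α.1 x, map_add' := fun _ _ => rfl, map_smul' := fun _ _ => rfl }
  smul f α := smulOneForm f α
  ev_smul _ _ _ := rfl
  ext _ _ h := Subtype.ext (funext h)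
  surjective x l := exists_oneForm_eq I F A x l
  exists_frame x := by
    obtain ⟨ψ, r, s, θ, hψ, h⟩ := exists_section_frame I F A x
    refine ⟨ψ * ψ, r, θ, ?_, fun α => ⟨fun i => ⟨_, α.2 (s i)⟩, fun hα i => ?_, ?_⟩⟩
    · change ψ x * ψ x = 1
      rw [hψ, one_mul]
    · change α.1 x (s i x) = 0
      rw [show α.1 x = 0 from hα, LinearMap.zero_apply]
    · refine Subtype.ext (funext fun y => LinearMap.ext fun v => ?_)
      rw [Submodule.coe_sum, Finset.sum_apply, LinearMap.sum_apply]
      have h1 := congrArg (α.1 y) (h y v)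
      rw [map_smul, map_sum] at h1
      refine Eq.trans h1 (Finset.sum_congr rfl fun i _ => ?_)
      rw [map_smul, smul_eq_mul, mul_comm]
      rfl

theorem IsTopSection.isVolume {n : ℕ} (hn : Module.finrank ℝ F = n)
    {η : ∀ x, (A x →ₗ[ℝ] ℝ) [⋀^Fin n]→ₗ[ℝ] ℝ} (h : IsTopSection I F A η) :
    (formModule I F A).IsVolume η where
  smooth := h.smooth
  ne_zero := h.ne_zero
  finrank x := by
    have := VectorBundle.finiteDimensional_fiber F A x
    rw [Subspace.dual_finrank_eq, VectorBundle.finrank_fiber F A, hn]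
  finite x := by
    have := VectorBundle.finiteDimensional_fiber F A x
    infer_instance

theorem IsVolumeForm.isVolume {d : ℕ} (hd : Module.finrank ℝ E = d)
    {μ : ∀ x : M, (TangentSpace I x) [⋀^Fin d]→ₗ[ℝ] ℝ} (h : IsVolumeForm I μ) :
    (sectionModule I E (TangentSpace I : M → Type _)).IsVolume μ where
  smooth := h.smooth
  ne_zero := h.ne_zero
  finrank _ := hd
  finite _ := inferInstanceAs (FiniteDimensional ℝ E)

variable [CompleteSpace E]

/-- The Lie derivative of vector fields along `V`, as a derivation of the tangent bundle. -/
def fieldDerivation (V : SmoothVectorField I M) :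
    (sectionModule I E (TangentSpace I : M → Type _)).Derivation where
  field := V
  nabla :=
    { toFun := fun W => vfBracket V W
      map_add' := fun W U => ContMDiffSection.ext fun x => vfBracket_add_right V W U x
      map_smul' := fun _ W => ContMDiffSection.ext fun _ =>
        VectorField.mlieBracket_const_smul_right W.mdifferentiableAt }
  leibniz f W x := vfBracket_smul_right V W f x

end Frames

/-! ### The modular form of a Lie algebroid -/

namespace LieAlgebroid

variable {E : Type*} [NormedAddCommGroup E] [NormedSpace ℝ E]
  {H : Type*} [TopologicalSpace H] {I : ModelWithCorners ℝ E H}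
  {M : Type*} [TopologicalSpace M] [ChartedSpace H M] [IsManifold I ∞ M]
  {F : Type*} [NormedAddCommGroup F] [NormedSpace ℝ F]
  {A : M → Type*} [TopologicalSpace (TotalSpace F A)]
  [∀ x, AddCommGroup (A x)] [∀ x, Module ℝ (A x)] [∀ x, TopologicalSpace (A x)]
  [FiberBundle F A] [VectorBundle ℝ F A]
  (L : LieAlgebroid I F A)

/-- The image of a section under the anchor. -/
def anchorField (X : SmoothSection I F A) : SmoothVectorField I M :=
  ⟨fun x => L.anchor x (X x), L.contMDiff_anchor X⟩

theorem contMDiff_lieDerivFun (X : SmoothSection I F A) {f : M → ℝ}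
    (hf : ContMDiff I 𝓘(ℝ, ℝ) ∞ f) : ContMDiff I 𝓘(ℝ, ℝ) ∞ (L.lieDerivFun X f) :=
  contMDiff_dirDeriv (L.anchorField X).contMDiff hf

theorem bracket_swap (X Y : SmoothSection I F A) : L.bracket X Y = - L.bracket Y X := by
  have h := L.bracket_self (X + Y)
  simp only [map_add, LinearMap.add_apply, L.bracket_self, zero_add, add_zero] at h
  exact eq_neg_of_add_eq_zero_right h

theorem leibniz_left (X Y : SmoothSection I F A) (f : C^∞⟮I, M; ℝ⟯) (x : M) :
    L.bracket (smulSection f X) Y x =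
      f x • L.bracket X Y x - dirDeriv I (L.anchor x (Y x)) f • X x := by
  rw [L.bracket_swap, L.bracket_swap X Y]
  simp only [ContMDiffSection.coe_neg, Pi.neg_apply, L.leibniz]
  module

variable [ContMDiffVectorBundle ∞ F A I] [FiniteDimensional ℝ E] [FiniteDimensional ℝ F]
  [T2Space M] [CompleteSpace E]

theorem anchorField_bracket (X Y : SmoothSection I F A) :
    L.anchorField (L.bracket X Y) = vfBracket (L.anchorField X) (L.anchorField Y) :=
  ContMDiffSection.ext fun x => L.anchor_bracket X Y x

theorem lieDerivFun_bracket (X Y : SmoothSection I F A) {f : M → ℝ}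
    (hf : ContMDiff I 𝓘(ℝ, ℝ) ∞ f) (x : M) :
    L.lieDerivFun (L.bracket X Y) f x =
      L.lieDerivFun X (L.lieDerivFun Y f) x - L.lieDerivFun Y (L.lieDerivFun X f) x := by
  have h := dirDeriv_vfBracket (L.anchorField X) (L.anchorField Y) hf x
  rw [← anchorField_bracket] at h
  exact h

theorem lieDerivOneForm_mem (X : SmoothSection I F A) (α : oneForms I F A) :
    L.lieDerivOneForm X α ∈ oneForms I F A := by
  intro Y
  simp only [lieDerivOneForm_apply]
  exact (L.contMDiff_lieDerivFun X (α.2 Y)).sub (α.2 _)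

theorem lieDerivOneForm_smul (X : SmoothSection I F A) (f : C^∞⟮I, M; ℝ⟯) (α : oneForms I F A)
    (x : M) : L.lieDerivOneForm X (smulOneForm f α) x =
      f x • L.lieDerivOneForm X α x + L.lieDerivFun X f x • α.1 x := by
  refine LinearMap.ext fun v => ?_
  obtain ⟨Y, rfl⟩ := exists_section_eq (I := I) (F := F) x v
  simp only [LinearMap.add_apply, LinearMap.smul_apply, lieDerivOneForm_apply, smul_eq_mul]
  change L.lieDerivFun X (fun y => f y * α.1 y (Y y)) x - f x * α.1 x _ = _
  rw [L.lieDerivFun_mul X f.contMDiff (α.2 Y)]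
  ring

/-- `ℒ_{fX} α = f ℒ_X α + α(X) df`. -/
theorem lieDerivOneForm_smul_left (X : SmoothSection I F A) (f : C^∞⟮I, M; ℝ⟯)
    (α : oneForms I F A) (x : M) (v : A x) : L.lieDerivOneForm (smulSection f X) α x v =
      f x * L.lieDerivOneForm X α x v + α.1 x (X x) * dirDeriv I (L.anchor x v) f := by
  obtain ⟨Y, rfl⟩ := exists_section_eq (I := I) (F := F) x v
  simp only [lieDerivOneForm_apply, L.leibniz_left, map_sub, map_smul, smul_eq_mul]
  have h : L.lieDerivFun (smulSection f X) (fun y => α.1 y (Y y)) x =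
      f x * L.lieDerivFun X (fun y => α.1 y (Y y)) x := by
    have h1 : L.anchor x (smulSection f X x) = f x • L.anchor x (X x) := map_smul _ _ _
    rw [lieDerivFun, h1, dirDeriv_smul_left]
    rfl
  rw [h]
  ring

/-- The Lie derivative of 1-forms along `X`, as a derivation of the dual bundle. -/
def formDerivation (X : SmoothSection I F A) : (formModule I F A).Derivation where
  field := L.anchorField X
  nabla :=
    { toFun := fun α => ⟨L.lieDerivOneForm X α, L.lieDerivOneForm_mem X α⟩
      map_add' := fun α β => Subtype.ext <| funext fun x => LinearMap.ext fun v => by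
        obtain ⟨Y, rfl⟩ := exists_section_eq (I := I) (F := F) x v
        have := L.lieDerivFun_add X (α.2 Y) (β.2 Y) x
        simp only [Submodule.coe_add, Pi.add_apply, LinearMap.add_apply, lieDerivOneForm_apply,
          this]
        ring
      map_smul' := fun c α => Subtype.ext <| funext fun x => LinearMap.ext fun v => by
        obtain ⟨Y, rfl⟩ := exists_section_eq (I := I) (F := F) x v
        have := L.lieDerivFun_const_mul X c (α.2 Y) x
        simp only [Submodule.coe_smul, Pi.smul_apply, LinearMap.smul_apply, lieDerivOneForm_apply,
          this, smul_eq_mul, RingHom.id_apply]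
        ring }
  leibniz f α x := L.lieDerivOneForm_smul X f α x

theorem formDerivation_lie {n : ℕ} (X : SmoothSection I F A)
    (η : ∀ x, (A x →ₗ[ℝ] ℝ) [⋀^Fin n]→ₗ[ℝ] ℝ) (α : Fin n → oneForms I F A) (x : M) :
    L.lieDerivMultivector X η α x = (L.formDerivation X).lie η α x := rfl

/-- The derivation of the base part: the Lie derivative along `ρ(X)`. -/
def baseDerivation (X : SmoothSection I F A) :
    (sectionModule I E (TangentSpace I : M → Type _)).Derivation :=
  fieldDerivation (L.anchorField X)

variable {n d : ℕ} {η : ∀ x, (A x →ₗ[ℝ] ℝ) [⋀^Fin n]→ₗ[ℝ] ℝ}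
  {μ : ∀ x : M, (TangentSpace I x) [⋀^Fin d]→ₗ[ℝ] ℝ}
  (hη : (formModule I F A).IsVolume η)
  (hμ : (sectionModule I E (TangentSpace I : M → Type _)).IsVolume μ)

theorem formDerivation_div_add (X Y : SmoothSection I F A) (x : M) :
    (L.formDerivation (X + Y)).div hη x =
      (L.formDerivation X).div hη x + (L.formDerivation Y).div hη x := by
  refine SectionModule.Derivation.div_add _ _ _ hη (fun x => (L.anchor x).map_add _ _)
    (fun α x => LinearMap.ext fun v => ?_) x
  obtain ⟨Z, rfl⟩ := exists_section_eq (I := I) (F := F) x v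
  change L.lieDerivOneForm _ _ _ _ = L.lieDerivOneForm _ _ _ _ + L.lieDerivOneForm _ _ _ _
  simp only [lieDerivOneForm_apply, map_add, LinearMap.add_apply, ContMDiffSection.coe_add,
    Pi.add_apply]
  have : L.lieDerivFun (X + Y) (fun y => α.1 y (Z y)) x =
      L.lieDerivFun X (fun y => α.1 y (Z y)) x + L.lieDerivFun Y (fun y => α.1 y (Z y)) x := by
    simp only [lieDerivFun, ContMDiffSection.coe_add, Pi.add_apply, map_add, dirDeriv_add_left]
  rw [this]
  ring

theorem baseDerivation_div_add (X Y : SmoothSection I F A) (x : M) :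
    (L.baseDerivation (X + Y)).div hμ x =
      (L.baseDerivation X).div hμ x + (L.baseDerivation Y).div hμ x := by
  have h : L.anchorField (X + Y) = L.anchorField X + L.anchorField Y :=
    ContMDiffSection.ext fun x => (L.anchor x).map_add _ _
  refine SectionModule.Derivation.div_add _ _ _ hμ (fun x => (L.anchor x).map_add _ _)
    (fun W x => ?_) x
  change vfBracket (L.anchorField (X + Y)) W x = vfBracket _ W x + vfBracket _ W x
  rw [h, vfBracket_add_left]

/-- The identity `[fX, η] = f [X, η] - (ρ(X) f) η` for `η` of top degree. -/
theorem formDerivation_div_smul (f : C^∞⟮I, M; ℝ⟯) (X : SmoothSection I F A) (x : M) :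
    (L.formDerivation (smulSection f X)).div hη x =
      f x * (L.formDerivation X).div hη x - L.lieDerivFun X f x := by
  refine SectionModule.Derivation.div_smul (L.formDerivation X) _ hη (f x)
    (LinearMap.applyₗ (X x))
    (differentialAt f x ∘ₗ L.anchor x) ((L.anchor x).map_smul _ _)
    (fun α => LinearMap.ext fun v => ?_)
  exact L.lieDerivOneForm_smul_left X f α x v

/-- The identity `ℒ_{fρ(X)} μ = f ℒ_{ρ(X)} μ + (ρ(X) f) μ` for `μ` of top degree. -/
theorem baseDerivation_div_smul (f : C^∞⟮I, M; ℝ⟯) (X : SmoothSection I F A) (x : M) :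
    (L.baseDerivation (smulSection f X)).div hμ x =
      f x * (L.baseDerivation X).div hμ x + L.lieDerivFun X f x := by
  have h : L.anchorField (smulSection f X) = smulSection f (L.anchorField X) :=
    ContMDiffSection.ext fun x => (L.anchor x).map_smul _ _
  have := SectionModule.Derivation.div_smul (L.baseDerivation X)
    (L.baseDerivation (smulSection f X)) hμ (x := x) (f x)
    (-differentialAt f x) (L.anchor x (X x)) ((L.anchor x).map_smul _ _)
    (fun W => ?_)
  · rw [this, LinearMap.neg_apply, sub_neg_eq_add]
    rfl
  · change vfBracket (L.anchorField (smulSection f X)) W x = f x • vfBracket _ W x + _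
    rw [h, vfBracket_smul_left, LinearMap.neg_apply, neg_smul, sub_eq_add_neg]
    rfl

/-- The sum of the two divergences is linear over functions in `X`: the terms `∓ ρ(X) f` cancel. -/
theorem exists_modularForm : ∃ ξ : ∀ x, A x →ₗ[ℝ] ℝ, ∀ (X : SmoothSection I F A) x,
    ξ x (X x) = (L.formDerivation X).div hη x + (L.baseDerivation X).div hμ x := by
  have hs : ∀ (f : C^∞⟮I, M; ℝ⟯) X x, (L.formDerivation (smulSection f X)).div hη x +
      (L.baseDerivation (smulSection f X)).div hμ x =
      f x * ((L.formDerivation X).div hη x + (L.baseDerivation X).div hμ x) := by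
    intro f X x
    rw [L.formDerivation_div_smul, L.baseDerivation_div_smul]
    ring
  have h : ∀ x, ∃ φ : A x →ₗ[ℝ] ℝ, ∀ X : SmoothSection I F A,
      φ (X x) = (L.formDerivation X).div hη x + (L.baseDerivation X).div hμ x := by
    intro x
    refine (sectionModule I F A).exists_eq_comp_ev
      { toFun := fun X => (L.formDerivation X).div hη x + (L.baseDerivation X).div hμ x
        map_add' := fun X Y => by
          rw [formDerivation_div_add, baseDerivation_div_add]
          ring
        map_smul' := fun c X => hs ⟨fun _ => c, contMDiff_const⟩ X x } fun f X => hs f X x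
  choose ξ hξ using h
  exact ⟨ξ, fun X x => hξ x X⟩

/-- The modular form of `L` with respect to `η ⊗ μ`: the sum of the two divergences. -/
def modularForm : ∀ x, A x →ₗ[ℝ] ℝ := (L.exists_modularForm hη hμ).choose

theorem modularForm_apply (X : SmoothSection I F A) (x : M) :
    L.modularForm hη hμ x (X x) =
      (L.formDerivation X).div hη x + (L.baseDerivation X).div hμ x :=
  (L.exists_modularForm hη hμ).choose_spec X x

theorem isModularForm_modularForm : L.IsModularForm η μ (L.modularForm hη hμ) := by
  refine ⟨fun X => ?_, fun X α W x => ?_⟩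
  · simp only [modularForm_apply]
    exact ((L.formDerivation X).div hη).contMDiff.add ((L.baseDerivation X).div hμ).contMDiff
  · have h1 := (L.formDerivation X).lie_eq_div_mul hη α x
    have h2 := (L.baseDerivation X).lie_eq_div_mul hμ W x
    rw [modularForm_apply, formDerivation_lie]
    change _ = _ + _ * (L.baseDerivation X).lie μ W x
    rw [h1, h2]
    change _ * (η x (fun i => (α i).1 x) * μ x (fun j => W j x)) =
      (_ * η x (fun i => (α i).1 x)) * μ x (fun j => W j x) +
      η x (fun i => (α i).1 x) * (_ * μ x (fun j => W j x))
    ring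

variable {L} in
theorem IsModularForm.eq {ξ ξ' : ∀ x, A x →ₗ[ℝ] ℝ} (h : L.IsModularForm η μ ξ)
    (hη : (formModule I F A).IsVolume η)
    (hμ : (sectionModule I E (TangentSpace I : M → Type _)).IsVolume μ)
    (h' : L.IsModularForm η μ ξ') : ξ = ξ' := by
  funext x
  refine LinearMap.ext fun v => ?_
  obtain ⟨X, rfl⟩ := exists_section_eq (I := I) (F := F) x v
  obtain ⟨α, hα⟩ := (formModule I F A).exists_apply_ne_zero (hη.ne_zero x)
  obtain ⟨W, hW⟩ :=
    (sectionModule I E (TangentSpace I : M → Type _)).exists_apply_ne_zero (hμ.ne_zero x)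
  exact mul_right_cancel₀ (mul_ne_zero hα hW) ((h.2 X α W x).trans (h'.2 X α W x).symm)

/-- `ℒ_{[X, Y]} = [ℒ_X, ℒ_Y]` on 1-forms. -/
theorem lieDerivOneForm_bracket (X Y : SmoothSection I F A) (α : oneForms I F A) :
    (L.formDerivation (L.bracket X Y)).nabla α =
      (L.formDerivation X).nabla ((L.formDerivation Y).nabla α) -
        (L.formDerivation Y).nabla ((L.formDerivation X).nabla α) := by
  refine Subtype.ext <| funext fun x => LinearMap.ext fun v => ?_
  obtain ⟨Z, rfl⟩ := exists_section_eq (I := I) (F := F) x v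
  change L.lieDerivOneForm (L.bracket X Y) α x (Z x) =
    L.lieDerivOneForm X ((L.formDerivation Y).nabla α) x (Z x) -
    L.lieDerivOneForm Y ((L.formDerivation X).nabla α) x (Z x)
  simp only [lieDerivOneForm_apply]
  change _ = L.lieDerivFun X (fun y => L.lieDerivOneForm Y α y (Z y)) x -
    L.lieDerivOneForm Y α x (L.bracket X Z x) -
    (L.lieDerivFun Y (fun y => L.lieDerivOneForm X α y (Z y)) x -
    L.lieDerivOneForm X α x (L.bracket Y Z x))
  simp only [lieDerivOneForm_apply]
  have h1 := dirDeriv_sub (L.anchor x (X x)) (L.contMDiff_lieDerivFun Y (α.2 Z))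
    (α.2 (L.bracket Y Z))
  have h2 := dirDeriv_sub (L.anchor x (Y x)) (L.contMDiff_lieDerivFun X (α.2 Z))
    (α.2 (L.bracket X Z))
  simp only [lieDerivFun] at h1 h2 ⊢
  rw [h1, h2]
  have h3 := L.lieDerivFun_bracket X Y (α.2 Z) x
  simp only [lieDerivFun] at h3
  have h4 := congrArg (fun T : SmoothSection I F A => α.1 x (T x)) (L.jacobi X Y Z)
  simp only [ContMDiffSection.coe_add, Pi.add_apply, map_add] at h4
  linarith

/-- The modular form is closed because the divergence is a cocycle on commutators of derivations. -/
theorem modularForm_mem_cocycles : L.modularForm hη hμ ∈ L.cocycles := by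
  refine ⟨(L.isModularForm_modularForm hη hμ).1, fun X Y x => ?_⟩
  simp only [modularForm_apply]
  rw [L.lieDerivFun_add X ((L.formDerivation Y).div hη).contMDiff
    ((L.baseDerivation Y).div hμ).contMDiff, L.lieDerivFun_add Y
    ((L.formDerivation X).div hη).contMDiff ((L.baseDerivation X).div hμ).contMDiff,
    (L.formDerivation (L.bracket X Y)).div_commutator (L.formDerivation X) (L.formDerivation Y) hη
      (fun f x hf => L.lieDerivFun_bracket X Y hf x) (L.lieDerivOneForm_bracket X Y),
    (L.baseDerivation (L.bracket X Y)).div_commutator (L.baseDerivation X) (L.baseDerivation Y) hμ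
      (fun f x hf => L.lieDerivFun_bracket X Y hf x) (fun W => ?_)]
  · simp only [lieDerivFun]
    change dirDeriv I (L.anchor x (X x)) _ + dirDeriv I (L.anchor x (X x)) _ -
      (dirDeriv I (L.anchor x (Y x)) _ + dirDeriv I (L.anchor x (Y x)) _) -
      (dirDeriv I (L.anchor x (X x)) _ - dirDeriv I (L.anchor x (Y x)) _ +
      (dirDeriv I (L.anchor x (X x)) _ - dirDeriv I (L.anchor x (Y x)) _)) = 0
    ring
  · refine ContMDiffSection.ext fun x => ?_
    change vfBracket (L.anchorField (L.bracket X Y)) W x =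
      vfBracket (L.anchorField X) (vfBracket (L.anchorField Y) W) x -
      vfBracket (L.anchorField Y) (vfBracket (L.anchorField X) W) x
    rw [L.anchorField_bracket, vfBracket_jacobi]
    abel

end LieAlgebroid

/-! ### The modular class of a Lie algebroid -/

section Log

variable {E : Type*} [NormedAddCommGroup E] [NormedSpace ℝ E]
  {H : Type*} [TopologicalSpace H] {I : ModelWithCorners ℝ E H}
  {M : Type*} [TopologicalSpace M] [ChartedSpace H M]

/-- `log |f|`, for a nowhere vanishing function `f`; recall that `Real.log` is even. -/
def logAbs (f : C^∞⟮I, M; ℝ⟯) (hf : ∀ x, f x ≠ 0) : C^∞⟮I, M; ℝ⟯ :=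
  ⟨fun x => Real.log (f x), fun x =>
    (Real.contDiffAt_log.2 (hf x)).contMDiffAt.comp x (f.contMDiff x)⟩

theorem mul_dirDeriv_comp {g : ℝ → ℝ} {f : M → ℝ} {x : M} {g' : ℝ} (hg : HasDerivAt g g' (f x))
    (hf : ContMDiff I 𝓘(ℝ, ℝ) ∞ f) (v : TangentSpace I x) :
    dirDeriv I v (fun y => g (f y)) = g' * dirDeriv I v f := by
  have h1 := mfderiv_comp (I := I) (I' := 𝓘(ℝ, ℝ)) (I'' := 𝓘(ℝ, ℝ)) x
      (g := g) (f := f) hg.differentiableAt.mdifferentiableAt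
      (hf.mdifferentiableAt (by simp))
  rw [mfderiv_eq_fderiv, hg.hasFDerivAt.fderiv] at h1
  have h2 := congrArg (fun T : TangentSpace I x →L[ℝ] ℝ => T v) h1
  refine h2.trans ?_
  change dirDeriv I v f * g' = _
  rw [mul_comm]

theorem mul_dirDeriv_logAbs (f : C^∞⟮I, M; ℝ⟯) (hf : ∀ x, f x ≠ 0) {x : M}
    (v : TangentSpace I x) : f x * dirDeriv I v (logAbs f hf) = dirDeriv I v f := by
  have h := mul_dirDeriv_comp (Real.hasDerivAt_log (hf x)) f.contMDiff v
  have h' : dirDeriv I v (logAbs f hf) = _ := h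
  rw [h', mul_inv_cancel_left₀ (hf x)]

end Log

namespace LieAlgebroid

variable {E : Type*} [NormedAddCommGroup E] [NormedSpace ℝ E]
  {H : Type*} [TopologicalSpace H] {I : ModelWithCorners ℝ E H}
  {M : Type*} [TopologicalSpace M] [ChartedSpace H M] [IsManifold I ∞ M]
  {F : Type*} [NormedAddCommGroup F] [NormedSpace ℝ F]
  {A : M → Type*} [TopologicalSpace (TotalSpace F A)]
  [∀ x, AddCommGroup (A x)] [∀ x, Module ℝ (A x)] [∀ x, TopologicalSpace (A x)]
  [FiberBundle F A] [VectorBundle ℝ F A]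
  (L : LieAlgebroid I F A)

variable {L} in
theorem HasClass.eq {α : ∀ x, A x →ₗ[ℝ] ℝ} {c c' : L.H1} (h : L.HasClass α c)
    (h' : L.HasClass α c') : c = c' := by
  obtain ⟨_, rfl⟩ := h
  obtain ⟨_, rfl⟩ := h'
  rfl

variable {L} in
theorem hasClass_mk {α β : ∀ x, A x →ₗ[ℝ] ℝ} (hα : α ∈ L.cocycles) (hβ : β ∈ L.cocycles)
    (h : α - β ∈ L.coboundaries) :
    L.HasClass α (Submodule.Quotient.mk ⟨β, hβ⟩ : L.H1) :=
  ⟨hα, (Submodule.Quotient.eq _).2 h⟩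

variable [ContMDiffVectorBundle ∞ F A I] [FiniteDimensional ℝ E] [FiniteDimensional ℝ F]
  [T2Space M] [CompleteSpace E]
  {n d : ℕ} {η η' : ∀ x, (A x →ₗ[ℝ] ℝ) [⋀^Fin n]→ₗ[ℝ] ℝ}
  {μ μ' : ∀ x : M, (TangentSpace I x) [⋀^Fin d]→ₗ[ℝ] ℝ}

/-- If `η' = f η` and `μ' = g μ`, then the modular forms differ by `d (log |f| + log |g|)`. -/
theorem modularForm_sub_mem_coboundaries (hη : (formModule I F A).IsVolume η)
    (hη' : (formModule I F A).IsVolume η')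
    (hμ : (sectionModule I E (TangentSpace I : M → Type _)).IsVolume μ)
    (hμ' : (sectionModule I E (TangentSpace I : M → Type _)).IsVolume μ') :
    L.modularForm hη' hμ' - L.modularForm hη hμ ∈ L.coboundaries := by
  obtain ⟨f, hf, hf'⟩ := hη.exists_smul hη'
  obtain ⟨g, hg, hg'⟩ := hμ.exists_smul hμ'
  refine ⟨logAbs f hf + logAbs g hg, fun x v => ?_⟩
  obtain ⟨X, rfl⟩ := exists_section_eq (I := I) (F := F) x v
  rw [Pi.sub_apply, LinearMap.sub_apply, modularForm_apply, modularForm_apply]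
  have h1 := (L.formDerivation X).div_mul hη hη' f hf' x
  have h2 := (L.baseDerivation X).div_mul hμ hμ' g hg' x
  change _ = _ + dirDeriv I (L.anchor x (X x)) f at h1
  change _ = _ + dirDeriv I (L.anchor x (X x)) g at h2
  rw [← mul_dirDeriv_logAbs f hf, ← mul_add] at h1
  rw [← mul_dirDeriv_logAbs g hg, ← mul_add] at h2
  have h3 : dirDeriv I (L.anchor x (X x)) (logAbs f hf + logAbs g hg : C^∞⟮I, M; ℝ⟯) = _ :=
    dirDeriv_add (L.anchor x (X x)) (logAbs f hf).contMDiff (logAbs g hg).contMDiff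
  rw [h3, mul_left_cancel₀ (hf x) h1, mul_left_cancel₀ (hg x) h2]
  ring

/-- The class of one modular form is the modular class. -/
theorem isModularClass_mk (hn : Module.finrank ℝ F = n) (hd : Module.finrank ℝ E = d)
    (hη : (formModule I F A).IsVolume η)
    (hμ : (sectionModule I E (TangentSpace I : M → Type _)).IsVolume μ) :
    L.IsModularClass n d
      (Submodule.Quotient.mk ⟨L.modularForm hη hμ, L.modularForm_mem_cocycles hη hμ⟩) := by
  intro η' μ' hη' hμ'
  have h1 := hη'.isVolume hn
  have h2 := hμ'.isVolume hd
  refine ⟨⟨_, L.isModularForm_modularForm h1 h2, fun ξ hξ =>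
    hξ.eq h1 h2 (L.isModularForm_modularForm h1 h2)⟩, fun ξ hξ => ?_⟩
  rw [hξ.eq h1 h2 (L.isModularForm_modularForm h1 h2)]
  exact hasClass_mk (L.modularForm_mem_cocycles h1 h2) _
    (L.modularForm_sub_mem_coboundaries hη h1 hμ h2)

variable {L} in
theorem IsModularClass.isJacobiModularClass {c : L.H1} (hc : L.IsModularClass n d c)
    {φ₀ : ∀ x, A x →ₗ[ℝ] ℝ} (hφ₀ : φ₀ ∈ L.cocycles) :
    L.IsJacobiModularClass n d φ₀
      (c - ((n : ℝ) - 1) • (Submodule.Quotient.mk ⟨φ₀, hφ₀⟩ : L.H1)) := by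
  intro η μ hη hμ
  obtain ⟨⟨ξ, hξ, hu⟩, hc'⟩ := hc η μ hη hμ
  refine ⟨⟨_, ⟨ξ, hξ, rfl⟩, ?_⟩, ?_⟩
  · rintro _ ⟨ξ', hξ', rfl⟩
    rw [hu ξ' hξ']
  · rintro _ ⟨ξ', hξ', rfl⟩
    obtain ⟨h, rfl⟩ := hc' ξ' hξ'
    exact ⟨sub_mem h (Submodule.smul_mem _ _ hφ₀), rfl⟩

end LieAlgebroid

/-! ### Forms along smooth maps, and `μ ∧ dt` -/

open scoped TensorProduct in
/-- If `a` vanishes as soon as one of its arguments is the last one of `v`, then only the identity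
permutation contributes to `(a ∧ b)(v)`. -/
theorem AlternatingMap.mul'_domCoprod_apply {V : Type*} [AddCommGroup V] [Module ℝ V] {d : ℕ}
    (a : V [⋀^Fin d]→ₗ[ℝ] ℝ) (b : V [⋀^Fin 1]→ₗ[ℝ] ℝ) (v : Fin d ⊕ Fin 1 → V)
    (h : ∀ (u : Fin d → V) i, u i = v (Sum.inr 0) → a u = 0) :
    LinearMap.mul' ℝ ℝ (a.domCoprod b v) = a (v ∘ Sum.inl) * b (v ∘ Sum.inr) := by
  classical
  rw [AlternatingMap.domCoprod_apply, _root_.sum_apply]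
  refine (congrArg (LinearMap.mul' ℝ ℝ) (Finset.sum_eq_single
    (Quotient.mk'' 1 : Equiv.Perm.ModSumCongr (Fin d) (Fin 1)) ?_ ?_)).trans ?_
  · intro σ _
    induction σ using Quotient.inductionOn' with | _ σ
    intro hσ
    rw [AlternatingMap.domCoprod.summand_mk'']
    have h0 : a (fun i => v (σ (Sum.inl i))) = 0 := by
      obtain ⟨x, hx⟩ := σ.surjective (Sum.inr 0)
      obtain i | i := x
      · exact h _ i (congrArg v hx)
      · obtain rfl : i = 0 := Subsingleton.elim _ _
        refine absurd ?_ hσ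
        refine (QuotientGroup.eq.2 ?_).symm
        rw [inv_one, one_mul]
        refine Equiv.Perm.mem_sumCongrHom_range_of_perm_mapsTo_inl ?_
        rintro _ ⟨i, rfl⟩
        rcases hy : σ (Sum.inl i) with j | j
        · exact ⟨j, rfl⟩
        · obtain rfl : j = 0 := Subsingleton.elim _ _
          exact absurd (σ.injective (hy.trans hx.symm)) (by simp)
    change Equiv.Perm.sign σ • ((a fun i => v (σ (Sum.inl i))) ⊗ₜ[ℝ]
      (b fun i => v (σ (Sum.inr i)))) = 0
    rw [h0, TensorProduct.zero_tmul, smul_zero]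
  · simp
  · rw [AlternatingMap.domCoprod.summand_mk'']
    simp only [Equiv.Perm.sign_one, one_smul]
    rfl

section Along

variable {E : Type*} [NormedAddCommGroup E] [NormedSpace ℝ E]
  {H : Type*} [TopologicalSpace H] {I : ModelWithCorners ℝ E H}
  {M : Type*} [TopologicalSpace M] [ChartedSpace H M]
  {F : Type*} [NormedAddCommGroup F] [NormedSpace ℝ F]
  {A : M → Type*} [TopologicalSpace (TotalSpace F A)]
  [∀ x, AddCommGroup (A x)] [∀ x, Module ℝ (A x)] [∀ x, TopologicalSpace (A x)]
  [FiberBundle F A] [VectorBundle ℝ F A] [ContMDiffVectorBundle ∞ F A I]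
  [FiniteDimensional ℝ E] [FiniteDimensional ℝ F] [IsManifold I ∞ M] [T2Space M]
  {E' : Type*} [NormedAddCommGroup E'] [NormedSpace ℝ E']
  {H' : Type*} [TopologicalSpace H'] {I' : ModelWithCorners ℝ E' H'}
  {N : Type*} [TopologicalSpace N] [ChartedSpace H' N]

/-- A smooth 1-form is smooth as a function on the total space of the bundle. -/
theorem contMDiff_oneForm_comp {α : ∀ x, A x →ₗ[ℝ] ℝ} (hα : α ∈ oneForms I F A)
    {f : N → TotalSpace F A} (hf : ContMDiff I' (I.prod 𝓘(ℝ, F)) ∞ f) :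
    ContMDiff I' 𝓘(ℝ, ℝ) ∞ fun y => α (f y).1 (f y).2 := by
  intro y₀
  obtain ⟨h1, h2⟩ := contMDiffAt_totalSpace.1 (hf y₀)
  obtain ⟨ψ, hψ, hs⟩ := exists_bump (I := I) (F := F) (A := A) (f y₀).proj
  set e := trivializationAt F A (f y₀).proj
  have hx : (f y₀).proj ∈ e.baseSet := FiberBundle.mem_baseSet_trivializationAt' _
  let b := Module.finBasis ℝ F
  let s : Fin (Module.finrank ℝ F) → SmoothSection I F A := fun i =>
    ⟨(ψ : M → ℝ) • e.localFrame b i, ContMDiffOn.smul_section_of_tsupport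
      ψ.contMDiff.contMDiffOn e.open_baseSet hs (e.contMDiffOn_localFrame_baseSet ∞ b i)⟩
  have hψ' : ContMDiffAt I' 𝓘(ℝ, ℝ) ∞ (fun y => ψ (f y).proj) y₀ :=
    (ψ.contMDiff _).comp y₀ h1
  have hc : ∀ i, ContMDiffAt I' 𝓘(ℝ, ℝ) ∞ (fun y => b.repr (e (f y)).2 i) y₀ := fun i =>
    (LinearMap.toContinuousLinearMap (b.coord i)).contMDiff.contMDiffAt.comp y₀ h2
  have hsum : ContMDiffAt I' 𝓘(ℝ, ℝ) ∞ (fun y => (∑ i, b.repr (e (f y)).2 i *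
      α (f y).proj (s i (f y).proj)) / ψ (f y).proj) y₀ := by
    refine ContMDiffAt.div₀ (ContMDiffAt.sum fun i _ => (hc i).mul ?_) hψ' ?_
    · exact (hα (s i) _).comp y₀ h1
    · rw [hψ]
      exact one_ne_zero
  refine hsum.congr_of_eventuallyEq ?_
  filter_upwards [h1.continuousAt.eventually_mem (e.open_baseSet.mem_nhds hx),
    hψ'.continuousAt.eventually_ne (show ψ (f y₀).proj ≠ 0 by rw [hψ]; exact one_ne_zero)]
    with y hy hy'
  rw [eq_div_iff hy']
  have h3 : (f y).2 = ∑ i, b.repr (e (f y)).2 i • e.localFrame b i (f y).proj := by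
    simp only [e.localFrame_apply_of_mem_baseSet b hy]
    conv_lhs => rw [← (e.basisAt b hy).sum_repr (f y).2]
    rfl
  rw [h3, map_sum, Finset.sum_mul]
  refine Finset.sum_congr rfl fun i _ => ?_
  change _ = _ * α _ (ψ (f y).proj • e.localFrame b i (f y).proj)
  rw [map_smul, map_smul, smul_eq_mul, smul_eq_mul]
  ring

/-- A smooth form along a map `g` takes smooth values on arguments `U i` which, up to the factor
`ψ`, are combinations of global sections with smooth coefficients. -/
theorem SectionModule.IsSmooth.contMDiffAt_comp {P : Type*} [AddCommGroup P] [Module ℝ P]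
    {V : M → Type*} [∀ x, AddCommGroup (V x)] [∀ x, Module ℝ (V x)] {S : SectionModule I P V}
    {n : ℕ} {κ : ∀ x, V x [⋀^Fin n]→ₗ[ℝ] ℝ} (hκ : S.IsSmooth κ) {g : N → M}
    (hg : ContMDiff I' I ∞ g) {y₀ : N} {r : ℕ} (q : Fin r → P) (ψ : C^∞⟮I, M; ℝ⟯)
    (hψ : ψ (g y₀) = 1) (U : Fin n → ∀ y, V (g y)) (c : Fin n → Fin r → N → ℝ)
    (hc : ∀ i j, ContMDiff I' 𝓘(ℝ, ℝ) ∞ (c i j))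
    (hU : ∀ i y, ψ (g y) • U i y = ∑ j, c i j y • S.ev (g y) (q j)) :
    ContMDiffAt I' 𝓘(ℝ, ℝ) ∞ (fun y => κ (g y) fun i => U i y) y₀ := by
  have h1 : ∀ y, (∏ _i : Fin n, ψ (g y)) * κ (g y) (fun i => U i y) =
      ∑ k : Fin n → Fin r, (∏ i, c i (k i) y) * κ (g y) fun i => S.ev (g y) (q (k i)) := by
    intro y
    have h2 := (κ (g y)).toMultilinearMap.map_smul_univ (fun _ => ψ (g y)) (fun i => U i y)
    simp only [hU] at h2
    rw [smul_eq_mul] at h2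
    refine h2.symm.trans ?_
    rw [MultilinearMap.map_sum]
    refine Finset.sum_congr rfl fun k _ => ?_
    exact (κ (g y)).toMultilinearMap.map_smul_univ (fun i => c i (k i) y) _
  have hψ' : ContMDiff I' 𝓘(ℝ, ℝ) ∞ (fun y => ∏ _i : Fin n, ψ (g y)) :=
    contMDiff_finsetProd fun i _ => ψ.contMDiff.comp hg
  have hne : (∏ _i : Fin n, ψ (g y₀)) ≠ 0 := by simp [hψ]
  have h3 : ContMDiff I' 𝓘(ℝ, ℝ) ∞ (fun y => ∑ k : Fin n → Fin r,
      (∏ i, c i (k i) y) * κ (g y) fun i => S.ev (g y) (q (k i))) :=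
    contMDiff_finsetSum fun k _ =>
      (contMDiff_finsetProd fun i _ => hc i (k i)).mul ((hκ fun i => q (k i)).comp hg)
  refine ((h3 y₀).div₀ (hψ' y₀) hne).congr_of_eventuallyEq ?_
  filter_upwards [hψ'.continuous.continuousAt.eventually_ne hne] with y hy
  refine (eq_div_iff hy).2 ((mul_comm _ _).trans (h1 y))

end Along

section Product

variable {E : Type*} [NormedAddCommGroup E] [NormedSpace ℝ E]
  {H : Type*} [TopologicalSpace H] {I : ModelWithCorners ℝ E H}
  {M : Type*} [TopologicalSpace M] [ChartedSpace H M]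

/-- The tangent vector of `M × ℝ` with components `v` and `c ∂/∂t`. -/
def prodVec (p : M × ℝ) (v : TangentSpace I p.1) (c : ℝ) :
    TangentSpace (I.prod 𝓘(ℝ, ℝ)) p := (v, c)

/-- The component along `M` of a tangent vector of `M × ℝ`. -/
def fstVec (p : M × ℝ) : TangentSpace (I.prod 𝓘(ℝ, ℝ)) p →ₗ[ℝ] TangentSpace I p.1 :=
  (mfderiv (I.prod 𝓘(ℝ, ℝ)) I Prod.fst p).toLinearMap

/-- The component along `ℝ` of a tangent vector of `M × ℝ`. -/
def sndVec (p : M × ℝ) : TangentSpace (I.prod 𝓘(ℝ, ℝ)) p →ₗ[ℝ] ℝ :=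
  (mfderiv (I.prod 𝓘(ℝ, ℝ)) 𝓘(ℝ, ℝ) Prod.snd p).toLinearMap

@[simp] theorem fstVec_prodVec (p : M × ℝ) (v : TangentSpace I p.1) (c : ℝ) :
    fstVec p (prodVec p v c) = v :=
  congrArg (fun T : TangentSpace (I.prod 𝓘(ℝ, ℝ)) p →L[ℝ] TangentSpace I p.1 =>
    T (prodVec p v c)) (mfderiv_fst (I := I) (I' := 𝓘(ℝ, ℝ)) (x := p))

@[simp] theorem sndVec_prodVec (p : M × ℝ) (v : TangentSpace I p.1) (c : ℝ) :
    sndVec p (prodVec p v c) = c :=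
  congrArg (fun T : TangentSpace (I.prod 𝓘(ℝ, ℝ)) p →L[ℝ] ℝ =>
    T (prodVec p v c)) (mfderiv_snd (I := I) (I' := 𝓘(ℝ, ℝ)) (x := p))

theorem prodVec_fstVec_sndVec (p : M × ℝ) (w : TangentSpace (I.prod 𝓘(ℝ, ℝ)) p) :
    prodVec p (fstVec p w) (sndVec p w) = w := by
  obtain ⟨v, c, rfl⟩ : ∃ v c, w = prodVec p v c := ⟨w.1, w.2, rfl⟩
  rw [fstVec_prodVec, sndVec_prodVec]

theorem prodVec_ext {p : M × ℝ} {v w : TangentSpace (I.prod 𝓘(ℝ, ℝ)) p}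
    (h1 : fstVec p v = fstVec p w) (h2 : sndVec p v = sndVec p w) : v = w := by
  rw [← prodVec_fstVec_sndVec p v, h1, h2, prodVec_fstVec_sndVec]

theorem dirDeriv_prodVec (p : M × ℝ) (v : TangentSpace I p.1) (c : ℝ) {f : M × ℝ → ℝ}
    (hf : ContMDiff (I.prod 𝓘(ℝ, ℝ)) 𝓘(ℝ, ℝ) ∞ f) :
    dirDeriv (I.prod 𝓘(ℝ, ℝ)) (prodVec p v c) f =
      dirDeriv I v (fun x => f (x, p.2)) + c * deriv (fun t => f (p.1, t)) p.2 := by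
  have h := mfderiv_prod_eq_add_apply (I := I) (I' := 𝓘(ℝ, ℝ)) (I'' := 𝓘(ℝ, ℝ)) (p := p)
    (v := prodVec p v c) (hf.mdifferentiableAt (x := p) (by simp))
  refine h.trans ?_
  rw [mfderiv_eq_fderiv]
  change _ + fderiv ℝ (fun t => f (p.1, t)) p.2 c = _
  rw [fderiv_eq_smul_deriv]
  rfl

/-- A function on `M`, seen as a time-independent function on `M × ℝ`. -/
def hatFun (f : C^∞⟮I, M; ℝ⟯) : C^∞⟮I.prod 𝓘(ℝ, ℝ), M × ℝ; ℝ⟯ :=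
  ⟨fun p => f p.1, f.contMDiff.comp contMDiff_fst⟩

theorem dirDeriv_comp_fst (p : M × ℝ) (w : TangentSpace (I.prod 𝓘(ℝ, ℝ)) p) {f : M → ℝ}
    (hf : ContMDiff I 𝓘(ℝ, ℝ) ∞ f) :
    dirDeriv (I.prod 𝓘(ℝ, ℝ)) w (fun q : M × ℝ => f q.1) = dirDeriv I (fstVec p w) f := by
  conv_lhs => rw [← prodVec_fstVec_sndVec p w]
  rw [dirDeriv_prodVec (f := fun q => f q.1) _ _ _ (hf.comp contMDiff_fst)]
  simp

theorem dirDeriv_comp_snd (p : M × ℝ) (w : TangentSpace (I.prod 𝓘(ℝ, ℝ)) p) {g : ℝ → ℝ}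
    (hg : ContDiff ℝ ∞ g) :
    dirDeriv (I.prod 𝓘(ℝ, ℝ)) w (fun q : M × ℝ => g q.2) = sndVec p w * deriv g p.2 := by
  conv_lhs => rw [← prodVec_fstVec_sndVec p w]
  rw [dirDeriv_prodVec (f := fun q => g q.2) _ _ _ (hg.contMDiff.comp contMDiff_snd)]
  exact (congrArg (· + _) (dirDeriv_const (fstVec p w) (g p.2))).trans (zero_add _)

theorem dirDeriv_snd (p : M × ℝ) (w : TangentSpace (I.prod 𝓘(ℝ, ℝ)) p) :
    dirDeriv (I.prod 𝓘(ℝ, ℝ)) w (fun q : M × ℝ => q.2) = sndVec p w := by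
  rw [dirDeriv_comp_snd p w (g := fun t => t) contDiff_id]
  simp

/-- Only the unshuffled term contributes when the last vector is `∂/∂t`. -/
theorem wedgeDt_snoc {d : ℕ} (μ : ∀ x : M, (TangentSpace I x) [⋀^Fin d]→ₗ[ℝ] ℝ) (p : M × ℝ)
    (w : Fin (d + 1) → TangentSpace (I.prod 𝓘(ℝ, ℝ)) p) (h1 : fstVec p (w (Fin.last d)) = 0)
    (h2 : sndVec p (w (Fin.last d)) = 1) :
    wedgeDt I μ p w = μ p.1 fun i => fstVec p (w i.castSucc) := by
  refine (AlternatingMap.mul'_domCoprod_apply ((μ p.1).compLinearMap (fstVec p))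
    (AlternatingMap.ofSubsingleton ℝ (TangentSpace (I.prod 𝓘(ℝ, ℝ)) p) ℝ (0 : Fin 1) (sndVec p))
    (w ∘ finSumFinEquiv) fun u i hu => ?_).trans ?_
  · refine (μ p.1).map_coord_zero i ?_
    rw [hu]
    exact h1
  · change (μ p.1 fun i => fstVec p (w i.castSucc)) * sndVec p (w (Fin.last d)) = _
    rw [h2, mul_one]

end Product

/-! ### Generating families of sections -/

section Generating

variable {E : Type*} [NormedAddCommGroup E] [NormedSpace ℝ E]
  {H : Type*} [TopologicalSpace H] {I : ModelWithCorners ℝ E H}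
  {M : Type*} [TopologicalSpace M] [ChartedSpace H M] [IsManifold I ∞ M]
  {F : Type*} [NormedAddCommGroup F] [NormedSpace ℝ F]
  {A : M → Type*} [TopologicalSpace (TotalSpace F A)]
  [∀ x, AddCommGroup (A x)] [∀ x, Module ℝ (A x)] [∀ x, TopologicalSpace (A x)]
  [FiberBundle F A] [VectorBundle ℝ F A] [ContMDiffVectorBundle ∞ F A I]
  [FiniteDimensional ℝ E] [FiniteDimensional ℝ F] [T2Space M]

/-- A set of sections which attain every value at every point. -/
def IsGenerating (G : Set (SmoothSection I F A)) : Prop :=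
  ∀ (x : M) (v : A x), ∃ X ∈ G, X x = v

theorem IsGenerating.eq_zero {G : Set (SmoothSection I F A)} (hG : IsGenerating G) {x : M}
    {W : Type*} [AddCommGroup W] [Module ℝ W] (Φ : SmoothSection I F A →ₗ[ℝ] W)
    (hΦ : ∀ (f : C^∞⟮I, M; ℝ⟯) Y, Φ (smulSection f Y) = f x • Φ Y) (h : ∀ X ∈ G, Φ X = 0)
    (X : SmoothSection I F A) : Φ X = 0 := by
  obtain ⟨φ, hφ⟩ := (sectionModule I F A).exists_eq_comp_ev Φ hΦ
  obtain ⟨Y, hY, hYX⟩ := hG x (X x)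
  rw [← hφ, ← h Y hY, ← hφ Y]
  exact congrArg φ hYX.symm

/-- Antisymmetric expressions, tensorial in the second argument, that vanish on generators. -/
theorem IsGenerating.eq_zero₂ {G : Set (SmoothSection I F A)} (hG : IsGenerating G) {x : M}
    {W : Type*} [AddCommGroup W] [Module ℝ W]
    (Φ : SmoothSection I F A → SmoothSection I F A →ₗ[ℝ] W)
    (hΦ : ∀ X (f : C^∞⟮I, M; ℝ⟯) Y, Φ X (smulSection f Y) = f x • Φ X Y)
    (hs : ∀ X Y, Φ X Y = - Φ Y X) (h : ∀ X ∈ G, ∀ Y ∈ G, Φ X Y = 0)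
    (X Y : SmoothSection I F A) : Φ X Y = 0 := by
  refine hG.eq_zero (Φ X) (hΦ X) (fun Z hZ => ?_) Y
  rw [hs, hG.eq_zero (Φ Z) (hΦ Z) (h Z hZ) X, neg_zero]

namespace LieAlgebroid

/-- Two Lie algebroid structures with the same anchor coincide if their brackets agree on a
generating family: their difference is tensorial. -/
theorem ext_of_isGenerating {G : Set (SmoothSection I F A)} (hG : IsGenerating G)
    {L L' : LieAlgebroid I F A} (ha : L.anchor = L'.anchor)
    (hb : ∀ X ∈ G, ∀ Y ∈ G, L.bracket X Y = L'.bracket X Y) : L = L' := by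
  refine LieAlgebroid.ext ha (LinearMap.ext fun X => LinearMap.ext fun Y =>
    ContMDiffSection.ext fun x => ?_)
  rw [← sub_eq_zero]
  refine hG.eq_zero₂ (x := x) (fun X => (sectionModule I F A).ev x ∘ₗ (L.bracket X - L'.bracket X))
    (fun X f Y => ?_) (fun X Y => ?_) (fun X hX Y hY => ?_) X Y
  · change L.bracket X (smulSection f Y) x - L'.bracket X (smulSection f Y) x =
      f x • (L.bracket X Y x - L'.bracket X Y x)
    rw [L.leibniz, L'.leibniz, ha]
    module
  · change L.bracket X Y x - L'.bracket X Y x = -(L.bracket Y X x - L'.bracket Y X x)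
    rw [L.bracket_swap, L'.bracket_swap, ContMDiffSection.coe_neg, ContMDiffSection.coe_neg,
      Pi.neg_apply, Pi.neg_apply]
    abel
  · change L.bracket X Y x - L'.bracket X Y x = 0
    rw [hb X hX Y hY, sub_self]

/-- Closedness of a 1-form can be checked on a generating family, since `dα` is tensorial. -/
theorem mem_cocycles_of_isGenerating {G : Set (SmoothSection I F A)} (hG : IsGenerating G)
    (L : LieAlgebroid I F A) {α : ∀ x, A x →ₗ[ℝ] ℝ} (hα : α ∈ oneForms I F A)
    (h : ∀ X ∈ G, ∀ Y ∈ G, ∀ x, L.lieDerivFun X (fun y => α y (Y y)) x -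
      L.lieDerivFun Y (fun y => α y (X y)) x - α x (L.bracket X Y x) = 0) : α ∈ L.cocycles := by
  refine ⟨hα, fun X Y x => ?_⟩
  have key : ∀ X Y, L.lieDerivAux X ⟨α, hα⟩ x Y - L.lieDerivFun Y (fun y => α y (X y)) x =
      L.lieDerivFun X (fun y => α y (Y y)) x -
      L.lieDerivFun Y (fun y => α y (X y)) x - α x (L.bracket X Y x) := fun X Y => by
    change L.lieDerivFun X (fun y => α y (Y y)) x - α x (L.bracket X Y x) - _ = _
    ring
  rw [← key]
  refine hG.eq_zero₂ (x := x) (fun X => L.lieDerivAux X ⟨α, hα⟩ x -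
    differentialAt (fun y => α y (X y)) x ∘ₗ L.anchor x ∘ₗ (sectionModule I F A).ev x)
    (fun X f Y => ?_) (fun X Y => ?_) (fun X hX Y hY => ?_) X Y
  · rw [LinearMap.sub_apply, L.lieDerivAux_smul, LinearMap.sub_apply, smul_sub]
    simp only [LinearMap.comp_apply, smul_eq_mul]
    congr 1
    have h1 : (sectionModule I F A).ev x (smulSection f Y) =
      f x • (sectionModule I F A).ev x Y := rfl
    rw [h1, map_smul, map_smul, smul_eq_mul]
  · refine (key X Y).trans (Eq.trans ?_ (congrArg Neg.neg (key Y X)).symm)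
    rw [L.bracket_swap, ContMDiffSection.coe_neg, Pi.neg_apply, map_neg]
    ring
  · exact (key X Y).trans (h X hX Y hY x)

variable [CompleteSpace E]

/-- A Lie algebroid structure from an anchor and an antisymmetric bracket with the Leibniz rule. The
Jacobi identity and the compatibility with the anchor need only be checked on a generating
family: the defect `ρ[X, Y] - [ρX, ρY]` is tensorial, and so is then the Jacobiator. -/
def ofGenerating (ρ : ∀ x, A x →ₗ[ℝ] TangentSpace I x)
    (hρ : ∀ X : SmoothSection I F A,
      ContMDiff I I.tangent ∞ fun x => (⟨x, ρ x (X x)⟩ : TangentBundle I M))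
    (b : SmoothSection I F A →ₗ[ℝ] SmoothSection I F A →ₗ[ℝ] SmoothSection I F A)
    (hb : ∀ X, b X X = 0)
    (leib : ∀ (X : SmoothSection I F A) (f : C^∞⟮I, M; ℝ⟯) (Y : SmoothSection I F A) (x : M),
      b X (smulSection f Y) x = f x • b X Y x + dirDeriv I (ρ x (X x)) f • Y x)
    {G : Set (SmoothSection I F A)} (hG : IsGenerating G)
    (hGρ : ∀ X ∈ G, ∀ Y ∈ G, ∀ x, ρ x (b X Y x) =
      VectorField.mlieBracket I (fun y => ρ y (X y)) (fun y => ρ y (Y y)) x)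
    (hGJ : ∀ X ∈ G, ∀ Y ∈ G, ∀ Z ∈ G, b X (b Y Z) = b (b X Y) Z + b Y (b X Z)) :
    LieAlgebroid I F A :=
  let a : SmoothSection I F A → SmoothVectorField I M := fun X => ⟨fun x => ρ x (X x), hρ X⟩
  have swap : ∀ X Y, b X Y = - b Y X := fun X Y => by
    have h := hb (X + Y)
    simp only [map_add, LinearMap.add_apply, hb, zero_add, add_zero] at h
    exact eq_neg_of_add_eq_zero_right h
  have hd : ∀ (X Y : SmoothSection I F A) {f : M → ℝ}, ContMDiff I 𝓘(ℝ, ℝ) ∞ f → ∀ x,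
      dirDeriv I (ρ x (b X Y x)) f = dirDeriv I (ρ x (X x)) (fun y => dirDeriv I (ρ y (Y y)) f) -
        dirDeriv I (ρ x (Y x)) (fun y => dirDeriv I (ρ y (X y)) f) := by
    intro X Y f hf x
    have hsm : ∀ X : SmoothSection I F A, ContMDiff I 𝓘(ℝ, ℝ) ∞ fun y => dirDeriv I (ρ y (X y)) f :=
      fun X => contMDiff_dirDeriv (hρ X) hf
    let Φ : SmoothSection I F A → SmoothSection I F A →ₗ[ℝ] ℝ := fun X =>
      { toFun := fun Y => dirDeriv I (ρ x (b X Y x)) f -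
          (dirDeriv I (ρ x (X x)) (fun y => dirDeriv I (ρ y (Y y)) f) -
          dirDeriv I (ρ x (Y x)) (fun y => dirDeriv I (ρ y (X y)) f))
        map_add' := fun Y Z => by
          simp only [map_add, ContMDiffSection.coe_add, Pi.add_apply, dirDeriv_add_left]
          rw [dirDeriv_add _ (hsm Y) (hsm Z)]
          ring
        map_smul' := fun c Y => by
          simp only [map_smul, ContMDiffSection.coe_smul, Pi.smul_apply, dirDeriv_smul_left,
            RingHom.id_apply, smul_eq_mul]
          rw [dirDeriv_const_mul _ _ (hsm Y)]
          ring }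
    have h0 := hG.eq_zero₂ (x := x) Φ (fun X g Y => ?_) (fun X Y => ?_) (fun X hX Y hY => ?_) X Y
    · exact sub_eq_zero.1 h0
    · change dirDeriv I (ρ x (b X (smulSection g Y) x)) f -
          (dirDeriv I (ρ x (X x)) (fun y => dirDeriv I (ρ y (g y • Y y)) f) -
          dirDeriv I (ρ x (g x • Y x)) (fun y => dirDeriv I (ρ y (X y)) f)) =
        g x • (dirDeriv I (ρ x (b X Y x)) f -
          (dirDeriv I (ρ x (X x)) (fun y => dirDeriv I (ρ y (Y y)) f) -
          dirDeriv I (ρ x (Y x)) (fun y => dirDeriv I (ρ y (X y)) f)))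
      simp only [leib, map_add, map_smul, dirDeriv_add_left, dirDeriv_smul_left, smul_eq_mul]
      rw [dirDeriv_mul _ g.contMDiff (hsm Y)]
      ring
    · change dirDeriv I (ρ x (b X Y x)) f - (_ - _) = -(dirDeriv I (ρ x (b Y X x)) f - (_ - _))
      rw [swap X Y, ContMDiffSection.coe_neg, Pi.neg_apply, map_neg, ← neg_one_smul ℝ,
        dirDeriv_smul_left]
      ring
    · refine sub_eq_zero.2 ?_
      rw [hGρ X hX Y hY]
      exact dirDeriv_vfBracket (a X) (a Y) hf x
  have hJ : ∀ X Y, (∀ Z ∈ G, b X (b Y Z) = b (b X Y) Z + b Y (b X Z)) →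
      ∀ Z, b X (b Y Z) = b (b X Y) Z + b Y (b X Z) := by
    intro X Y h Z
    refine ContMDiffSection.ext fun x => sub_eq_zero.1 ?_
    refine hG.eq_zero (x := x) ((sectionModule I F A).ev x ∘ₗ
      (b X ∘ₗ b Y - (b (b X Y) + b Y ∘ₗ b X))) (fun f Z => ?_) (fun Z hZ => ?_) Z
    · let df : SmoothSection I F A → C^∞⟮I, M; ℝ⟯ := fun X =>
        ⟨_, contMDiff_dirDeriv (hρ X) f.contMDiff⟩
      have hr : ∀ X, b X (smulSection f Z) = smulSection f (b X Z) + smulSection (df X) Z :=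
        fun X => ContMDiffSection.ext fun y => leib X f Z y
      change b X (b Y (smulSection f Z)) x - (b (b X Y) (smulSection f Z) x +
          b Y (b X (smulSection f Z)) x) =
        f x • (b X (b Y Z) x - (b (b X Y) Z x + b Y (b X Z) x))
      rw [hr X, hr Y, map_add, map_add]
      simp only [ContMDiffSection.coe_add, Pi.add_apply]
      rw [leib, leib, leib, leib, leib, hd X Y f.contMDiff]
      change f x • _ + df X x • _ + (df Y x • _ + dirDeriv I (ρ x (X x)) (df Y) • _) -
        (f x • _ + (dirDeriv I (ρ x (X x)) (df Y) - dirDeriv I (ρ x (Y x)) (df X)) • _ +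
          (f x • _ + df Y x • _ + (df X x • _ + dirDeriv I (ρ x (Y x)) (df X) • _))) = _
      module
    · change b X (b Y Z) x - (b (b X Y) Z + b Y (b X Z)) x = 0
      rw [h Z hZ, sub_self]
  { anchor := ρ
    contMDiff_anchor := hρ
    bracket := b
    bracket_self := hb
    leibniz := leib
    anchor_bracket := fun X Y x => eq_of_forall_dirDeriv_eq fun f hf => by
      rw [hd X Y hf]
      exact (dirDeriv_vfBracket (a X) (a Y) hf x).symm
    jacobi := by
      -- the Jacobi identity is symmetric in its three arguments, which are treated one by one
      have h1 : ∀ X ∈ G, ∀ Y ∈ G, ∀ Z, b X (b Y Z) = b (b X Y) Z + b Y (b X Z) :=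
        fun X hX Y hY => hJ X Y (hGJ X hX Y hY)
      have h2 : ∀ X ∈ G, ∀ Y Z, b X (b Y Z) = b (b X Y) Z + b Y (b X Z) := by
        intro X hX Y
        refine hJ X Y fun Z hZ => ?_
        have h := h1 X hX Z hZ Y
        rw [swap Y Z, map_neg, h, swap (b X Y) Z, swap Y (b X Z)]
        abel
      intro X Y
      refine hJ X Y fun Z hZ => ?_
      have h := h2 Z hZ X Y
      rw [swap Y Z, map_neg, swap (b X Y) Z, h, swap X Z, map_neg, swap Y (b Z X),
        swap X (b Z Y)]
      abel }

end LieAlgebroid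

end Generating

/-! ### Time-independent sections, forms and multivector fields -/

section HatBundle

variable {E : Type*} [NormedAddCommGroup E] [NormedSpace ℝ E]
  {H : Type*} [TopologicalSpace H] {I : ModelWithCorners ℝ E H}
  {M : Type*} [TopologicalSpace M] [ChartedSpace H M]
  {F : Type*} [NormedAddCommGroup F] [NormedSpace ℝ F]
  {A : M → Type*} [TopologicalSpace (TotalSpace F A)]
  [∀ x, AddCommGroup (A x)] [∀ x, Module ℝ (A x)] [∀ x, TopologicalSpace (A x)]
  [FiberBundle F A]

/-- A section of the pullback bundle is smooth iff it is smooth as a map to the total space of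
`A`. -/
theorem contMDiff_hat_iff [VectorBundle ℝ F A] [ContMDiffVectorBundle ∞ F A I]
    (Y : ∀ p : M × ℝ, HatBundle I A p) :
    ContMDiff (I.prod 𝓘(ℝ, ℝ)) ((I.prod 𝓘(ℝ, ℝ)).prod 𝓘(ℝ, F)) ∞
      (fun p => TotalSpace.mk' F p (Y p)) ↔
    ContMDiff (I.prod 𝓘(ℝ, ℝ)) (I.prod 𝓘(ℝ, F)) ∞
      (fun p : M × ℝ => (⟨p.1, Y p⟩ : TotalSpace F A)) := by
  refine forall_congr' fun p => ?_
  refine (contMDiffAt_section (IB := I.prod 𝓘(ℝ, ℝ)) (E := HatBundle I A) (s := Y) p).trans ?_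
  refine Iff.trans ?_ contMDiffAt_totalSpace.symm
  exact ⟨fun h => ⟨contMDiffAt_fst, h⟩, fun h => h.2⟩

variable [VectorBundle ℝ F A] [ContMDiffVectorBundle ∞ F A I]
  [FiniteDimensional ℝ E] [FiniteDimensional ℝ F] [IsManifold I ∞ M] [T2Space M]

theorem hatOneForm_mem {α : ∀ x, A x →ₗ[ℝ] ℝ} (hα : α ∈ oneForms I F A) :
    hatOneForm I α ∈ oneForms (I.prod 𝓘(ℝ, ℝ)) F (HatBundle I A) := fun Y =>
  contMDiff_oneForm_comp hα ((contMDiff_hat_iff _).1 Y.contMDiff)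

/-- A smooth 1-form on `A`, seen as a smooth time-independent 1-form on `Â`. -/
def hatForm (α : oneForms I F A) : oneForms (I.prod 𝓘(ℝ, ℝ)) F (HatBundle I A) :=
  ⟨hatOneForm I α.1, hatOneForm_mem α.2⟩

variable (I F A) in
theorem isGenerating_hatSection :
    IsGenerating (Set.range (hatSection I : SmoothSection I F A → _)) := by
  intro p v
  obtain ⟨X, hX⟩ := exists_section_eq (I := I) (F := F) (A := A) p.1 v
  exact ⟨_, ⟨X, rfl⟩, hX⟩

theorem isTopSection_hatMultivector {n : ℕ} {η : ∀ x, (A x →ₗ[ℝ] ℝ) [⋀^Fin n]→ₗ[ℝ] ℝ}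
    (hη : IsTopSection I F A η) :
    IsTopSection (I.prod 𝓘(ℝ, ℝ)) F (HatBundle I A) (hatMultivector I η) where
  smooth α p := by
    obtain ⟨ψ, r, s, θ, hψ, h⟩ := exists_section_frame I F A p.1
    have hη' : (formModule I F A).IsSmooth η := hη.smooth
    refine hη'.contMDiffAt_comp (I' := I.prod 𝓘(ℝ, ℝ)) contMDiff_fst θ (ψ * ψ) ?_
      (fun i q => (α i).1 q) (fun i j q => (α i).1 q (hatSection I (s j) q))
      (fun i j => (α i).2 _) (fun i q => LinearMap.ext fun v => ?_)
    · change ψ p.1 * ψ p.1 = 1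
      rw [hψ, one_mul]
    · have h1 := congrArg ((α i).1 q) (h q.1 v)
      rw [LinearMap.sum_apply]
      refine Eq.trans (((α i).1 q).map_smul _ _).symm (h1.trans
        ((map_sum ((α i).1 q) _ _).trans ?_))
      refine Finset.sum_congr rfl fun j _ => ?_
      refine (((α i).1 q).map_smul _ _).trans ?_
      rw [smul_eq_mul, mul_comm]
      rfl
  ne_zero p := hη.ne_zero p.1

theorem isTopSection_expHatMultivector {n : ℕ} {η : ∀ x, (A x →ₗ[ℝ] ℝ) [⋀^Fin n]→ₗ[ℝ] ℝ}
    (hη : IsTopSection I F A η) :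
    IsTopSection (I.prod 𝓘(ℝ, ℝ)) F (HatBundle I A) (expHatMultivector I η) where
  smooth α := by
    have h : ContMDiff (I.prod 𝓘(ℝ, ℝ)) 𝓘(ℝ, ℝ) ∞
        (fun p : M × ℝ => Real.exp (-((n : ℝ) - 1) * p.2)) :=
      (Real.contDiff_exp.comp (contDiff_const.mul contDiff_id)).contMDiff.comp contMDiff_snd
    exact h.mul ((isTopSection_hatMultivector hη).smooth α)
  ne_zero p := smul_ne_zero (Real.exp_pos _).ne' (hη.ne_zero p.1)

theorem contMDiff_sndVec (W : SmoothVectorField (I.prod 𝓘(ℝ, ℝ)) (M × ℝ)) :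
    ContMDiff (I.prod 𝓘(ℝ, ℝ)) 𝓘(ℝ, ℝ) ∞ fun p => sndVec p (W p) := by
  have h := contMDiff_dirDeriv W.contMDiff
    (contMDiff_snd (I := I) (J := 𝓘(ℝ, ℝ)) (M := M) (N := ℝ) (n := ∞))
  exact h.congr fun p => (dirDeriv_snd p (W p)).symm

theorem contMDiff_fstVec (W : SmoothVectorField (I.prod 𝓘(ℝ, ℝ)) (M × ℝ)) :
    ContMDiff (I.prod 𝓘(ℝ, ℝ)) I.tangent ∞
      fun p => (⟨p.1, fstVec p (W p)⟩ : TangentBundle I M) := by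
  have h1 : ContMDiff (I.prod 𝓘(ℝ, ℝ)).tangent I.tangent ∞
      (tangentMap (I.prod 𝓘(ℝ, ℝ)) I (Prod.fst : M × ℝ → M)) :=
    (contMDiff_fst (n := ∞)).contMDiff_tangentMap (by simp)
  exact h1.comp W.contMDiff

/-- The vector field on `M × ℝ` with components `V`, a vector field along the projection to `M`,
and `h ∂/∂t`. -/
def prodField (V : ∀ p : M × ℝ, TangentSpace I p.1) (h : M × ℝ → ℝ)
    (hV : ContMDiff (I.prod 𝓘(ℝ, ℝ)) I.tangent ∞ fun p => (⟨p.1, V p⟩ : TangentBundle I M))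
    (hh : ContMDiff (I.prod 𝓘(ℝ, ℝ)) 𝓘(ℝ, ℝ) ∞ h) :
    SmoothVectorField (I.prod 𝓘(ℝ, ℝ)) (M × ℝ) :=
  ⟨fun p => prodVec p (V p) (h p), by
    have : IsManifold I 1 M := IsManifold.of_le (n := ∞) (by norm_cast)
    have h1 : ContMDiff (I.prod 𝓘(ℝ, ℝ)) 𝓘(ℝ, ℝ).tangent ∞
        fun p => (⟨p.2, h p⟩ : TangentBundle 𝓘(ℝ, ℝ) ℝ) := fun p => by
      refine contMDiffAt_totalSpace.2 ⟨contMDiffAt_snd, ?_⟩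
      simpa using hh p
    exact (contMDiff_equivTangentBundleProd_symm (I := I) (I' := 𝓘(ℝ, ℝ))).comp (hV.prodMk h1)⟩

/-- The lift of a vector field on `M` to `M × ℝ`, plus `h ∂/∂t`. -/
def liftField (V : SmoothVectorField I M) (h : C^∞⟮I, M; ℝ⟯) :
    SmoothVectorField (I.prod 𝓘(ℝ, ℝ)) (M × ℝ) :=
  prodField (fun p => V p.1) (fun p => h p.1) (V.contMDiff.comp contMDiff_fst)
    (h.contMDiff.comp contMDiff_fst)

open scoped TensorProduct in
theorem isSmoothForm_wedgeDt {d : ℕ} {μ : ∀ x : M, (TangentSpace I x) [⋀^Fin d]→ₗ[ℝ] ℝ}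
    (hμ : IsSmoothForm I μ) : IsSmoothForm (I.prod 𝓘(ℝ, ℝ)) (wedgeDt I μ) := by
  intro W
  -- each term of the shuffle sum is the product of a value of `μ` and a value of `dt`
  have h1 : ∀ k : Fin d → Fin (d + 1), ContMDiff (I.prod 𝓘(ℝ, ℝ)) 𝓘(ℝ, ℝ) ∞
      fun p => μ p.1 fun i => fstVec p (W (k i) p) := by
    intro k p
    obtain ⟨ψ, r, s, θ, hψ, h⟩ :=
      exists_section_frame I E (TangentSpace I : M → Type _) p.1
    have hμ' : (sectionModule I E (TangentSpace I : M → Type _)).IsSmooth μ := hμ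
    refine hμ'.contMDiffAt_comp (I' := I.prod 𝓘(ℝ, ℝ)) (N := M × ℝ) contMDiff_fst s (ψ * ψ) ?_
      (fun i (q : M × ℝ) => fstVec q (W (k i) q)) (fun i j q => (θ j).1 q.1 (fstVec q (W (k i) q)))
      (fun i j => contMDiff_oneForm_comp (I := I) (θ j).2 (contMDiff_fstVec (W (k i))))
      (fun i q => h q.1 _)
    change ψ p.1 * ψ p.1 = 1
    rw [hψ, one_mul]
  let a : ∀ p : M × ℝ, (TangentSpace (I.prod 𝓘(ℝ, ℝ)) p) [⋀^Fin d]→ₗ[ℝ] ℝ :=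
    fun p => (μ p.1).compLinearMap (fstVec p)
  let b : ∀ p : M × ℝ, (TangentSpace (I.prod 𝓘(ℝ, ℝ)) p) [⋀^Fin 1]→ₗ[ℝ] ℝ := fun p =>
    AlternatingMap.ofSubsingleton ℝ (TangentSpace (I.prod 𝓘(ℝ, ℝ)) p) ℝ (0 : Fin 1) (sndVec p)
  have h2 : (fun p => wedgeDt I μ p fun i => W i p) = fun p =>
      ∑ σ : Equiv.Perm.ModSumCongr (Fin d) (Fin 1), LinearMap.mul' ℝ ℝ
        (AlternatingMap.domCoprod.summand (a p) (b p) σ fun i => W (finSumFinEquiv i) p) := by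
    funext p
    refine Eq.trans ?_ (map_sum (LinearMap.mul' ℝ ℝ) _ _)
    change LinearMap.mul' ℝ ℝ ((a p).domCoprod (b p) fun i => W (finSumFinEquiv i) p) = _
    rw [AlternatingMap.domCoprod_apply, _root_.sum_apply]
  rw [h2]
  refine contMDiff_finsetSum fun σ _ => ?_
  induction σ using Quotient.inductionOn' with | _ σ
  have h3 := (contMDiff_const (c := ((Equiv.Perm.sign σ : ℤ) : ℝ))).mul
    ((h1 fun i => finSumFinEquiv (σ (Sum.inl i))).mul
      (contMDiff_sndVec (W (finSumFinEquiv (σ (Sum.inr 0))))))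
  refine h3.congr fun p => ?_
  rw [AlternatingMap.domCoprod.summand_mk'']
  change LinearMap.mul' ℝ ℝ (Equiv.Perm.sign σ •
    ((a p fun i => W (finSumFinEquiv (σ (Sum.inl i))) p) ⊗ₜ[ℝ]
      (b p fun i => W (finSumFinEquiv (σ (Sum.inr i))) p))) = _
  rw [Units.smul_def, map_zsmul, zsmul_eq_mul]
  rfl

theorem isVolumeForm_wedgeDt {d : ℕ} {μ : ∀ x : M, (TangentSpace I x) [⋀^Fin d]→ₗ[ℝ] ℝ}
    (hμ : IsVolumeForm I μ) : IsVolumeForm (I.prod 𝓘(ℝ, ℝ)) (wedgeDt I μ) where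
  smooth := isSmoothForm_wedgeDt hμ.smooth
  ne_zero p h := hμ.ne_zero p.1 <| AlternatingMap.ext fun v => by
    have h1 := wedgeDt_snoc μ p (Fin.snoc (fun i => prodVec p (v i) 0) (prodVec p 0 1))
      (by simp) (by simp)
    rw [h] at h1
    simpa using h1.symm

end HatBundle

/-! ### The Lie algebroid structure on `Â` -/

section HatAlgebroid

variable {E : Type*} [NormedAddCommGroup E] [NormedSpace ℝ E]
  {H : Type*} [TopologicalSpace H] {I : ModelWithCorners ℝ E H}
  {M : Type*} [TopologicalSpace M] [ChartedSpace H M]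
  {F : Type*} [NormedAddCommGroup F] [NormedSpace ℝ F]
  {A : M → Type*} [TopologicalSpace (TotalSpace F A)]
  [∀ x, AddCommGroup (A x)] [∀ x, Module ℝ (A x)] [∀ x, TopologicalSpace (A x)]
  [FiberBundle F A] [VectorBundle ℝ F A] [ContMDiffVectorBundle ∞ F A I]
  [FiniteDimensional ℝ E] [FiniteDimensional ℝ F] [IsManifold I ∞ M] [T2Space M]

/-- A rough section is smooth if locally some multiple of it by a nonvanishing function is. -/
theorem contMDiff_section_of_smul {T : ∀ x, A x}
    (h : ∀ x, ∃ (ψ : C^∞⟮I, M; ℝ⟯) (Z : SmoothSection I F A), ψ x ≠ 0 ∧ ∀ y, ψ y • T y = Z y) :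
    ContMDiff I (I.prod 𝓘(ℝ, F)) ∞ fun x => TotalSpace.mk' F x (T x) := by
  intro x
  obtain ⟨ψ, Z, hψ, hZ⟩ := h x
  have h1 : ContMDiffAt I 𝓘(ℝ, ℝ) ∞ (fun y => (ψ y)⁻¹) x := (ψ.contMDiff x).inv₀ hψ
  have h2 := h1.smul_section (Z.contMDiff x)
  refine h2.congr_of_eventuallyEq ?_
  filter_upwards [ψ.contMDiff.continuous.continuousAt.eventually_ne hψ] with y hy
  change TotalSpace.mk' F y (T y) = TotalSpace.mk' F y ((ψ y)⁻¹ • Z y)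
  rw [← hZ, inv_smul_smul₀ hy]

/-- Up to a cut-off function, sections of `Â` are combinations of time-independent sections. -/
theorem exists_hatSection_frame (p : M × ℝ) : ∃ (ψ : C^∞⟮I.prod 𝓘(ℝ, ℝ), M × ℝ; ℝ⟯) (r : ℕ)
    (s : Fin r → SmoothSection I F A), ψ p = 1 ∧
    ∀ Y : SmoothSection (I.prod 𝓘(ℝ, ℝ)) F (HatBundle I A),
      ∃ c : Fin r → C^∞⟮I.prod 𝓘(ℝ, ℝ), M × ℝ; ℝ⟯,
        smulSection ψ Y = ∑ i, smulSection (c i) (hatSection I (s i)) := by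
  obtain ⟨ψ, r, s, θ, hψ, h⟩ := exists_section_frame I F A p.1
  refine ⟨hatFun (ψ * ψ), r, s, ?_, fun Y => ⟨fun i => ⟨_, (hatForm (θ i)).2 Y⟩, ?_⟩⟩
  · change ψ p.1 * ψ p.1 = 1
    rw [hψ, one_mul]
  · refine ContMDiffSection.ext fun q => ?_
    rw [ContMDiffSection.sum_apply]
    exact h q.1 (Y q)

/-- The section `x ↦ X(x, t)` of `A`. -/
def slice (t : ℝ) : SmoothSection (I.prod 𝓘(ℝ, ℝ)) F (HatBundle I A) →ₗ[ℝ] SmoothSection I F A where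
  toFun X := ⟨fun x => X (x, t), by
    have h := (contMDiff_hat_iff (I := I) (A := A) (F := F) _).1 X.contMDiff
    exact h.comp (contMDiff_id.prodMk contMDiff_const)⟩
  map_add' _ _ := rfl
  map_smul' _ _ := rfl

/-- The identification of a fibre with the model fibre by the preferred trivialization. -/
def fiberEquiv (F : Type*) [NormedAddCommGroup F] [NormedSpace ℝ F]
    (A : M → Type*) [TopologicalSpace (TotalSpace F A)]
    [∀ x, AddCommGroup (A x)] [∀ x, Module ℝ (A x)] [∀ x, TopologicalSpace (A x)]
    [FiberBundle F A] [VectorBundle ℝ F A] (x : M) : A x ≃L[ℝ] F :=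
  (trivializationAt F A x).continuousLinearEquivAt ℝ x
    (FiberBundle.mem_baseSet_trivializationAt' x)

theorem differentiable_fiberEquiv (X : SmoothSection (I.prod 𝓘(ℝ, ℝ)) F (HatBundle I A)) (x : M) :
    Differentiable ℝ fun t => fiberEquiv F A x (X (x, t)) := by
  have h := (contMDiff_hat_iff (I := I) (A := A) (F := F) _).1 X.contMDiff
  have h1 : ContMDiff 𝓘(ℝ, ℝ) (I.prod 𝓘(ℝ, F)) ∞
      fun t : ℝ => (⟨x, X (x, t)⟩ : TotalSpace F A) :=
    h.comp (contMDiff_const.prodMk contMDiff_id)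
  have h2 : ContMDiff 𝓘(ℝ, ℝ) 𝓘(ℝ, F) ∞ fun t => fiberEquiv F A x (X (x, t)) :=
    fun t => (contMDiffAt_totalSpace.1 (h1 t)).2
  exact h2.contDiff.differentiable (by simp)

/-- The time derivative of a section of `Â`; the fibres do not depend on time. -/
def timeDeriv (p : M × ℝ) : SmoothSection (I.prod 𝓘(ℝ, ℝ)) F (HatBundle I A) →ₗ[ℝ] A p.1 where
  toFun X := (fiberEquiv F A p.1).symm (deriv (fun t => fiberEquiv F A p.1 (X (p.1, t))) p.2)
  map_add' X Y := by
    rw [← map_add, ← deriv_fun_add (differentiable_fiberEquiv X p.1 _)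
      (differentiable_fiberEquiv Y p.1 _)]
    congr 2
    funext t
    exact map_add (fiberEquiv F A p.1) (X (p.1, t)) (Y (p.1, t))
  map_smul' c X := by
    rw [RingHom.id_apply, ← map_smul, ← deriv_fun_const_smul c (differentiable_fiberEquiv X p.1 _)]
    congr 2
    funext t
    exact map_smul (fiberEquiv F A p.1) c (X (p.1, t))

theorem timeDeriv_smul (p : M × ℝ) (f : C^∞⟮I.prod 𝓘(ℝ, ℝ), M × ℝ; ℝ⟯)
    (X : SmoothSection (I.prod 𝓘(ℝ, ℝ)) F (HatBundle I A)) :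
    timeDeriv p (smulSection f X) =
      f p • timeDeriv p X + deriv (fun t => f (p.1, t)) p.2 • slice p.2 X p.1 := by
  have hf : Differentiable ℝ fun t => f (p.1, t) := by
    have h : ContMDiff 𝓘(ℝ, ℝ) 𝓘(ℝ, ℝ) ∞ fun t => f (p.1, t) :=
      f.contMDiff.comp (contMDiff_const.prodMk contMDiff_id)
    exact h.contDiff.differentiable (by simp)
  have h1 : (fun t => fiberEquiv F A p.1 (smulSection f X (p.1, t))) =
      fun t => f (p.1, t) • fiberEquiv F A p.1 (X (p.1, t)) :=
    funext fun t => map_smul (fiberEquiv F A p.1) (f (p.1, t)) (X (p.1, t))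
  change (fiberEquiv F A p.1).symm (deriv (fun t => fiberEquiv F A p.1
    (smulSection f X (p.1, t))) p.2) = _
  rw [h1, deriv_fun_smul (hf _) (differentiable_fiberEquiv X p.1 _), map_add, map_smul, map_smul]
  congr 2
  exact (fiberEquiv F A p.1).symm_apply_apply (X p)

theorem timeDeriv_hatSection (p : M × ℝ) (X : SmoothSection I F A) :
    timeDeriv p (hatSection I X) = 0 := by
  change (fiberEquiv F A p.1).symm (deriv (fun t => fiberEquiv F A p.1 (X p.1)) p.2) = 0
  rw [deriv_const, map_zero]

namespace LieAlgebroid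

variable (L : LieAlgebroid I F A) (φ₀ : ∀ x, A x →ₗ[ℝ] ℝ)

/-- The anchor `ρ(X) + φ₀(X) ∂/∂t` of `Â`. -/
def hatAnchor (p : M × ℝ) : HatBundle I A p →ₗ[ℝ] TangentSpace (I.prod 𝓘(ℝ, ℝ)) p where
  toFun a := prodVec p (L.anchor p.1 a) (φ₀ p.1 a)
  map_add' a b := prodVec_ext
    (by rw [map_add, fstVec_prodVec, fstVec_prodVec, fstVec_prodVec]
        exact (L.anchor p.1).map_add a b)
    (by rw [map_add, sndVec_prodVec, sndVec_prodVec, sndVec_prodVec]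
        exact (φ₀ p.1).map_add a b)
  map_smul' c a := prodVec_ext
    (by rw [map_smul, fstVec_prodVec, fstVec_prodVec]
        exact (L.anchor p.1).map_smul c a)
    (by rw [map_smul, sndVec_prodVec, sndVec_prodVec]
        exact (φ₀ p.1).map_smul c a)

/-- The bracket of `Â` at `p = (x, t)`:
`[X_t, Y_t](x) + φ₀(X) ∂Y/∂t - φ₀(Y) ∂X/∂t`. -/
def hatBracketAt (p : M × ℝ) (X : SmoothSection (I.prod 𝓘(ℝ, ℝ)) F (HatBundle I A)) :
    SmoothSection (I.prod 𝓘(ℝ, ℝ)) F (HatBundle I A) →ₗ[ℝ] A p.1 :=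
  (sectionModule I F A).ev p.1 ∘ₗ L.bracket (slice p.2 X) ∘ₗ slice p.2 +
    φ₀ p.1 (X p) • timeDeriv p -
    (LinearMap.toSpanSingleton ℝ (A p.1) (timeDeriv p X)) ∘ₗ φ₀ p.1 ∘ₗ
      (sectionModule (I.prod 𝓘(ℝ, ℝ)) F (HatBundle I A)).ev p

theorem hatBracketAt_apply (p : M × ℝ)
    (X Y : SmoothSection (I.prod 𝓘(ℝ, ℝ)) F (HatBundle I A)) :
    L.hatBracketAt φ₀ p X Y = L.bracket (slice p.2 X) (slice p.2 Y) p.1 +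
      φ₀ p.1 (X p) • timeDeriv p Y - φ₀ p.1 (Y p) • timeDeriv p X := rfl

theorem hatBracketAt_swap (p : M × ℝ)
    (X Y : SmoothSection (I.prod 𝓘(ℝ, ℝ)) F (HatBundle I A)) :
    L.hatBracketAt φ₀ p X Y = -L.hatBracketAt φ₀ p Y X := by
  rw [hatBracketAt_apply, hatBracketAt_apply, L.bracket_swap, ContMDiffSection.coe_neg,
    Pi.neg_apply]
  abel

theorem hatBracketAt_self (p : M × ℝ) (X : SmoothSection (I.prod 𝓘(ℝ, ℝ)) F (HatBundle I A)) :
    L.hatBracketAt φ₀ p X X = 0 := by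
  rw [hatBracketAt_apply, L.bracket_self, add_sub_cancel_right]
  rfl

theorem hatBracketAt_smul (p : M × ℝ) (X Y : SmoothSection (I.prod 𝓘(ℝ, ℝ)) F (HatBundle I A))
    (f : C^∞⟮I.prod 𝓘(ℝ, ℝ), M × ℝ; ℝ⟯) :
    L.hatBracketAt φ₀ p X (smulSection f Y) = f p • L.hatBracketAt φ₀ p X Y +
      dirDeriv (I.prod 𝓘(ℝ, ℝ)) (L.hatAnchor φ₀ p (X p)) f • slice p.2 Y p.1 := by
  let ft : C^∞⟮I, M; ℝ⟯ :=
    ⟨fun x => f (x, p.2), f.contMDiff.comp (contMDiff_id.prodMk contMDiff_const)⟩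
  have h1 : slice p.2 (smulSection f Y) = smulSection ft (slice p.2 Y) := rfl
  have h2 : φ₀ p.1 (smulSection f Y p) = f p * φ₀ p.1 (Y p) := (φ₀ p.1).map_smul (f p) (Y p)
  have h3 : dirDeriv (I.prod 𝓘(ℝ, ℝ)) (L.hatAnchor φ₀ p (X p)) f =
      dirDeriv I (L.anchor p.1 (slice p.2 X p.1)) ft +
        φ₀ p.1 (X p) * deriv (fun t => f (p.1, t)) p.2 := dirDeriv_prodVec _ _ _ f.contMDiff
  rw [hatBracketAt_apply, hatBracketAt_apply, h1, h2, h3, L.leibniz, timeDeriv_smul]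
  change f p • _ + _ • slice p.2 Y p.1 + _ - _ = _
  module

theorem hatBracketAt_hat (p : M × ℝ) (X Y : SmoothSection I F A) :
    L.hatBracketAt φ₀ p (hatSection I X) (hatSection I Y) = L.bracket X Y p.1 := by
  rw [hatBracketAt_apply, timeDeriv_hatSection, timeDeriv_hatSection, smul_zero, smul_zero,
    add_zero, sub_zero]
  rfl

variable {φ₀}

theorem contMDiff_hatAnchor (hφ₀ : φ₀ ∈ oneForms I F A)
    (X : SmoothSection (I.prod 𝓘(ℝ, ℝ)) F (HatBundle I A)) :
    ContMDiff (I.prod 𝓘(ℝ, ℝ)) (I.prod 𝓘(ℝ, ℝ)).tangent ∞ fun p =>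
      (⟨p, L.hatAnchor φ₀ p (X p)⟩ : TangentBundle (I.prod 𝓘(ℝ, ℝ)) (M × ℝ)) := by
  have h : ContMDiff (I.prod 𝓘(ℝ, ℝ)) ((I.prod 𝓘(ℝ, ℝ)).prod 𝓘(ℝ, E)) ∞
      (fun p : M × ℝ => TotalSpace.mk' E (E := HatBundle I (TangentSpace I : M → Type _)) p
        (L.anchor p.1 (X p))) := by
    refine contMDiff_section_of_smul fun p => ?_
    obtain ⟨ψ, r, s, hψ, h⟩ := exists_hatSection_frame (I := I) (F := F) (A := A) p
    obtain ⟨c, hc⟩ := h X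
    refine ⟨ψ, ∑ i, smulSection (c i) (hatSection I (L.anchorField (s i))), ?_, fun q => ?_⟩
    · rw [hψ]
      exact one_ne_zero
    · rw [ContMDiffSection.sum_apply]
      have h1 := congrArg (fun Z => L.anchor q.1 (Z q)) hc
      simp only [ContMDiffSection.sum_apply] at h1
      refine ((L.anchor q.1).map_smul (ψ q) (X q)).symm.trans (h1.trans ?_)
      refine (map_sum (L.anchor q.1) _ _).trans (Finset.sum_congr rfl fun i _ => ?_)
      exact (L.anchor q.1).map_smul _ _
  exact (prodField _ _ ((contMDiff_hat_iff _).1 h) (hatOneForm_mem hφ₀ X)).contMDiff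

/-- By the Leibniz rule, `[X, Y]` is smooth for all `Y` if it is smooth for time-independent `Y`. -/
theorem contMDiff_hatBracketAt_of_hat (hφ₀ : φ₀ ∈ oneForms I F A)
    {X : SmoothSection (I.prod 𝓘(ℝ, ℝ)) F (HatBundle I A)}
    (hX : ∀ s : SmoothSection I F A, ContMDiff (I.prod 𝓘(ℝ, ℝ)) ((I.prod 𝓘(ℝ, ℝ)).prod 𝓘(ℝ, F)) ∞
      (fun p => TotalSpace.mk' F (E := HatBundle I A) p (L.hatBracketAt φ₀ p X (hatSection I s))))
    (Y : SmoothSection (I.prod 𝓘(ℝ, ℝ)) F (HatBundle I A)) :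
    ContMDiff (I.prod 𝓘(ℝ, ℝ)) ((I.prod 𝓘(ℝ, ℝ)).prod 𝓘(ℝ, F)) ∞
      (fun p => TotalSpace.mk' F (E := HatBundle I A) p (L.hatBracketAt φ₀ p X Y)) := by
  refine contMDiff_section_of_smul fun p => ?_
  obtain ⟨ψ, r, s, hψ, h⟩ := exists_hatSection_frame (I := I) (F := F) (A := A) p
  obtain ⟨c, hc⟩ := h Y
  let d : C^∞⟮I.prod 𝓘(ℝ, ℝ), M × ℝ; ℝ⟯ → C^∞⟮I.prod 𝓘(ℝ, ℝ), M × ℝ; ℝ⟯ := fun f =>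
    ⟨_, contMDiff_dirDeriv (L.contMDiff_hatAnchor hφ₀ X) f.contMDiff⟩
  let B : Fin r → SmoothSection (I.prod 𝓘(ℝ, ℝ)) F (HatBundle I A) := fun i => ⟨_, hX (s i)⟩
  refine ⟨ψ, (∑ i, (smulSection (c i) (B i) + smulSection (d (c i)) (hatSection I (s i)))) -
    smulSection (d ψ) Y, ?_, fun q => ?_⟩
  · rw [hψ]
    exact one_ne_zero
  · have h1 := congrArg (L.hatBracketAt φ₀ q X) hc
    rw [L.hatBracketAt_smul φ₀, map_sum] at h1
    simp only [L.hatBracketAt_smul φ₀] at h1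
    rw [ContMDiffSection.coe_sub, Pi.sub_apply, ContMDiffSection.sum_apply]
    exact eq_sub_of_add_eq h1

theorem contMDiff_hatBracketAt (hφ₀ : φ₀ ∈ oneForms I F A)
    (X Y : SmoothSection (I.prod 𝓘(ℝ, ℝ)) F (HatBundle I A)) :
    ContMDiff (I.prod 𝓘(ℝ, ℝ)) ((I.prod 𝓘(ℝ, ℝ)).prod 𝓘(ℝ, F)) ∞
      (fun p => TotalSpace.mk' F (E := HatBundle I A) p (L.hatBracketAt φ₀ p X Y)) := by
  have h1 : ∀ s Y, ContMDiff (I.prod 𝓘(ℝ, ℝ)) ((I.prod 𝓘(ℝ, ℝ)).prod 𝓘(ℝ, F)) ∞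
      (fun p => TotalSpace.mk' F (E := HatBundle I A) p
        (L.hatBracketAt φ₀ p (hatSection I s) Y)) := fun s =>
    L.contMDiff_hatBracketAt_of_hat hφ₀ fun s' => by
      simp only [hatBracketAt_hat]
      exact (hatSection I (L.bracket s s')).contMDiff
  -- by antisymmetry the first argument may be taken time-independent as well
  refine L.contMDiff_hatBracketAt_of_hat hφ₀ (fun s => ?_) Y
  simp only [L.hatBracketAt_swap φ₀ _ X]
  exact (h1 s X).neg_section

/-- The bracket of `Â`. -/
def hatBracket (hφ₀ : φ₀ ∈ oneForms I F A) :
    SmoothSection (I.prod 𝓘(ℝ, ℝ)) F (HatBundle I A) →ₗ[ℝ]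
      SmoothSection (I.prod 𝓘(ℝ, ℝ)) F (HatBundle I A) →ₗ[ℝ]
        SmoothSection (I.prod 𝓘(ℝ, ℝ)) F (HatBundle I A) :=
  LinearMap.mk₂ ℝ (fun X Y => ⟨fun p => L.hatBracketAt φ₀ p X Y, L.contMDiff_hatBracketAt hφ₀ X Y⟩)
    (fun X Y Z => ContMDiffSection.ext fun p => by
      change L.hatBracketAt φ₀ p (X + Y) Z = L.hatBracketAt φ₀ p X Z + L.hatBracketAt φ₀ p Y Z
      rw [hatBracketAt_swap, map_add, L.hatBracketAt_swap φ₀ p X, L.hatBracketAt_swap φ₀ p Y,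
        neg_add])
    (fun c X Y => ContMDiffSection.ext fun p => by
      change L.hatBracketAt φ₀ p (c • X) Y = c • L.hatBracketAt φ₀ p X Y
      rw [hatBracketAt_swap, map_smul, L.hatBracketAt_swap φ₀ p X, smul_neg])
    (fun X Y Z => ContMDiffSection.ext fun p => map_add (L.hatBracketAt φ₀ p X) Y Z)
    (fun c X Y => ContMDiffSection.ext fun p => map_smul (L.hatBracketAt φ₀ p X) c Y)

theorem hatBracket_hat (hφ₀ : φ₀ ∈ oneForms I F A) (X Y : SmoothSection I F A) :
    L.hatBracket hφ₀ (hatSection I X) (hatSection I Y) = hatSection I (L.bracket X Y) :=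
  ContMDiffSection.ext fun p => L.hatBracketAt_hat φ₀ p X Y

end LieAlgebroid

variable [CompleteSpace E]

/-- The component along `M` of a bracket of projectable vector fields. -/
theorem fstVec_vfBracket {V W : SmoothVectorField (I.prod 𝓘(ℝ, ℝ)) (M × ℝ)}
    {V' W' : SmoothVectorField I M} (hV : ∀ p, fstVec p (V p) = V' p.1)
    (hW : ∀ p, fstVec p (W p) = W' p.1) (p : M × ℝ) :
    fstVec p (vfBracket V W p) = vfBracket V' W' p.1 := by
  refine eq_of_forall_dirDeriv_eq fun f hf => ?_
  rw [← dirDeriv_comp_fst p _ hf,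
    dirDeriv_vfBracket (f := fun q : M × ℝ => f q.1) V W (hf.comp contMDiff_fst),
    dirDeriv_vfBracket V' W' hf]
  have h : ∀ q (w : TangentSpace (I.prod 𝓘(ℝ, ℝ)) q), dirDeriv (I.prod 𝓘(ℝ, ℝ)) w
      (fun q => f q.1) = dirDeriv I (fstVec q w) f := fun q w => dirDeriv_comp_fst q w hf
  simp only [h, hV, hW]
  rw [dirDeriv_comp_fst p _ (contMDiff_dirDeriv W'.contMDiff hf),
    dirDeriv_comp_fst p _ (contMDiff_dirDeriv V'.contMDiff hf), hV, hW]

/-- The component along `ℝ` of a bracket of vector fields with time-independent `∂/∂t`-parts. -/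
theorem sndVec_vfBracket {V W : SmoothVectorField (I.prod 𝓘(ℝ, ℝ)) (M × ℝ)}
    {f g : C^∞⟮I, M; ℝ⟯} (hV : ∀ p, sndVec p (V p) = f p.1)
    (hW : ∀ p, sndVec p (W p) = g p.1) (p : M × ℝ) :
    sndVec p (vfBracket V W p) =
      dirDeriv I (fstVec p (V p)) g - dirDeriv I (fstVec p (W p)) f := by
  rw [← dirDeriv_snd p, dirDeriv_vfBracket V W contMDiff_snd]
  simp only [dirDeriv_snd, hV, hW]
  rw [dirDeriv_comp_fst p _ g.contMDiff, dirDeriv_comp_fst p _ f.contMDiff]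

namespace LieAlgebroid

variable (L : LieAlgebroid I F A) {φ₀ : ∀ x, A x →ₗ[ℝ] ℝ}

/-- The Lie algebroid `Â`. On time-independent sections the anchor is a homomorphism because `φ₀`
is closed. -/
def hat (hφ₀ : φ₀ ∈ L.cocycles) : LieAlgebroid (I.prod 𝓘(ℝ, ℝ)) F (HatBundle I A) :=
  ofGenerating (L.hatAnchor φ₀) (L.contMDiff_hatAnchor hφ₀.1) (L.hatBracket hφ₀.1)
    (fun X => ContMDiffSection.ext fun p => L.hatBracketAt_self φ₀ p X)
    (fun X f Y p => L.hatBracketAt_smul φ₀ p X Y f)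
    (isGenerating_hatSection I F A)
    (by
      rintro _ ⟨X, rfl⟩ _ ⟨Y, rfl⟩ p
      rw [hatBracket_hat]
      let V : SmoothSection I F A → SmoothVectorField (I.prod 𝓘(ℝ, ℝ)) (M × ℝ) := fun X =>
        ⟨_, L.contMDiff_hatAnchor hφ₀.1 (hatSection I X)⟩
      have hV : ∀ X p, fstVec p (V X p) = L.anchorField X p.1 := fun X p => fstVec_prodVec p _ _
      let g : SmoothSection I F A → C^∞⟮I, M; ℝ⟯ := fun X => ⟨_, hφ₀.1 X⟩
      have hV' : ∀ X p, sndVec p (V X p) = g X p.1 := fun X p => sndVec_prodVec p _ _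
      refine prodVec_ext ?_ ?_
      · refine Eq.trans ?_ (fstVec_vfBracket (hV X) (hV Y) p).symm
        rw [← anchorField_bracket]
        exact fstVec_prodVec p _ _
      · refine Eq.trans ?_ (sndVec_vfBracket (hV' X) (hV' Y) p).symm
        rw [hV, hV]
        refine (sndVec_prodVec p _ _).trans ?_
        exact (sub_eq_zero.1 (hφ₀.2 X Y p.1)).symm)
    (by
      rintro _ ⟨X, rfl⟩ _ ⟨Y, rfl⟩ _ ⟨Z, rfl⟩
      simp only [hatBracket_hat]
      rw [L.jacobi]
      rfl)

theorem isInduced_hat (hφ₀ : φ₀ ∈ L.cocycles) : L.IsInduced φ₀ (L.hat hφ₀) where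
  anchor_fst p a := fstVec_prodVec p (L.anchor p.1 a) (φ₀ p.1 a)
  anchor_snd p a := sndVec_prodVec p (L.anchor p.1 a) (φ₀ p.1 a)
  bracket_hat X Y := L.hatBracket_hat hφ₀.1 X Y

variable {L}
variable {Lhat : LieAlgebroid (I.prod 𝓘(ℝ, ℝ)) F (HatBundle I A)}

theorem IsInduced.anchor_eq (h : L.IsInduced φ₀ Lhat) : Lhat.anchor = L.hatAnchor φ₀ := by
  funext p
  refine LinearMap.ext fun a => prodVec_ext ?_ ?_
  · exact (h.anchor_fst p a).trans (fstVec_prodVec p _ _).symm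
  · exact (h.anchor_snd p a).trans (sndVec_prodVec p _ _).symm

theorem IsInduced.eq (h : L.IsInduced φ₀ Lhat)
    {Lhat' : LieAlgebroid (I.prod 𝓘(ℝ, ℝ)) F (HatBundle I A)} (h' : L.IsInduced φ₀ Lhat') :
    Lhat = Lhat' := by
  refine ext_of_isGenerating (isGenerating_hatSection I F A)
    (h.anchor_eq.trans h'.anchor_eq.symm) ?_
  rintro _ ⟨X, rfl⟩ _ ⟨Y, rfl⟩
  rw [h.bracket_hat, h'.bracket_hat]

end LieAlgebroid

end HatAlgebroid

/-! ### Modular forms and modular classes of `Â` -/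

namespace LieAlgebroid

variable {E : Type*} [NormedAddCommGroup E] [NormedSpace ℝ E]
  {H : Type*} [TopologicalSpace H] {I : ModelWithCorners ℝ E H}
  {M : Type*} [TopologicalSpace M] [ChartedSpace H M]
  {F : Type*} [NormedAddCommGroup F] [NormedSpace ℝ F]
  {A : M → Type*} [TopologicalSpace (TotalSpace F A)]
  [∀ x, AddCommGroup (A x)] [∀ x, Module ℝ (A x)] [∀ x, TopologicalSpace (A x)]
  [FiberBundle F A] [VectorBundle ℝ F A] [ContMDiffVectorBundle ∞ F A I]
  [FiniteDimensional ℝ E] [FiniteDimensional ℝ F] [IsManifold I ∞ M] [T2Space M]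
  {L : LieAlgebroid I F A} {φ₀ : ∀ x, A x →ₗ[ℝ] ℝ}
  {Lhat : LieAlgebroid (I.prod 𝓘(ℝ, ℝ)) F (HatBundle I A)}

theorem IsInduced.lieDerivFun_hat (h : L.IsInduced φ₀ Lhat) (X : SmoothSection I F A)
    {f : M → ℝ} (hf : ContMDiff I 𝓘(ℝ, ℝ) ∞ f) (p : M × ℝ) :
    Lhat.lieDerivFun (hatSection I X) (fun q => f q.1) p = L.lieDerivFun X f p.1 :=
  (dirDeriv_comp_fst p _ hf).trans
    (congrArg (fun v => dirDeriv I v f) (h.anchor_fst p (X p.1)))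

theorem IsInduced.lieDerivOneForm_hat (h : L.IsInduced φ₀ Lhat) (X : SmoothSection I F A)
    (α : oneForms I F A) (p : M × ℝ) :
    Lhat.lieDerivOneForm (hatSection I X) (hatForm α) p = L.lieDerivOneForm X α p.1 := by
  refine LinearMap.ext fun v => ?_
  obtain ⟨Y, rfl⟩ := exists_section_eq (I := I) (F := F) (A := A) p.1 v
  refine (Lhat.lieDerivOneForm_apply (hatSection I X) (hatForm α) (hatSection I Y) p).trans ?_
  rw [h.bracket_hat]
  refine Eq.trans ?_ (L.lieDerivOneForm_apply X α Y p.1).symm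
  rw [← h.lieDerivFun_hat X (α.2 Y)]
  rfl

theorem IsInduced.lieDerivMultivector_hat (h : L.IsInduced φ₀ Lhat) {n : ℕ}
    {η : ∀ x, (A x →ₗ[ℝ] ℝ) [⋀^Fin n]→ₗ[ℝ] ℝ} (hη : IsSmoothMultivector I F A η)
    (X : SmoothSection I F A) (α : Fin n → oneForms I F A) (p : M × ℝ) :
    Lhat.lieDerivMultivector (hatSection I X) (hatMultivector I η) (fun i => hatForm (α i)) p =
      L.lieDerivMultivector X η α p.1 := by
  rw [lieDerivMultivector, lieDerivMultivector, ← h.lieDerivFun_hat X (hη α)]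
  simp only [h.lieDerivOneForm_hat]
  rfl

theorem IsInduced.hatOneForm_mem_cocycles (h : L.IsInduced φ₀ Lhat) {α : ∀ x, A x →ₗ[ℝ] ℝ}
    (hα : α ∈ L.cocycles) : hatOneForm I α ∈ Lhat.cocycles := by
  refine Lhat.mem_cocycles_of_isGenerating (isGenerating_hatSection I F A)
    (hatOneForm_mem hα.1) ?_
  rintro _ ⟨X, rfl⟩ _ ⟨Y, rfl⟩ p
  rw [h.bracket_hat]
  refine Eq.trans ?_ (hα.2 X Y p.1)
  rw [← h.lieDerivFun_hat X (hα.1 Y), ← h.lieDerivFun_hat Y (hα.1 X)]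
  rfl

theorem IsInduced.hatOneForm_mem_coboundaries (h : L.IsInduced φ₀ Lhat)
    {α : ∀ x, A x →ₗ[ℝ] ℝ} (hα : α ∈ L.coboundaries) : hatOneForm I α ∈ Lhat.coboundaries := by
  obtain ⟨f, hf⟩ := hα
  refine ⟨hatFun f, fun p a => (hf p.1 a).trans ?_⟩
  exact ((dirDeriv_comp_fst p _ f.contMDiff).trans
    (congrArg (fun v => dirDeriv I v f) (h.anchor_fst p a))).symm

/-- On `Â` the form `φ₀` becomes exact: it is the differential of the coordinate `t`. -/
theorem IsInduced.hatOneForm_self_mem_coboundaries (h : L.IsInduced φ₀ Lhat) :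
    hatOneForm I φ₀ ∈ Lhat.coboundaries :=
  ⟨⟨fun p => p.2, contMDiff_snd⟩, fun p a =>
    ((dirDeriv_snd p _).trans (h.anchor_snd p a)).symm⟩

/-- The pullback `H¹(A) → H¹(Â)`. -/
def IsInduced.pullback (h : L.IsInduced φ₀ Lhat) : L.H1 →ₗ[ℝ] Lhat.H1 :=
  Submodule.mapQ _ _
    { toFun := fun α => ⟨hatOneForm I α.1, h.hatOneForm_mem_cocycles α.2⟩
      map_add' := fun _ _ => rfl
      map_smul' := fun _ _ => rfl }
    fun _ hα => h.hatOneForm_mem_coboundaries hα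

theorem IsInduced.hasClass_pullback (h : L.IsInduced φ₀ Lhat) {α : ∀ x, A x →ₗ[ℝ] ℝ} {c : L.H1}
    (hc : L.HasClass α c) : Lhat.HasClass (hatOneForm I α) (h.pullback c) := by
  obtain ⟨hα, rfl⟩ := hc
  exact ⟨h.hatOneForm_mem_cocycles hα, rfl⟩

theorem IsInduced.pullback_mk_self (h : L.IsInduced φ₀ Lhat) (hφ₀ : φ₀ ∈ L.cocycles) :
    h.pullback (Submodule.Quotient.mk ⟨φ₀, hφ₀⟩ : L.H1) = 0 :=
  (Submodule.Quotient.mk_eq_zero _).2 h.hatOneForm_self_mem_coboundaries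

variable [CompleteSpace E]

/-- `ℒ_{ρ̂(X)} (μ ∧ dt) = (ℒ_{ρ(X)} μ) ∧ dt`, evaluated on lifts of vector fields on `M` and on
`∂/∂t`. The term with `[ρ̂(X), ∂/∂t] = 0` vanishes since `⟨φ₀, X⟩` does not depend on time. -/
theorem IsInduced.lieDerivForm_wedgeDt (h : L.IsInduced φ₀ Lhat) (hφ₀ : φ₀ ∈ oneForms I F A)
    {d : ℕ} {μ : ∀ x : M, (TangentSpace I x) [⋀^Fin d]→ₗ[ℝ] ℝ} (hμ : IsSmoothForm I μ)
    (X : SmoothSection I F A) (W : Fin d → SmoothVectorField I M) (p : M × ℝ) :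
    lieDerivForm (I.prod 𝓘(ℝ, ℝ)) (fun q => Lhat.anchor q (hatSection I X q)) (wedgeDt I μ)
        (Fin.snoc (fun i => liftField (W i) 0) (liftField 0 1)) p =
      lieDerivForm I (fun y => L.anchor y (X y)) μ W p.1 := by
  set U : Fin (d + 1) → SmoothVectorField (I.prod 𝓘(ℝ, ℝ)) (M × ℝ) :=
    Fin.snoc (fun i => liftField (W i) 0) (liftField 0 1)
  have hUl : U (Fin.last d) = liftField 0 1 := Fin.snoc_last _ _
  have hUc : ∀ i : Fin d, U i.castSucc = liftField (W i) 0 := fun i => Fin.snoc_castSucc _ _ _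
  have hl1 : ∀ q : M × ℝ, fstVec q (liftField (0 : SmoothVectorField I M) 1 q) = 0 :=
    fun q => fstVec_prodVec q _ _
  have hl2 : ∀ q : M × ℝ, sndVec q (liftField (0 : SmoothVectorField I M) 1 q) = 1 :=
    fun q => sndVec_prodVec q _ _
  have hc1 : ∀ i (q : M × ℝ), fstVec q (liftField (W i) 0 q) = W i q.1 :=
    fun i q => fstVec_prodVec q _ _
  let V := Lhat.anchorField (hatSection I X)
  have hV1 : ∀ q, fstVec q (V q) = L.anchorField X q.1 := fun q => h.anchor_fst q (X q.1)
  let g : C^∞⟮I, M; ℝ⟯ := ⟨_, hφ₀ X⟩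
  have hV2 : ∀ q, sndVec q (V q) = g q.1 := fun q => h.anchor_snd q (X q.1)
  have hfun : (fun q => wedgeDt I μ q fun j => U j q) = fun q => μ q.1 fun j => W j q.1 := by
    funext q
    rw [wedgeDt_snoc μ q _ (by rw [hUl, hl1]) (by rw [hUl, hl2])]
    simp only [hUc, hc1]
  have h1 : dirDeriv (I.prod 𝓘(ℝ, ℝ)) (V p) (fun q => wedgeDt I μ q fun j => U j q) =
      dirDeriv I (L.anchorField X p.1) fun y => μ y fun j => W j y := by
    rw [hfun, dirDeriv_comp_fst p _ (hμ W), hV1]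
  have h2 : vfBracket V (liftField (0 : SmoothVectorField I M) 1) p = 0 := by
    refine prodVec_ext ?_ ?_
    · rw [fstVec_vfBracket (W' := 0) hV1 hl1, map_zero]
      have : vfBracket (L.anchorField X) 0 = 0 := (fieldDerivation (L.anchorField X)).nabla.map_zero
      rw [this]
      rfl
    · rw [sndVec_vfBracket (g := 1) hV2 hl2, hl1, map_zero, dirDeriv_zero_left, sub_zero]
      exact dirDeriv_const _ _
  have h3 : ∀ i : Fin d, wedgeDt I μ p (Function.update (fun j => U j p) i.castSucc
      (vfBracket V (U i.castSucc) p)) = μ p.1 (Function.update (fun j => W j p.1) i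
      (vfBracket (L.anchorField X) (W i) p.1)) := by
    intro i
    have hne : Fin.last d ≠ i.castSucc := (Fin.castSucc_lt_last i).ne'
    rw [wedgeDt_snoc μ p _ (by rw [Function.update_of_ne hne, hUl, hl1])
      (by rw [Function.update_of_ne hne, hUl, hl2])]
    congr 1
    funext j
    by_cases hj : j = i
    · subst hj
      rw [Function.update_self, Function.update_self, hUc, fstVec_vfBracket hV1 (hc1 j)]
    · rw [Function.update_of_ne hj, Function.update_of_ne
        (fun h => hj (Fin.castSucc_injective d h)), hUc, hc1]
  change dirDeriv (I.prod 𝓘(ℝ, ℝ)) (V p) (fun q => wedgeDt I μ q fun j => U j q) -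
    ∑ i, wedgeDt I μ p (Function.update (fun j => U j p) i (vfBracket V (U i) p)) =
    dirDeriv I (L.anchorField X p.1) (fun y => μ y fun j => W j y) -
    ∑ i, μ p.1 (Function.update (fun j => W j p.1) i (vfBracket (L.anchorField X) (W i) p.1))
  rw [h1, Fin.sum_univ_castSucc]
  simp only [h3]
  rw [hUl, h2, AlternatingMap.map_coord_zero (wedgeDt I μ p) (Fin.last d)
    (Function.update_self _ _ _), add_zero]

variable {n d : ℕ} {η : ∀ x, (A x →ₗ[ℝ] ℝ) [⋀^Fin n]→ₗ[ℝ] ℝ}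
  {μ : ∀ x : M, (TangentSpace I x) [⋀^Fin d]→ₗ[ℝ] ℝ}

/-- The modular form of `Â` with respect to `η ⊗ (μ ∧ dt)` is the pullback of that of `A`. Both are
determined by their values on time-independent sections, which can be compared after evaluation on
time-independent 1-forms, lifts of vector fields and `∂/∂t`. -/
theorem IsInduced.isModularForm_hatOneForm (h : L.IsInduced φ₀ Lhat) (hφ₀ : φ₀ ∈ oneForms I F A)
    (hn : Module.finrank ℝ F = n) (hd : Module.finrank ℝ E = d)
    (hη : IsTopSection I F A η) (hμ : IsVolumeForm I μ) {ξ : ∀ x, A x →ₗ[ℝ] ℝ}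
    (hξ : L.IsModularForm η μ ξ) :
    Lhat.IsModularForm (hatMultivector I η) (wedgeDt I μ) (hatOneForm I ξ) := by
  have hη' := (isTopSection_hatMultivector hη).isVolume hn
  have hμ' := (isVolumeForm_wedgeDt hμ).isVolume (d := d + 1) (by simp [hd])
  have hm := Lhat.isModularForm_modularForm hη' hμ'
  suffices Lhat.modularForm hη' hμ' = hatOneForm I ξ by rwa [this] at hm
  funext p
  refine LinearMap.ext fun v => ?_
  obtain ⟨X, rfl⟩ := exists_section_eq (I := I) (F := F) (A := A) p.1 v
  obtain ⟨α, hα⟩ := (formModule I F A).exists_apply_ne_zero (hη.ne_zero p.1)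
  obtain ⟨W, hW⟩ :=
    (sectionModule I E (TangentSpace I : M → Type _)).exists_apply_ne_zero (hμ.ne_zero p.1)
  refine mul_right_cancel₀ (mul_ne_zero hα hW) (Eq.trans ?_ (hξ.2 X α W p.1).symm)
  have h1 := hm.2 (hatSection I X) (fun i => hatForm (α i))
    (Fin.snoc (fun i => liftField (W i) 0) (liftField 0 1)) p
  have h2 : (wedgeDt I μ p fun j => (Fin.snoc (fun i => liftField (W i) 0) (liftField 0 1) :
      Fin (d + 1) → SmoothVectorField (I.prod 𝓘(ℝ, ℝ)) (M × ℝ)) j p) =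
      μ p.1 fun j => W j p.1 := by
    rw [wedgeDt_snoc μ p]
    · simp only [Fin.snoc_castSucc]
      congr 1
      funext i
      exact fstVec_prodVec p _ _
    · rw [Fin.snoc_last]
      exact fstVec_prodVec p _ _
    · rw [Fin.snoc_last]
      exact sndVec_prodVec p _ _
  rw [h.lieDerivForm_wedgeDt hφ₀ hμ.smooth, h.lieDerivMultivector_hat hη.smooth, h2] at h1
  exact h1

/-- Rescaling `η` by `e^{-(n-1)t}` subtracts `(n - 1) dt = (n - 1) φ₀` from the modular form. -/
theorem IsInduced.isModularForm_exp (h : L.IsInduced φ₀ Lhat) (hφ₀ : φ₀ ∈ oneForms I F A)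
    (hn : Module.finrank ℝ F = n) (hd : Module.finrank ℝ E = d)
    (hη : IsTopSection I F A η) (hμ : IsVolumeForm I μ) {ζ : ∀ x, A x →ₗ[ℝ] ℝ}
    (hζ : L.IsJacobiModularForm φ₀ η μ ζ) :
    Lhat.IsModularForm (expHatMultivector I η) (wedgeDt I μ) (hatOneForm I ζ) := by
  obtain ⟨ξ, hξ, rfl⟩ := hζ
  have hη' := (isTopSection_hatMultivector hη).isVolume hn
  have hη'' := (isTopSection_expHatMultivector hη).isVolume hn
  have hμ' := (isVolumeForm_wedgeDt hμ).isVolume (d := d + 1) (by simp [hd])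
  have hm := Lhat.isModularForm_modularForm hη'' hμ'
  suffices Lhat.modularForm hη'' hμ' = hatOneForm I (ξ - ((n : ℝ) - 1) • φ₀) by rwa [this] at hm
  have hξ' : Lhat.modularForm hη' hμ' = hatOneForm I ξ :=
    (Lhat.isModularForm_modularForm hη' hμ').eq hη' hμ'
      (h.isModularForm_hatOneForm hφ₀ hn hd hη hμ hξ)
  have hexp : ContDiff ℝ ∞ fun t : ℝ => Real.exp (-((n : ℝ) - 1) * t) :=
    Real.contDiff_exp.comp (contDiff_const.mul contDiff_id)
  let f : C^∞⟮I.prod 𝓘(ℝ, ℝ), M × ℝ; ℝ⟯ :=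
    ⟨fun p => Real.exp (-((n : ℝ) - 1) * p.2), hexp.contMDiff.comp contMDiff_snd⟩
  funext p
  refine LinearMap.ext fun v => ?_
  obtain ⟨X, rfl⟩ := exists_section_eq (I := I) (F := F) (A := A) p.1 v
  have h1 := (Lhat.formDerivation (hatSection I X)).div_mul hη' hη'' f (fun _ => rfl) p
  have h2 : dirDeriv (I.prod 𝓘(ℝ, ℝ)) (Lhat.anchor p (hatSection I X p)) f =
      φ₀ p.1 (X p.1) * (f p * -((n : ℝ) - 1)) := by
    refine (dirDeriv_comp_snd p _ hexp).trans ?_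
    have h3 : deriv (fun t : ℝ => Real.exp (-((n : ℝ) - 1) * t)) p.2 = f p * -((n : ℝ) - 1) := by
      have := ((hasDerivAt_id p.2).const_mul (-((n : ℝ) - 1))).exp.deriv
      rw [mul_one] at this
      exact this
    rw [h3]
    exact congrArg (· * _) (h.anchor_snd p (X p.1))
  have hf : f p ≠ 0 := (Real.exp_pos _).ne'
  change _ = _ + dirDeriv (I.prod 𝓘(ℝ, ℝ)) (Lhat.anchor p (hatSection I X p)) f at h1
  have h4 : (Lhat.formDerivation (hatSection I X)).div hη'' p =
      (Lhat.formDerivation (hatSection I X)).div hη' p - ((n : ℝ) - 1) * φ₀ p.1 (X p.1) := by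
    apply mul_left_cancel₀ hf
    rw [h1, h2]
    ring
  have h5 := Lhat.modularForm_apply hη' hμ' (hatSection I X) p
  have h6 := Lhat.modularForm_apply hη'' hμ' (hatSection I X) p
  rw [hξ'] at h5
  refine h6.trans ?_
  have h7 : hatOneForm I (ξ - ((n : ℝ) - 1) • φ₀) p (X p.1) =
      hatOneForm I ξ p (hatSection I X p) - ((n : ℝ) - 1) * φ₀ p.1 (X p.1) := rfl
  rw [h7, h5, h4]
  ring

end LieAlgebroid

end

theorem mainTheorem10 {m n : ℕ}
    {M : Type*} [TopologicalSpace M] [ChartedSpace (EuclideanSpace ℝ (Fin m)) M]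
    [IsManifold (𝓡 m) ∞ M] [T2Space M] [SecondCountableTopology M]
    {F : Type*} [NormedAddCommGroup F] [NormedSpace ℝ F] [FiniteDimensional ℝ F]
    (hF : Module.finrank ℝ F = n)
    {A : M → Type*} [TopologicalSpace (TotalSpace F A)]
    [∀ x, AddCommGroup (A x)] [∀ x, Module ℝ (A x)] [∀ x, TopologicalSpace (A x)]
    [FiberBundle F A] [VectorBundle ℝ F A] [ContMDiffVectorBundle ∞ F A (𝓡 m)]
    (L : LieAlgebroid (𝓡 m) F A)
    (φ₀ : ∀ x, A x →ₗ[ℝ] ℝ) (hφ₀ : φ₀ ∈ L.cocycles)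
    (η : ∀ x, (A x →ₗ[ℝ] ℝ) [⋀^Fin n]→ₗ[ℝ] ℝ) (hη : IsTopSection (𝓡 m) F A η)
    (μ : ∀ x : M, (TangentSpace (𝓡 m) x) [⋀^Fin m]→ₗ[ℝ] ℝ) (hμ : IsVolumeForm (𝓡 m) μ) :
    (∃! Lhat : LieAlgebroid ((𝓡 m).prod 𝓘(ℝ, ℝ)) F (HatBundle (𝓡 m) A), L.IsInduced φ₀ Lhat) ∧
    ∀ Lhat : LieAlgebroid ((𝓡 m).prod 𝓘(ℝ, ℝ)) F (HatBundle (𝓡 m) A), L.IsInduced φ₀ Lhat →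
      -- the explicit modular forms of `Â`
      IsTopSection ((𝓡 m).prod 𝓘(ℝ, ℝ)) F (HatBundle (𝓡 m) A) (hatMultivector (𝓡 m) η) ∧
      IsTopSection ((𝓡 m).prod 𝓘(ℝ, ℝ)) F (HatBundle (𝓡 m) A) (expHatMultivector (𝓡 m) η) ∧
      IsVolumeForm ((𝓡 m).prod 𝓘(ℝ, ℝ)) (wedgeDt (𝓡 m) μ) ∧
      (∀ ξ, L.IsModularForm η μ ξ →
        Lhat.IsModularForm (hatMultivector (𝓡 m) η) (wedgeDt (𝓡 m) μ) (hatOneForm (𝓡 m) ξ)) ∧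
      (∀ ζ, L.IsJacobiModularForm φ₀ η μ ζ →
        Lhat.IsModularForm (expHatMultivector (𝓡 m) η) (wedgeDt (𝓡 m) μ)
          (hatOneForm (𝓡 m) ζ)) ∧
      -- the equality of the classes in `H¹(Â)`, `p` being the pullback `H¹(A) → H¹(Â)`
      ∃ p : L.H1 →ₗ[ℝ] Lhat.H1,
        (∀ α c, L.HasClass α c → Lhat.HasClass (hatOneForm (𝓡 m) α) (p c)) ∧
        ∃ (modHat : Lhat.H1) (modJacobi modA : L.H1),
          Lhat.IsModularClass n (m + 1) modHat ∧
          L.IsJacobiModularClass n m φ₀ modJacobi ∧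
          L.IsModularClass n m modA ∧
          modHat = p modJacobi ∧ p modJacobi = p modA := by
  have hm : Module.finrank ℝ (EuclideanSpace ℝ (Fin m)) = m := finrank_euclideanSpace_fin
  refine ⟨⟨L.hat hφ₀, L.isInduced_hat hφ₀, fun Lhat h => h.eq (L.isInduced_hat hφ₀)⟩,
    fun Lhat h => ?_⟩
  have hη' := isTopSection_hatMultivector hη
  have hμ' := isVolumeForm_wedgeDt hμ
  refine ⟨hη', isTopSection_expHatMultivector hη, hμ',
    fun ξ hξ => h.isModularForm_hatOneForm hφ₀.1 hF hm hη hμ hξ,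
    fun ζ hζ => h.isModularForm_exp hφ₀.1 hF hm hη hμ hζ,
    h.pullback, fun α c hc => h.hasClass_pullback hc, ?_⟩
  have hA := L.isModularClass_mk hF hm (hη.isVolume hF) (hμ.isVolume hm)
  have hJ := hA.isJacobiModularClass hφ₀
  have hHat := Lhat.isModularClass_mk hF (d := m + 1) (by simp) (hη'.isVolume hF)
    (hμ'.isVolume (by simp))
  refine ⟨_, _, _, hHat, hJ, hA, ?_, ?_⟩
  · -- `e^{-(n-1)t} η ⊗ (μ ∧ dt)` is one of the sections computing the modular class of `Â`
    obtain ⟨⟨ζ, hζ, -⟩, hc⟩ := hJ η μ hη hμ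
    exact ((hHat _ _ (isTopSection_expHatMultivector hη) hμ').2 _
      (h.isModularForm_exp hφ₀.1 hF hm hη hμ hζ)).eq (h.hasClass_pullback (hc ζ hζ))
  · rw [map_sub, map_smul, h.pullback_mk_self hφ₀, smul_zero, sub_zero]
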